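/- Let $n\ge 2$ and let $\overline M$ be a connected smooth manifold of dimension $2n+1$ with an almost contact B-metric structure $(\overline\varphi,\overline\xi,\overline\eta,\overline g)$: smooth tensor fields with $\overline\varphi^2=-\mathrm{id}+\overline\eta\otimes\overline\xi$, $\overline\eta(\overline\xi)=1$, and a semi-Riemannian metric $\overline g$ with $\overline g(\overline\varphi X,\overline\varphi Y)=-\overline g(X,Y)+\overline\eta(X)\overline\eta(Y)$. Let $\overline\nabla$ be the Levi-Civita connection of $\overline g$, and $\overline{\widetilde\nabla}$ that of the associated metric $\overline{\widetilde g}(X,Y)=\overline g(X,\overline\varphi Y)+\overline\eta(X)\overline\eta(Y)$; let $\overline R$, $\overline{\widetilde R}$ be their curvature tensors, with $\overline R(X,Y,Z,W)=\overline g(\overline R(X,Y)Z,W)$ and $\overline{\widetilde R}(X,Y,Z,W)=\overline{\widetilde g}(\overline{\widetilde R}(X,Y)Z,W)$. Assume that $\overline M$ is an $\mathcal F_0$-manifold, i.e. $\overline g((\overline\nabla_X\overline\varphi)Y,Z)=0$ for all $X,Y,Z$, and that it is of pointwise constant totally real sectional curvatures: there are functions $\overline\nu,\overline{\widetilde\nu}$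 on $\overline M$ such that, for every $p\in\overline M$ and every $\overline g$-nondegenerate plane $\alpha=\mathrm{span}\{x,y\}\subset T_p\overline M$ with $\alpha\perp\overline\xi$ and $\overline\varphi\alpha\perp\alpha$, $$\frac{\overline R(x,y,y,x)}{\overline g(x,x)\overline g(y,y)-\overline g(x,y)^2}=\overline\nu(p),\qquad \frac{\overline{\widetilde R}(x,y,y,x)}{\overline g(x,x)\overline g(y,y)-\overline g(x,y)^2}=\overline{\widetilde\nu}(p).$$ Let $M$ be a non-empty (immersed) submanifold of $\overline M$ of codimension $2$ with induced (degenerate) metric $g$ that is half lightlike: the radical distribution $\mathrm{Rad}(TM)=TM\cap TM^\perp$ has rank $1$, and a screen distribution $S(TM)$ and a screen transversal bundle $S(TM^\perp)$ are given, that is, smooth distributions with $TM=\mathrm{Rad}(TM)\perp S(TM)$ and $TM^\perp=\mathrm{Rad}(TM)\perp S(TM^\perp)$. Let $\mathrm{ltr}(TM)$ be the line bundle spanned by the vectors $N$ such that $\overline g(N,\xi)=1$ for some $\xi\in\mathrm{Rad}(TM)$, $\overline g(N,N)=0$, and $N$ is orthogonal to $S(TM)$ and $S(TM^\perp)$; put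 $\mathrm{tr}(TM)=S(TM^\perp)\perp\mathrm{ltr}(TM)$, so that $T\overline M|_M=TM\oplus\mathrm{tr}(TM)$. Assume that $M$ is radical screen transversal, $\overline\varphi(\mathrm{Rad}(TM))=S(TM^\perp)$, and ascreen, $\overline\xi\in\mathrm{Rad}(TM)\oplus\mathrm{ltr}(TM)$ along $M$. Let $\nabla$ be the induced connection on $M$ and $h$ the second fundamental form, given by $\overline\nabla_XY=\nabla_XY+h(X,Y)$ with $\nabla_XY$ tangent to $M$ and $h(X,Y)\in\mathrm{tr}(TM)$. If $(M,g)$ is totally umbilical, i.e. locally $h(X,Y)=g(X,Y)H$ for a smooth section $H$ of $\mathrm{tr}(TM)$, then $(M,g)$ and $\overline M$ are flat: the curvature tensor $R$ of $\nabla$ vanishes identically on $M$ and the curvature tensor $\overline R$ of $\overline\nabla$ vanishes identically on $\overline M$. -/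

import Mathlib

open scoped Manifold ContDiff Topology

noncomputable section

namespace BMetric

/-- Smooth vector fields on a boundaryless manifold modelled on `E`. -/
def SmoothField {E : Type*} [NormedAddCommGroup E] [NormedSpace ℝ E]
    {M : Type*} [TopologicalSpace M] [ChartedSpace E M] [IsManifold 𝓘(ℝ, E) ∞ M]
    (X : (p : M) → TangentSpace 𝓘(ℝ, E) p) : Prop :=
  ContMDiff 𝓘(ℝ, E) (𝓘(ℝ, E).prod 𝓘(ℝ, E)) ∞
    (fun p => (⟨p, X p⟩ : TangentBundle 𝓘(ℝ, E) M))

/-- `nabla` is the Levi-Civita connection of the (semi-Riemannian) metric `g`: it is torsion-free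
and `v (g (Y, Z)) = g (∇_v Y, Z) + g (Y, ∇_v Z)`.  Recall Mathlib's argument order:
`nabla Y p v` is `∇_v Y` at `p`. -/
structure IsLeviCivita {E : Type*} [NormedAddCommGroup E] [NormedSpace ℝ E]
    [FiniteDimensional ℝ E]
    {M : Type*} [TopologicalSpace M] [ChartedSpace E M] [IsManifold 𝓘(ℝ, E) ∞ M]
    (nabla : CovariantDerivative 𝓘(ℝ, E) E (TangentSpace 𝓘(ℝ, E) : M → Type _))
    (g : (p : M) → TangentSpace 𝓘(ℝ, E) p → TangentSpace 𝓘(ℝ, E) p → ℝ) : Prop where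
  torsion_free : nabla.torsion = 0
  metric : ∀ (Y Z : (p : M) → TangentSpace 𝓘(ℝ, E) p) (p : M) (v : TangentSpace 𝓘(ℝ, E) p),
    MDifferentiableAt 𝓘(ℝ, E) (𝓘(ℝ, E).prod 𝓘(ℝ, E))
      (fun q => (⟨q, Y q⟩ : TangentBundle 𝓘(ℝ, E) M)) p →
    MDifferentiableAt 𝓘(ℝ, E) (𝓘(ℝ, E).prod 𝓘(ℝ, E))
      (fun q => (⟨q, Z q⟩ : TangentBundle 𝓘(ℝ, E) M)) p →
      mvfderiv 𝓘(ℝ, E) (fun q => g q (Y q) (Z q)) p v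
        = g p (nabla Y p v) (Z p) + g p (Y p) (nabla Z p v)

/-- The curvature `R(X, Y) Z = ∇_X ∇_Y Z - ∇_Y ∇_X Z - ∇_[X, Y] Z` of a linear connection. -/
def curvature {E : Type*} [NormedAddCommGroup E] [NormedSpace ℝ E]
    {M : Type*} [TopologicalSpace M] [ChartedSpace E M] [IsManifold 𝓘(ℝ, E) ∞ M]
    (nabla : CovariantDerivative 𝓘(ℝ, E) E (TangentSpace 𝓘(ℝ, E) : M → Type _))
    (X Y Z : (p : M) → TangentSpace 𝓘(ℝ, E) p) (p : M) : TangentSpace 𝓘(ℝ, E) p :=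
  nabla (fun q => nabla Z q (Y q)) p (X p) - nabla (fun q => nabla Z q (X q)) p (Y p)
    - nabla Z p (VectorField.mlieBracket 𝓘(ℝ, E) X Y p)

/-- A linear connection is flat if its curvature tensor vanishes identically. -/
def IsFlat {E : Type*} [NormedAddCommGroup E] [NormedSpace ℝ E]
    {M : Type*} [TopologicalSpace M] [ChartedSpace E M] [IsManifold 𝓘(ℝ, E) ∞ M]
    (nabla : CovariantDerivative 𝓘(ℝ, E) E (TangentSpace 𝓘(ℝ, E) : M → Type _)) : Prop :=
  ∀ X Y Z : (p : M) → TangentSpace 𝓘(ℝ, E) p,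
    SmoothField X → SmoothField Y → SmoothField Z → ∀ p, curvature nabla X Y Z p = 0

/-- An almost contact B-metric structure `(φ, ξ, η, g)` on a manifold: smooth tensor fields with
`φ² = -id + η ⊗ ξ`, `η(ξ) = 1`, and a semi-Riemannian metric `g` (symmetric and nondegenerate)
with `g(φ X, φ Y) = - g(X, Y) + η(X) η(Y)`. -/
structure AlmostContactBMetric (E : Type*) [NormedAddCommGroup E] [NormedSpace ℝ E]
    (M : Type*) [TopologicalSpace M] [ChartedSpace E M] [IsManifold 𝓘(ℝ, E) ∞ M] where
  phi : (p : M) → TangentSpace 𝓘(ℝ, E) p →L[ℝ] TangentSpace 𝓘(ℝ, E) p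
  xi : (p : M) → TangentSpace 𝓘(ℝ, E) p
  eta : (p : M) → TangentSpace 𝓘(ℝ, E) p →L[ℝ] ℝ
  g : (p : M) → TangentSpace 𝓘(ℝ, E) p →L[ℝ] TangentSpace 𝓘(ℝ, E) p →L[ℝ] ℝ
  smooth_phi : ContMDiff 𝓘(ℝ, E) (𝓘(ℝ, E).prod 𝓘(ℝ, E →L[ℝ] E)) ∞
    (fun p => Bundle.TotalSpace.mk' (E →L[ℝ] E)
      (E := fun p : M => TangentSpace 𝓘(ℝ, E) p →L[ℝ] TangentSpace 𝓘(ℝ, E) p) p (phi p))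
  smooth_xi : SmoothField xi
  smooth_eta : ContMDiff 𝓘(ℝ, E) (𝓘(ℝ, E).prod 𝓘(ℝ, E →L[ℝ] ℝ)) ∞
    (fun p => Bundle.TotalSpace.mk' (E →L[ℝ] ℝ)
      (E := fun p : M => TangentSpace 𝓘(ℝ, E) p →L[ℝ] ℝ) p (eta p))
  smooth_g : ContMDiff 𝓘(ℝ, E) (𝓘(ℝ, E).prod 𝓘(ℝ, E →L[ℝ] E →L[ℝ] ℝ)) ∞
    (fun p => Bundle.TotalSpace.mk' (E →L[ℝ] E →L[ℝ] ℝ)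
      (E := fun p : M => TangentSpace 𝓘(ℝ, E) p →L[ℝ] TangentSpace 𝓘(ℝ, E) p →L[ℝ] ℝ) p (g p))
  phi_sq : ∀ p (u : TangentSpace 𝓘(ℝ, E) p), phi p (phi p u) = -u + eta p u • xi p
  eta_xi : ∀ p, eta p (xi p) = 1
  g_symm : ∀ p (u v : TangentSpace 𝓘(ℝ, E) p), g p u v = g p v u
  g_nondegenerate : ∀ p (u : TangentSpace 𝓘(ℝ, E) p), (∀ v, g p u v = 0) → u = 0
  g_phi : ∀ p (u v : TangentSpace 𝓘(ℝ, E) p),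
    g p (phi p u) (phi p v) = - g p u v + eta p u * eta p v

namespace AlmostContactBMetric

variable {E : Type*} [NormedAddCommGroup E] [NormedSpace ℝ E]
  {M : Type*} [TopologicalSpace M] [ChartedSpace E M] [IsManifold 𝓘(ℝ, E) ∞ M]
  (A : AlmostContactBMetric E M)

/-- The metric `g` as a plain family of functions of two vectors. -/
def metric (p : M) (u v : TangentSpace 𝓘(ℝ, E) p) : ℝ := A.g p u v

/-- The associated B-metric `g̃(X, Y) = g(X, φ Y) + η(X) η(Y)`. -/
def assocMetric (p : M) (u v : TangentSpace 𝓘(ℝ, E) p) : ℝ :=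
  A.g p u (A.phi p v) + A.eta p u * A.eta p v

/-- The class `F₀`: the tensor `F(X, Y, Z) = g((∇_X φ) Y, Z)` vanishes, where `nabla` is the
Levi-Civita connection of `g` and `(∇_X φ) Y = ∇_X (φ Y) - φ (∇_X Y)`. -/
def IsF0 (nabla : CovariantDerivative 𝓘(ℝ, E) E (TangentSpace 𝓘(ℝ, E) : M → Type _)) : Prop :=
  ∀ X Y Z : (p : M) → TangentSpace 𝓘(ℝ, E) p,
    SmoothField X → SmoothField Y → SmoothField Z → ∀ p,
      A.g p (nabla (fun q => A.phi q (Y q)) p (X p) - A.phi p (nabla Y p (X p))) (Z p) = 0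

/-- `g(u, u) g(v, v) - g(u, v)²`; the section `span {u, v}` is nondegenerate iff it is nonzero. -/
def gram (p : M) (u v : TangentSpace 𝓘(ℝ, E) p) : ℝ :=
  A.g p u u * A.g p v v - (A.g p u v) ^ 2

/-- A subspace `α` of `T_p M` is totally real if `φ α` is `g`-orthogonal to `α`. -/
def IsTotallyReal (p : M) (α : Submodule ℝ (TangentSpace 𝓘(ℝ, E) p)) : Prop :=
  ∀ u ∈ α, ∀ v ∈ α, A.g p (A.phi p u) v = 0

/-- The manifold is of pointwise constant totally real sectional curvatures `ν(p)`, `ν̃(p)` of the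
nondegenerate totally real sections `α = span {x, y}` orthogonal to `ξ`:
`R(x, y, y, x) / gram = ν(p)` and `R̃(x, y, y, x) / gram = ν̃(p)`, where
`R(x, y, z, w) = g(R(x, y) z, w)` and `R̃(x, y, z, w) = g̃(R̃(x, y) z, w)`, for the
Levi-Civita connections `nabla` of `g` and `nablaT` of `g̃`.
Tangent vectors are written as values of smooth fields. -/
def HasTotallyRealCurvatures
    (nabla nablaT : CovariantDerivative 𝓘(ℝ, E) E (TangentSpace 𝓘(ℝ, E) : M → Type _))
    (nu nuT : M → ℝ) : Prop :=
  ∀ X Y : (p : M) → TangentSpace 𝓘(ℝ, E) p, SmoothField X → SmoothField Y → ∀ p,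
    A.gram p (X p) (Y p) ≠ 0 →
    A.IsTotallyReal p (Submodule.span ℝ {X p, Y p}) →
    (∀ u ∈ Submodule.span ℝ {X p, Y p}, A.g p u (A.xi p) = 0) →
      A.metric p (curvature nabla X Y Y p) (X p) / A.gram p (X p) (Y p) = nu p ∧
      A.assocMetric p (curvature nablaT X Y Y p) (X p) / A.gram p (X p) (Y p) = nuT p

end AlmostContactBMetric

section Submanifold

variable {E : Type*} [NormedAddCommGroup E] [NormedSpace ℝ E]
  {Mbar : Type*} [TopologicalSpace Mbar] [ChartedSpace E Mbar] [IsManifold 𝓘(ℝ, E) ∞ Mbar]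
  {E' : Type*} [NormedAddCommGroup E'] [NormedSpace ℝ E']
  {M : Type*} [TopologicalSpace M] [ChartedSpace E' M] [IsManifold 𝓘(ℝ, E') ∞ M]

/-- The differential of `ι : M → M̄` at `x`. -/
def dmap (ι : M → Mbar) (x : M) :
    TangentSpace 𝓘(ℝ, E') x →L[ℝ] TangentSpace 𝓘(ℝ, E) (ι x) :=
  mfderiv 𝓘(ℝ, E') 𝓘(ℝ, E) ι x

/-- Vector fields along `ι` that are smooth on `U`. -/
def SmoothAlongOn (ι : M → Mbar) (V : (x : M) → TangentSpace 𝓘(ℝ, E) (ι x)) (U : Set M) : Prop :=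
  ContMDiffOn 𝓘(ℝ, E') (𝓘(ℝ, E).prod 𝓘(ℝ, E)) ∞
    (fun x => (⟨ι x, V x⟩ : TangentBundle 𝓘(ℝ, E) Mbar)) U

/-- The metric induced on `M` by the ambient metric `g`. -/
def inducedMetric (A : AlmostContactBMetric E Mbar) (ι : M → Mbar) (x : M)
    (v w : TangentSpace 𝓘(ℝ, E') x) : ℝ :=
  A.g (ι x) (dmap ι x v) (dmap ι x w)

/-- The radical subspace `Rad(T_x M)` of the induced metric. -/
def radical (A : AlmostContactBMetric E Mbar) (ι : M → Mbar) (x : M) :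
    Submodule ℝ (TangentSpace 𝓘(ℝ, E') x) where
  carrier := {v | ∀ w, inducedMetric A ι x v w = 0}
  add_mem' := by
    intro a b ha hb w
    have h1 := ha w
    have h2 := hb w
    simp only [inducedMetric] at h1 h2 ⊢
    simp [h1, h2]
  zero_mem' := by
    intro w
    simp [inducedMetric]
  smul_mem' := by
    intro c a ha w
    have h1 := ha w
    simp only [inducedMetric] at h1 ⊢
    simp [h1]

/-- A subspace of `T_x M`, seen in `T_{ι x} M̄` through the differential of `ι`. -/
def push (ι : M → Mbar) (x : M) (V : Submodule ℝ (TangentSpace 𝓘(ℝ, E') x)) :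
    Submodule ℝ (TangentSpace 𝓘(ℝ, E) (ι x)) :=
  V.map (dmap (E := E) (E' := E') ι x).toLinearMap

/-- The normal space `T_x M^⊥` in `T_{ι x} M̄`. -/
def normalSpace (A : AlmostContactBMetric E Mbar) (ι : M → Mbar) (x : M) :
    Submodule ℝ (TangentSpace 𝓘(ℝ, E) (ι x)) where
  carrier := {u | ∀ w : TangentSpace 𝓘(ℝ, E') x, A.g (ι x) u (dmap ι x w) = 0}
  add_mem' := by
    intro a b ha hb w
    have h1 := ha w
    have h2 := hb w
    simp [h1, h2]
  zero_mem' := by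
    intro w
    simp
  smul_mem' := by
    intro c a ha w
    have h1 := ha w
    simp [h1]

/-- `ι : M → M̄` is a half lightlike submanifold (an immersed submanifold of codimension two whose
radical distribution has rank one), with screen distribution `S = S(TM)` and screen transversal
bundle `St = S(TM^⊥)`: smooth distributions with `TM = Rad(TM) ⊥ S(TM)` and
`TM^⊥ = Rad(TM) ⊥ S(TM^⊥)`.  (Orthogonality of both sums and nondegeneracy of `S` and `St` are
automatic.) -/
structure IsHalfLightlike (A : AlmostContactBMetric E Mbar) (ι : M → Mbar)
    (S : (x : M) → Submodule ℝ (TangentSpace 𝓘(ℝ, E') x))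
    (St : (x : M) → Submodule ℝ (TangentSpace 𝓘(ℝ, E) (ι x))) : Prop where
  immersion : Manifold.IsImmersion 𝓘(ℝ, E') 𝓘(ℝ, E) ∞ ι
  codim_two : Module.finrank ℝ E' + 2 = Module.finrank ℝ E
  rank_radical : ∀ x, Module.finrank ℝ (radical (E' := E') A ι x) = 1
  screen_isCompl : ∀ x, IsCompl (radical (E' := E') A ι x) (S x)
  transversal_disjoint : ∀ x, Disjoint (push ι x (radical (E' := E') A ι x)) (St x)
  transversal_sup : ∀ x, push ι x (radical (E' := E') A ι x) ⊔ St x = normalSpace (E' := E') A ι x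
  smooth_screen : ∀ x₀, ∀ v ∈ S x₀, ∃ V : (x : M) → TangentSpace 𝓘(ℝ, E') x,
    SmoothField V ∧ (∀ x, V x ∈ S x) ∧ V x₀ = v
  smooth_transversal : ∀ x₀, ∀ v ∈ St x₀, ∃ V : (x : M) → TangentSpace 𝓘(ℝ, E) (ι x),
    SmoothAlongOn (E' := E') ι V Set.univ ∧ (∀ x, V x ∈ St x) ∧ V x₀ = v

/-- The lightlike transversal space `ltr(T_x M)`: it is spanned by the vectors `N` with, for some
`ζ` in the radical, `g(N, ζ) = 1`, `g(N, N) = 0` and `N` orthogonal to `S(TM)` and `S(TM^⊥)`. -/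
def ltr (A : AlmostContactBMetric E Mbar) (ι : M → Mbar)
    (S : (x : M) → Submodule ℝ (TangentSpace 𝓘(ℝ, E') x))
    (St : (x : M) → Submodule ℝ (TangentSpace 𝓘(ℝ, E) (ι x))) (x : M) :
    Submodule ℝ (TangentSpace 𝓘(ℝ, E) (ι x)) :=
  Submodule.span ℝ {N | (∃ ζ ∈ radical (E' := E') A ι x, A.g (ι x) N (dmap ι x ζ) = 1) ∧
    A.g (ι x) N N = 0 ∧ (∀ s ∈ S x, A.g (ι x) N (dmap ι x s) = 0) ∧
    ∀ l ∈ St x, A.g (ι x) N l = 0}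

/-- The transversal space `tr(T_x M) = S(T_x M^⊥) ⊥ ltr(T_x M)`. -/
def tr (A : AlmostContactBMetric E Mbar) (ι : M → Mbar)
    (S : (x : M) → Submodule ℝ (TangentSpace 𝓘(ℝ, E') x))
    (St : (x : M) → Submodule ℝ (TangentSpace 𝓘(ℝ, E) (ι x))) (x : M) :
    Submodule ℝ (TangentSpace 𝓘(ℝ, E) (ι x)) :=
  St x ⊔ ltr A ι S St x

/-- Radical screen transversal: `φ(Rad(TM)) = S(TM^⊥)`. -/
def IsRSTHL (E' : Type*) [NormedAddCommGroup E'] [NormedSpace ℝ E']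
    [ChartedSpace E' M] [IsManifold 𝓘(ℝ, E') ∞ M] (A : AlmostContactBMetric E Mbar) (ι : M → Mbar)
    (St : (x : M) → Submodule ℝ (TangentSpace 𝓘(ℝ, E) (ι x))) : Prop :=
  ∀ x, (push ι x (radical (E' := E') A ι x)).map
    (A.phi (ι x)).toLinearMap = St x

/-- Ascreen: the Reeb field `ξ` of the ambient manifold lies in `Rad(TM) ⊕ ltr(TM)` along `M`. -/
def IsAscreen (A : AlmostContactBMetric E Mbar) (ι : M → Mbar)
    (S : (x : M) → Submodule ℝ (TangentSpace 𝓘(ℝ, E') x))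
    (St : (x : M) → Submodule ℝ (TangentSpace 𝓘(ℝ, E) (ι x))) : Prop :=
  ∀ x, A.xi (ι x) ∈ push ι x (radical (E' := E') A ι x) ⊔ ltr A ι S St x

/-- The field `Yb` on `M̄` extends the tangent field `Y` of `M` near `x`. -/
def ExtendsAt (ι : M → Mbar) (Y : (x : M) → TangentSpace 𝓘(ℝ, E') x)
    (Yb : (p : Mbar) → TangentSpace 𝓘(ℝ, E) p) (x : M) : Prop :=
  ∀ᶠ z in 𝓝 x, Yb (ι z) = dmap ι z (Y z)

/-- `∇̄_v Y - ∇_v Y`, where `∇̄_v Y` is computed with an extension `Yb` of `Y`; for the induced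
connection `D = ∇` this is the second fundamental form `h(v, Y)`. -/
def gaussDefect (nabla : CovariantDerivative 𝓘(ℝ, E) E (TangentSpace 𝓘(ℝ, E) : Mbar → Type _))
    (D : CovariantDerivative 𝓘(ℝ, E') E' (TangentSpace 𝓘(ℝ, E') : M → Type _))
    (ι : M → Mbar) (Y : (x : M) → TangentSpace 𝓘(ℝ, E') x)
    (Yb : (p : Mbar) → TangentSpace 𝓘(ℝ, E) p) (x : M) (v : TangentSpace 𝓘(ℝ, E') x) :
    TangentSpace 𝓘(ℝ, E) (ι x) :=
  nabla Yb (ι x) (dmap ι x v) - dmap ι x (D Y x v)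

/-- `D` is the connection `∇` on `TM` induced by `∇̄` and the splitting `TM̄ = TM ⊕ tr(TM)`:
`∇_v Y` is the tangential part of `∇̄_v Y` (Gauss formula
`∇̄_v Y = ∇_v Y + h(v, Y)` with `h(v, Y)` in `tr(TM)`). -/
def IsInducedConnection (A : AlmostContactBMetric E Mbar)
    (nabla : CovariantDerivative 𝓘(ℝ, E) E (TangentSpace 𝓘(ℝ, E) : Mbar → Type _))
    (ι : M → Mbar) (S : (x : M) → Submodule ℝ (TangentSpace 𝓘(ℝ, E') x))
    (St : (x : M) → Submodule ℝ (TangentSpace 𝓘(ℝ, E) (ι x)))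
    (D : CovariantDerivative 𝓘(ℝ, E') E' (TangentSpace 𝓘(ℝ, E') : M → Type _)) : Prop :=
  ∀ (Y : (x : M) → TangentSpace 𝓘(ℝ, E') x) (Yb : (p : Mbar) → TangentSpace 𝓘(ℝ, E) p),
    SmoothField Y → SmoothField Yb → ∀ x, ExtendsAt ι Y Yb x →
      ∀ v : TangentSpace 𝓘(ℝ, E') x, gaussDefect nabla D ι Y Yb x v ∈ tr A ι S St x

/-- Totally umbilical: locally there is a smooth section `H` of `tr(TM)` with
`h(X, Y) = g(X, Y) H`. -/
def IsTotallyUmbilical (A : AlmostContactBMetric E Mbar)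
    (nabla : CovariantDerivative 𝓘(ℝ, E) E (TangentSpace 𝓘(ℝ, E) : Mbar → Type _))
    (ι : M → Mbar) (S : (x : M) → Submodule ℝ (TangentSpace 𝓘(ℝ, E') x))
    (St : (x : M) → Submodule ℝ (TangentSpace 𝓘(ℝ, E) (ι x)))
    (D : CovariantDerivative 𝓘(ℝ, E') E' (TangentSpace 𝓘(ℝ, E') : M → Type _)) : Prop :=
  ∀ x₀ : M, ∃ U : Set M, IsOpen U ∧ x₀ ∈ U ∧
    ∃ H : (x : M) → TangentSpace 𝓘(ℝ, E) (ι x),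
      SmoothAlongOn (E' := E') ι H U ∧ (∀ x ∈ U, H x ∈ tr A ι S St x) ∧
      ∀ (Y : (x : M) → TangentSpace 𝓘(ℝ, E') x) (Yb : (p : Mbar) → TangentSpace 𝓘(ℝ, E) p),
        SmoothField Y → SmoothField Yb → ∀ x ∈ U, ExtendsAt ι Y Yb x →
          ∀ v : TangentSpace 𝓘(ℝ, E') x,
            gaussDefect nabla D ι Y Yb x v = inducedMetric A ι x v (Y x) • H x

end Submanifold

end BMetric

end

set_option maxSynthPendingDepth 3
set_option linter.unusedSectionVars false

noncomputable section

namespace BMetric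

/-! ### Unique continuation across a sphere by a maximum principle. -/

section


section UniqueContinuation

open Filter Set Metric

/-! On an $\mathcal F_0$-manifold $\overline\varphi$ is parallel. Hence $\overline{\widetilde g}$ is
parallel for $\overline\nabla$, the two Levi-Civita connections coincide, and the curvature tensor
commutes with $\overline\varphi$ in every slot. With $i$ acting as $\overline\varphi$, it becomes
complex multilinear for the complex form $G=(\overline
g-\overline\eta\otimes\overline\eta)-i\,\overline g(\cdot,\overline\varphi\cdot)$. The two totally
real sectional curvatures are, up to sign, the real and imaginary parts of one complex sectional
curvature, so $\overline R(x,y)z=c\,(G(y,z)x-G(x,z)y)$ with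
$c=\overline\nu-i\overline{\widetilde\nu}$ (`IsCurvature.eq_model`). Since $G$ and
$\overline\varphi$ are parallel, the second Bianchi identity reduces to
$dc\circ\overline\varphi=i\,dc$ (`holomorphic_of_model`). In particular $dc(\overline\xi)=0$.

Along $M$, let $\zeta$ span the radical. The normal space is spanned by $\zeta$ and
$\overline\varphi\zeta$, and the ascreen condition gives $\overline\eta(\zeta)\ne0$ and
$\overline\eta=0$ on the screen. So $\overline\varphi$ maps screen vectors to tangent vectors.
Differentiating $\overline\varphi V$ for a screen field $V$ and pairing with $\zeta$ gives a
proportionality between $g(\cdot,V)$ and $g(\cdot,\overline\varphi V)$ that forces $H=0$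
(`christoffel_map`). Then $M$ is autoparallel and $\overline R$ preserves $TM$. But $\overline
R(\zeta,t)s$ is a complex multiple of $\zeta$, which is tangent only if it vanishes, so $c=0$ on $M$
(`eq_zero_of_model`) and $\nabla$ is flat.

It remains to propagate $c=0$ from $M$ to $\overline M$. Modulo the direction $\overline\xi$, which
is transverse to $M$ and along which $c$ is constant, $M$ is a real hypersurface in a complex
manifold, and a holomorphic function vanishing there vanishes nearby. Complex coordinates are
avoided: $\log|f|$ is annihilated by a degenerate second-order operator, and a maximum principle
with an exponential barrier gives unique continuation across spheres, then hyperplanes, then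
codimension two (`eventually_eq_zero_of_codim_two`). Connectedness of $\overline M$ concludes. -/

/-- Second derivative test at a local maximum. -/
theorem second_deriv_nonpos_of_isLocalMax {g g₁ : ℝ → ℝ} {g₂ : ℝ}
    (hg : ∀ᶠ t in 𝓝 (0 : ℝ), HasDerivAt g (g₁ t) t) (hg₁ : HasDerivAt g₁ g₂ 0)
    (hmax : IsLocalMax g 0) : g₂ ≤ 0 := by
  by_contra! hpos
  have hd : deriv g =ᶠ[𝓝 0] g₁ := hg.mono fun t ht => ht.deriv
  have hdd : deriv (deriv g) 0 = g₂ := by rw [hd.deriv_eq, hg₁.deriv]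
  -- A positive second derivative would make $0$ a local minimum as well, so $g$ would be constant
  -- near $0$ and its second derivative zero.
  have hmin : IsLocalMin g 0 := isLocalMin_of_deriv_deriv_pos (by rw [hdd]; exact hpos)
    hmax.deriv_eq_zero hg.self_of_nhds.continuousAt
  have hconst : g =ᶠ[𝓝 0] fun _ => g 0 := by
    filter_upwards [hmin, hmax] with t h1 h2 using le_antisymm h2 h1
  have : deriv g =ᶠ[𝓝 0] fun _ => 0 := by
    filter_upwards [hconst.eventuallyEq_nhds] with t ht
    rw [ht.deriv_eq]; simp
  rw [this.deriv_eq] at hdd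
  simp at hdd
  exact hpos.ne hdd

/-- For a function `h` with `dh ∘ φ = i dh`, where `φ` is a field of endomorphisms, the operator
`D²(e, e) + D²(φ e, φ e)` acts on `h` as a first-order operator. -/
theorem hessian_of_holomorphic {V : Type*} [NormedAddCommGroup V] [NormedSpace ℝ V]
    {φ : V → V →L[ℝ] V} {φ' : V →L[ℝ] V →L[ℝ] V} {h : V → ℂ} {Dh : V → V →L[ℝ] ℂ}
    {D2 : V →L[ℝ] V →L[ℝ] ℂ} {x : V}
    (hh : ∀ᶠ y in 𝓝 x, HasFDerivAt h (Dh y) y) (hDh : HasFDerivAt Dh D2 x)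
    (hφ : HasFDerivAt φ φ' x)
    (hol : ∀ᶠ y in 𝓝 x, ∀ v, Dh y (φ y v) = Complex.I * Dh y v) (e : V) :
    D2 e e + D2 (φ x e) (φ x e) + Dh x (φ' (φ x e) e + φ x (φ' e e)) = 0 := by
  have hsymm : ∀ a b, D2 a b = D2 b a := fun a b =>
    second_derivative_symmetric_of_eventually hh hDh a b
  -- This is the equation $dh(\varphi v)=i\,dh(v)$ differentiated in the direction $w$. It is used
  -- for $(w,v)=(\varphi e,e)$ and $(e,e)$; symmetry of $D^2h$ eliminates the mixed term. The
  -- relation $\varphi^2=-1$ is not needed, so `φ` may be any field of endomorphisms.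
  have key : ∀ w v, D2 w (φ x v) + Dh x (φ' w v) = Complex.I * D2 w v := by
    intro w v
    have h1 : HasFDerivAt (fun y => Dh y (φ y v))
        ((Dh x).comp (φ'.flip v) + D2.flip (φ x v)) x :=
      hDh.clm_apply (hφ.clm_apply (hasFDerivAt_const v x) |>.congr_fderiv (by ext; simp))
    have h2 : HasFDerivAt (fun y => Complex.I * Dh y v) (Complex.I • D2.flip v) x := by
      have := (hDh.clm_apply (hasFDerivAt_const v x)).const_mul Complex.I
      exact this.congr_fderiv (by ext; simp)
    have h3 := h1.unique (h2.congr_of_eventuallyEq (hol.mono fun y hy => hy v))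
    have := congrArg (fun L => L w) h3
    simp at this
    linear_combination this
  have k1 := key (φ x e) e
  have k2 := key e e
  have k3 := hol.self_of_nhds (φ' e e)
  rw [hsymm (φ x e) e] at k1
  rw [map_add]
  linear_combination k1 + Complex.I * k2 + k3 + D2 e e * Complex.I_mul_I

variable {V : Type*} [NormedAddCommGroup V] [InnerProductSpace ℝ V]

open scoped RealInnerProductSpace

/-- The second derivatives of `log |f| + K exp (-l |y - x₁|²)` at a local maximum. -/
theorem barrier_at_isLocalMax {h : V → ℂ} {Dh : V → V →L[ℝ] ℂ}
    {D2 : V →L[ℝ] V →L[ℝ] ℂ} {x : V}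
    (hh : ∀ᶠ y in 𝓝 x, HasFDerivAt h (Dh y) y) (hDh : HasFDerivAt Dh D2 x)
    (K l : ℝ) (x₁ : V)
    (hmax : IsLocalMax (fun y => (h y).re + K * Real.exp (-l * ‖y - x₁‖ ^ 2)) x) (a : V) :
    (Dh x a).re + K * (Real.exp (-l * ‖x - x₁‖ ^ 2) * (-l * (2 * ⟪x - x₁, a⟫))) = 0 ∧
    (D2 a a).re + K * (Real.exp (-l * ‖x - x₁‖ ^ 2) *
      ((-l * (2 * ⟪x - x₁, a⟫)) ^ 2 + (-l * (2 * ‖a‖ ^ 2)))) ≤ 0 := by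
  have hline : ∀ t : ℝ, HasDerivAt (fun t : ℝ => x + t • a) a t := fun t => by
    simpa using ((hasDerivAt_id t).smul_const a).const_add x
  have hcont : Tendsto (fun t : ℝ => x + t • a) (𝓝 0) (𝓝 x) := by
    have := (hline 0).continuousAt.tendsto
    simpa using this
  set g : ℝ → ℝ := fun t => (h (x + t • a)).re + K * Real.exp (-l * ‖x + t • a - x₁‖ ^ 2)
  set g₁ : ℝ → ℝ := fun t => (Dh (x + t • a) a).re +
    K * (Real.exp (-l * ‖x + t • a - x₁‖ ^ 2) * (-l * (2 * ⟪x + t • a - x₁, a⟫)))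
  have hq : ∀ t : ℝ, HasDerivAt (fun t : ℝ => -l * ‖x + t • a - x₁‖ ^ 2)
      (-l * (2 * ⟪x + t • a - x₁, a⟫)) t := fun t =>
    (((hline t).sub_const x₁).norm_sq).const_mul (-l)
  have hg : ∀ᶠ t in 𝓝 (0 : ℝ), HasDerivAt g (g₁ t) t := by
    filter_upwards [hcont.eventually hh] with t ht
    have h1 := Complex.reCLM.hasFDerivAt.comp_hasDerivAt t (ht.comp_hasDerivAt t (hline t))
    exact h1.add (((hq t).exp).const_mul K)
  have hg₁ : HasDerivAt g₁ ((D2 a a).re + K * (Real.exp (-l * ‖x - x₁‖ ^ 2) *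
      ((-l * (2 * ⟪x - x₁, a⟫)) ^ 2 + (-l * (2 * ‖a‖ ^ 2))))) 0 := by
    have h0 : HasFDerivAt Dh D2 (x + (0 : ℝ) • a) := by simpa using hDh
    have h1 : HasFDerivAt (fun y => Dh y a) (D2.flip a) (x + (0 : ℝ) • a) :=
      (h0.clm_apply (hasFDerivAt_const a _)).congr_fderiv (by ext; simp)
    have h2 : HasDerivAt (fun t : ℝ => (Dh (x + t • a) a).re) (D2 a a).re 0 :=
      have h1' : HasDerivAt (fun t : ℝ => Dh (x + t • a) a) (D2 a a) 0 :=
        (HasFDerivAt.comp_hasDerivAt (0 : ℝ) (f := fun t : ℝ => x + t • a) h1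
          (hline 0)).congr_deriv (by simp)
      Complex.reCLM.hasFDerivAt.comp_hasDerivAt (0 : ℝ) h1'
    have h3 : HasDerivAt (fun t : ℝ => -l * (2 * ⟪x + t • a - x₁, a⟫))
        (-l * (2 * ‖a‖ ^ 2)) 0 := by
      have := (((hline 0).sub_const x₁).inner ℝ (hasDerivAt_const (0 : ℝ) a)).const_mul 2
      have := this.const_mul (-l)
      refine this.congr_deriv ?_
      simp
    have h4 := (((hq 0).exp.mul h3)).const_mul K
    refine (h2.add h4).congr_deriv ?_
    simp only [zero_smul, add_zero]
    ring
  have hmax' : IsLocalMax g 0 := by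
    have : ∀ᶠ t in 𝓝 (0 : ℝ), g t ≤ g 0 := by
      filter_upwards [hcont.eventually hmax] with t ht
      simpa [g] using ht
    exact this
  refine ⟨?_, second_deriv_nonpos_of_isLocalMax hg hg₁ hmax'⟩
  have := hmax'.hasDerivAt_eq_zero hg.self_of_nhds
  simpa [g₁] using this

/-- The logarithm of a function `f` with `df ∘ φ = i df`, normalised at a point where `f ≠ 0`. -/
theorem log_of_holomorphic {f : V → ℂ} {φ : V → V →L[ℝ] V} {x : V} (hx : f x ≠ 0)
    (hC2 : ContDiffAt ℝ 2 f x)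
    (hol : ∀ᶠ y in 𝓝 x, ∀ v, fderiv ℝ f y (φ y v) = Complex.I * fderiv ℝ f y v) :
    ∃ (h : V → ℂ) (Dh : V → V →L[ℝ] ℂ) (D2 : V →L[ℝ] V →L[ℝ] ℂ),
      (∀ᶠ y in 𝓝 x, HasFDerivAt h (Dh y) y) ∧ HasFDerivAt Dh D2 x ∧
      (∀ᶠ y in 𝓝 x, ∀ v, Dh y (φ y v) = Complex.I * Dh y v) ∧
      ∀ᶠ y in 𝓝 x, f y ≠ 0 ∧ (h y).re = Real.log ‖f y‖ - Real.log ‖f x‖ := by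
  -- Dividing by $f(x)$ puts the base value at $1$, inside the slit plane, so the principal
  -- logarithm serves near $x$.
  have hslit1 : (f x)⁻¹ * f x ∈ Complex.slitPlane := by
    rw [inv_mul_cancel₀ hx]; exact Complex.one_mem_slitPlane
  have hcont : ContinuousAt (fun y => (f x)⁻¹ * f y) x :=
    continuousAt_const.mul hC2.continuousAt
  have hslit : ∀ᶠ y in 𝓝 x, (f x)⁻¹ * f y ∈ Complex.slitPlane :=
    hcont.eventually_mem (Complex.isOpen_slitPlane.mem_nhds hslit1)
  have hdiff : ∀ᶠ y in 𝓝 x, DifferentiableAt ℝ f y := by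
    filter_upwards [hC2.eventually (by simp)] with y hy using hy.differentiableAt (by simp)
  set h : V → ℂ := fun y => Complex.log ((f x)⁻¹ * f y) with hdef
  have hhC2 : ContDiffAt ℝ 2 h x := by
    have h1 : ContDiffAt ℝ 2 Complex.log ((f x)⁻¹ * f x) :=
      (Complex.contDiffAt_log hslit1 (n := 2)).restrict_scalars ℝ
    exact ContDiffAt.comp x h1 (contDiffAt_const.mul hC2)
  have hder : ∀ᶠ y in 𝓝 x, HasFDerivAt h
      (((((f x)⁻¹ * f y)⁻¹ * (f x)⁻¹)) • fderiv ℝ f y) y := by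
    filter_upwards [hslit, hdiff] with y hy hd
    have h1 := (Complex.hasDerivAt_log hy).complexToReal_fderiv
    have h2 := h1.comp y (hd.hasFDerivAt.const_mul ((f x)⁻¹))
    exact h2.congr_fderiv (by ext v; simp [mul_assoc])
  refine ⟨h, fderiv ℝ h, fderiv ℝ (fderiv ℝ h) x, ?_, ?_, ?_, ?_⟩
  · filter_upwards [hder] with y hy using hy.differentiableAt.hasFDerivAt
  · exact ((hhC2.fderiv_right (m := 1) le_rfl).differentiableAt one_ne_zero).hasFDerivAt
  · filter_upwards [hder, hol] with y hy ho v
    rw [hy.fderiv]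
    simp only [smul_apply, smul_eq_mul, ho v]
    ring
  · filter_upwards [hC2.continuousAt.eventually_ne hx] with y hy
    refine ⟨hy, ?_⟩
    rw [hdef]
    simp only [Complex.log_re, norm_mul, norm_inv]
    rw [Real.log_mul (by simpa using hx) (by simpa using hy), Real.log_inv]
    ring

/-- Unique continuation across a sphere: if `df ∘ φ = i df` wherever `f ≠ 0`, and `f` vanishes
on a ball, then `f` vanishes near the boundary points of the ball. -/
theorem eventually_eq_zero_of_ball [FiniteDimensional ℝ V] {U : Set V} (hU : IsOpen U)
    {φ : V → V →L[ℝ] V} (hφ : ContDiffOn ℝ 1 φ U) {f : V → ℂ} (hf : ContinuousOn f U)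
    (hC2 : ∀ x ∈ U, f x ≠ 0 → ContDiffAt ℝ 2 f x)
    (hol : ∀ x ∈ U, f x ≠ 0 → ∀ v, fderiv ℝ f x (φ x v) = Complex.I * fderiv ℝ f x v)
    {p x₁ : V} (hp : p ∈ U) (hne : p ≠ x₁)
    (hzero : ∀ y ∈ U, ‖y - x₁‖ ≤ ‖p - x₁‖ → f y = 0) : ∀ᶠ y in 𝓝 p, f y = 0 := by
  -- The barrier is centred at the midpoint $x_2=p-e$ of $x_1$ and $p$. The sphere about $x_2$
  -- through $p$ is internally tangent at $p$ to the given one, so away from $p$ the points outside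
  -- the large ball are strictly farther from $x_2$ than $p$ is.
  set e : V := (1 / 2 : ℝ) • (p - x₁) with he
  have hx₁ : x₁ = p - (2 : ℝ) • e := by rw [he, smul_smul]; norm_num
  have hpx : p - x₁ = (2 : ℝ) • e := by rw [hx₁]; abel
  have he0 : e ≠ 0 := by
    simp [he, sub_eq_zero, hne]
  have hepos : 0 < ‖e‖ := norm_pos_iff.mpr he0
  set x₂ : V := p - e with hx₂
  obtain ⟨r₀, hr₀, hr₀U⟩ := Metric.isOpen_iff.mp hU p hp
  set r : ℝ := min (r₀ / 2) (‖e‖ / 2) with hr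
  have hrpos : 0 < r := by positivity
  have hrU : closedBall p r ⊆ U := fun y hy => hr₀U (by
    have : r ≤ r₀ / 2 := min_le_left _ _
    rw [mem_closedBall] at hy; rw [mem_ball]; linarith)
  have hre : r ≤ ‖e‖ / 2 := min_le_right _ _
  have hlow : ∀ x ∈ closedBall p r, ‖e‖ ^ 2 / 2 ≤ ⟪x - x₂, e⟫ := by
    intro x hx
    have h1 : x - x₂ = (x - p) + e := by rw [hx₂]; abel
    rw [h1, inner_add_left, real_inner_self_eq_norm_sq]
    have h2 := abs_le.mp (abs_real_inner_le_norm (x - p) e)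
    rw [mem_closedBall, dist_eq_norm] at hx
    have h3 : ‖x - p‖ * ‖e‖ ≤ ‖e‖ / 2 * ‖e‖ := by gcongr; linarith
    nlinarith [h2.1]
  -- `W` is the first-order term produced by `hessian_of_holomorphic`. For $P=D^2(e,e)+D^2(\varphi
  -- e,\varphi e)+D_W$ one has $P\log|f|=0$, and `B` collects the part of $Pb$ that is linear in
  -- $l$.
  set W : V → V := fun x => fderiv ℝ φ x (φ x e) e + φ x (fderiv ℝ φ x e e) with hW
  set B : V → ℝ := fun x => 2 * ‖e‖ ^ 2 + 2 * ‖φ x e‖ ^ 2 + 2 * ⟪x - x₂, W x⟫ with hB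
  have hφc : ContinuousOn φ U := hφ.continuousOn
  have hφ'c : ContinuousOn (fderiv ℝ φ) U := hφ.continuousOn_fderiv_of_isOpen hU le_rfl
  have hBc : ContinuousOn B U := by
    have h1 : ContinuousOn (fun x => φ x e) U := hφc.clm_apply continuousOn_const
    have h2 : ContinuousOn (fun x => fderiv ℝ φ x (φ x e) e) U :=
      (hφ'c.clm_apply h1).clm_apply continuousOn_const
    have h3 : ContinuousOn (fun x => φ x (fderiv ℝ φ x e e)) U :=
      hφc.clm_apply ((hφ'c.clm_apply continuousOn_const).clm_apply continuousOn_const)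
    have h4 : ContinuousOn (fun x => ⟪x - x₂, W x⟫) U :=
      (continuousOn_id.sub continuousOn_const).inner (h2.add h3)
    exact (continuousOn_const.add (continuousOn_const.mul (h1.norm.pow 2))).add
      (continuousOn_const.mul h4)
  have hcomp : IsCompact (closedBall p r) := isCompact_closedBall p r
  obtain ⟨C, hC⟩ := hcomp.exists_bound_of_continuousOn (hBc.mono hrU)
  have hC0 : 0 ≤ C := (norm_nonneg _).trans (hC p (mem_closedBall_self hrpos.le))
  -- On the small ball $\langle x-x_2,e\rangle\ge\|e\|^2/2$, so the term of $Pb$ quadratic in $l$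
  -- contributes $4l\langle x-x_2,e\rangle^2\ge l\|e\|^4=C+1$, which beats $B\le C$ and makes
  -- $Pb>0$.
  set l : ℝ := (C + 1) / ‖e‖ ^ 4 with hl
  have hlpos : 0 < l := by positivity
  have hle : l * ‖e‖ ^ 4 = C + 1 := by rw [hl]; field_simp
  set b : V → ℝ := fun y => Real.exp (-l * ‖y - x₂‖ ^ 2) with hb
  have hbc : Continuous b := by
    have : Continuous fun y : V => -l * ‖y - x₂‖ ^ 2 := by fun_prop
    exact Real.continuous_exp.comp this
  -- no interior maximum of `|f| exp (K b)` at a point where `f ≠ 0`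
  have hinterior : ∀ K : ℝ, 0 < K → ∀ x ∈ ball p r, f x ≠ 0 →
      ¬ IsLocalMax (fun y => ‖f y‖ * Real.exp (K * b y)) x := by
    intro K hK x hx hfx hmax
    have hxU : x ∈ U := hrU (ball_subset_closedBall hx)
    have hev : ∀ᶠ y in 𝓝 x, ∀ v, fderiv ℝ f y (φ y v) = Complex.I * fderiv ℝ f y v := by
      filter_upwards [hU.mem_nhds hxU, (hC2 x hxU hfx).continuousAt.eventually_ne hfx]
        with y hy hy0 using hol y hy hy0
    obtain ⟨h, Dh, D2, hh, hDh, hholh, hre'⟩ := log_of_holomorphic hfx (hC2 x hxU hfx) hev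
    have hφx : HasFDerivAt φ (fderiv ℝ φ x) x :=
      ((hφ.contDiffAt (hU.mem_nhds hxU)).differentiableAt one_ne_zero).hasFDerivAt
    have hloc : IsLocalMax (fun y => (h y).re + K * Real.exp (-l * ‖y - x₂‖ ^ 2)) x := by
      have hr0 := hre'.self_of_nhds.2
      filter_upwards [hre', hmax] with y hy hym
      rw [hy.2, hr0]
      have h1 := Real.log_le_log (by have := hy.1; positivity) hym
      rw [Real.log_mul (by simpa using hy.1) (Real.exp_pos _).ne',
        Real.log_mul (by simpa using hfx) (Real.exp_pos _).ne', Real.log_exp, Real.log_exp] at h1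
      simp only [hb] at h1
      linarith
    have hid := congrArg Complex.re (hessian_of_holomorphic hh hDh hφx hholh e)
    rw [Complex.add_re, Complex.add_re, Complex.zero_re] at hid
    have hw := (barrier_at_isLocalMax hh hDh K l x₂ hloc (W x)).1
    have h1 := (barrier_at_isLocalMax hh hDh K l x₂ hloc e).2
    have h2 := (barrier_at_isLocalMax hh hDh K l x₂ hloc (φ x e)).2
    have hE : 0 < Real.exp (-l * ‖x - x₂‖ ^ 2) := Real.exp_pos _
    set E := Real.exp (-l * ‖x - x₂‖ ^ 2)
    have h3 : K * E * (l * (4 * l * ⟪x - x₂, e⟫ ^ 2 + 4 * l * ⟪x - x₂, φ x e⟫ ^ 2 - B x)) ≤ 0 := by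
      have : (Dh x (W x)).re = (Dh x ((fderiv ℝ φ x) ((φ x) e) e +
        (φ x) ((fderiv ℝ φ x) e e))).re := rfl
      rw [← this] at hid
      simp only [hB]
      linarith
    have h4 : 4 * l * ⟪x - x₂, e⟫ ^ 2 + 4 * l * ⟪x - x₂, φ x e⟫ ^ 2 - B x ≤ 0 := by
      have hp1 : 0 < K * E * l := by positivity
      by_contra! hcon
      have := mul_pos hp1 hcon
      linarith
    have h5 := (abs_le.mp (hC x (ball_subset_closedBall hx))).2
    have h6 := hlow x (ball_subset_closedBall hx)
    have h7 : (‖e‖ ^ 2 / 2) ^ 2 ≤ ⟪x - x₂, e⟫ ^ 2 := by gcongr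
    have h8 : 4 * l * (‖e‖ ^ 2 / 2) ^ 2 ≤ 4 * l * ⟪x - x₂, e⟫ ^ 2 := by gcongr
    have h9 : 0 ≤ 4 * l * ⟪x - x₂, φ x e⟫ ^ 2 := by positivity
    have h10 : 4 * l * (‖e‖ ^ 2 / 2) ^ 2 = C + 1 := by rw [← hle]; ring
    linarith
  obtain ⟨A, hA⟩ := hcomp.exists_bound_of_continuousOn (hf.mono hrU)
  have hq0 : ‖p - x₂‖ ^ 2 < ‖e‖ ^ 2 + r ^ 2 / 4 := by
    have : p - x₂ = e := by rw [hx₂]; abel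
    rw [this]; nlinarith
  have hnear : ∀ᶠ y in 𝓝 p, ‖y - x₂‖ ^ 2 < ‖e‖ ^ 2 + r ^ 2 / 4 :=
    (by fun_prop : Continuous fun y : V => ‖y - x₂‖ ^ 2).continuousAt.eventually_lt
      continuousAt_const hq0
  filter_upwards [hnear, ball_mem_nhds p hrpos] with x hxq hxr
  by_contra hfx
  -- `β` is the value of the barrier at squared distance $\|e\|^2+r^2/2$, which bounds $b$ on the
  -- boundary points with $f\ne0$. Points $x$ close to $p$ have $b(x)>\beta$, so letting
  -- $K\to\infty$ in `hmain` forces $f(x)=0$.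
  set β : ℝ := Real.exp (-l * (‖e‖ ^ 2 + r ^ 2 / 2)) with hβ
  have hbx : β < b x := by
    rw [hβ, hb]; apply Real.exp_lt_exp.mpr
    have : ‖x - x₂‖ ^ 2 < ‖e‖ ^ 2 + r ^ 2 / 2 := by nlinarith
    nlinarith
  have hmain : ∀ K : ℝ, 0 < K → ‖f x‖ * Real.exp (K * (b x - β)) ≤ A := by
    intro K hK
    obtain ⟨z, hz, hzmax⟩ := hcomp.exists_isMaxOn ⟨p, mem_closedBall_self hrpos.le⟩
      (f := fun y => ‖f y‖ * Real.exp (K * b y))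
      ((hf.mono hrU).norm.mul (Real.continuous_exp.comp
        (continuous_const.mul hbc)).continuousOn)
    have hxz := hzmax (ball_subset_closedBall hxr)
    simp only [mem_ofPred_eq] at hxz
    have hfz : f z ≠ 0 := by
      intro h0
      rw [h0, norm_zero, zero_mul] at hxz
      have : 0 < ‖f x‖ * Real.exp (K * b x) := by positivity
      linarith
    have hzb : z ∉ ball p r := by
      intro hzb
      refine hinterior K hK z hzb hfz ?_
      exact (hzmax.isLocalMax (Filter.mem_of_superset (isOpen_ball.mem_nhds hzb)
        ball_subset_closedBall))
    have hzr : ‖z - p‖ = r := by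
      rw [mem_closedBall, dist_eq_norm] at hz
      rw [mem_ball, dist_eq_norm, not_lt] at hzb
      exact le_antisymm hz hzb
    have hzx : ‖p - x₁‖ < ‖z - x₁‖ := by
      by_contra! hcon
      exact hfz (hzero z (hrU hz) hcon)
    -- Since $f(z)\neq0$, the point $z$ lies outside the large ball; with $\|z-p\|=r$ this gives
    -- $2\langle z-p,e\rangle>-r^2/2$.
    have hzq : ‖e‖ ^ 2 + r ^ 2 / 2 ≤ ‖z - x₂‖ ^ 2 := by
      have e1 : z - x₁ = (z - p) + (2 : ℝ) • e := by rw [hx₁]; abel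
      have e2 : z - x₂ = (z - p) + e := by rw [hx₂]; abel
      have h1 : ‖p - x₁‖ ^ 2 < ‖z - x₁‖ ^ 2 := by gcongr
      rw [e1, hpx, norm_add_sq_real, inner_smul_right, hzr] at h1
      rw [e2, norm_add_sq_real, hzr]
      linarith
    have hbz : b z ≤ β := by
      rw [hβ, hb]; apply Real.exp_le_exp.mpr
      nlinarith
    calc ‖f x‖ * Real.exp (K * (b x - β))
        = ‖f x‖ * Real.exp (K * b x) * Real.exp (-(K * β)) := by
          rw [mul_assoc, ← Real.exp_add]; ring_nf
      _ ≤ ‖f z‖ * Real.exp (K * b z) * Real.exp (-(K * β)) := by gcongr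
      _ = ‖f z‖ * Real.exp (K * (b z - β)) := by
          rw [mul_assoc, ← Real.exp_add]; ring_nf
      _ ≤ A * 1 := by
          have : Real.exp (K * (b z - β)) ≤ 1 := by
            rw [Real.exp_le_one_iff]; nlinarith
          have hAz := hA z hz
          gcongr
          exact (norm_nonneg _).trans hAz
      _ = A := mul_one A
  have hfpos : 0 < ‖f x‖ := norm_pos_iff.mpr hfx
  have hd : 0 < b x - β := by linarith
  have hlim : Tendsto (fun K : ℝ => ‖f x‖ * Real.exp (K * (b x - β))) atTop atTop :=
    (Real.tendsto_exp_atTop.comp (tendsto_id.atTop_mul_const hd)).const_mul_atTop hfpos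
  obtain ⟨K, hK1, hK2⟩ := ((hlim.eventually_gt_atTop A).and (eventually_gt_atTop 0)).exists
  exact absurd (hmain K hK2) (not_le.mpr hK1)

end UniqueContinuation

end

/-! ### Unique continuation from hyperplanes and from open sets. -/

section


section UniqueContinuation

open Filter Set Metric

open scoped RealInnerProductSpace

/-- `f` is a `C²` function on the open set `U` with `df ∘ φ = i df`, for a `C¹` field `φ` of
endomorphisms. -/
structure IsHolomorphicOn {E : Type*} [NormedAddCommGroup E] [NormedSpace ℝ E]
    (φ : E → E →L[ℝ] E) (f : E → ℂ) (U : Set E) : Prop where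
  isOpen : IsOpen U
  contDiffOn_field : ContDiffOn ℝ 1 φ U
  contDiffOn : ContDiffOn ℝ 2 f U
  eq_I_mul : ∀ x ∈ U, ∀ v, fderiv ℝ f x (φ x v) = Complex.I * fderiv ℝ f x v

namespace IsHolomorphicOn

theorem mono {E : Type*} [NormedAddCommGroup E] [NormedSpace ℝ E]
    {φ : E → E →L[ℝ] E} {f : E → ℂ} {U U' : Set E} (h : IsHolomorphicOn φ f U)
    (hU' : IsOpen U') (hsub : U' ⊆ U) : IsHolomorphicOn φ f U' where
  isOpen := hU'
  contDiffOn_field := h.contDiffOn_field.mono hsub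
  contDiffOn := h.contDiffOn.mono hsub
  eq_I_mul x hx := h.eq_I_mul x (hsub hx)

/-- The equation is invariant under linear changes of coordinates, because `φ` is an arbitrary field
of endomorphisms. Arguments with Euclidean spheres therefore apply in any finite-dimensional normed
space. -/
theorem conj_equiv {E : Type*} [NormedAddCommGroup E] [NormedSpace ℝ E]
    {V : Type*} [NormedAddCommGroup V] [NormedSpace ℝ V] (L : E ≃L[ℝ] V)
    {φ : E → E →L[ℝ] E} {f : E → ℂ} {U : Set E} (h : IsHolomorphicOn φ f U) :
    IsHolomorphicOn (fun y => (L : E →L[ℝ] V).comp ((φ (L.symm y)).comp (L.symm : V →L[ℝ] E)))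
      (fun y => f (L.symm y)) (L.symm ⁻¹' U) where
  isOpen := h.isOpen.preimage L.symm.continuous
  contDiffOn_field := by
    have h1 : ContDiffOn ℝ 1 (fun y => φ (L.symm y)) (L.symm ⁻¹' U) :=
      h.contDiffOn_field.comp L.symm.contDiff.contDiffOn (mapsTo_preimage _ _)
    exact contDiffOn_const.clm_comp (h1.clm_comp contDiffOn_const)
  contDiffOn := h.contDiffOn.comp L.symm.contDiff.contDiffOn (mapsTo_preimage _ _)
  eq_I_mul := by
    intro y hy v
    have hd : DifferentiableAt ℝ f (L.symm y) :=
      (h.contDiffOn.contDiffAt (h.isOpen.mem_nhds hy)).differentiableAt two_ne_zero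
    have h1 : HasFDerivAt (fun y => f (L.symm y))
        ((fderiv ℝ f (L.symm y)).comp (L.symm : V →L[ℝ] E)) y :=
      hd.hasFDerivAt.comp y L.symm.hasFDerivAt
    rw [h1.fderiv]
    simpa using h.eq_I_mul _ hy (L.symm v)

variable {V : Type*} [NormedAddCommGroup V] [InnerProductSpace ℝ V] [FiniteDimensional ℝ V]

/-- One-sided unique continuation across a hyperplane. -/
theorem eventually_eq_zero_of_hyperplane_side {φ : V → V →L[ℝ] V} {f : V → ℂ} {U : Set V}
    (h : IsHolomorphicOn φ f U) {p n : V} (hp : p ∈ U) (hn : n ≠ 0)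
    (hzero : ∀ y ∈ U, ⟪y - p, n⟫ = 0 → f y = 0) :
    ∀ᶠ y in 𝓝 p, 0 < ⟪y - p, n⟫ → f y = 0 := by
  classical
  have hin : Continuous fun y : V => ⟪y - p, n⟫ := by fun_prop
  -- Cutting $f$ off to zero on one side stays continuous because $f$ vanishes on the hyperplane.
  -- The truncation need not be differentiable there, which is why `eventually_eq_zero_of_ball` asks
  -- for regularity and for the equation only where the function is nonzero.
  set F : V → ℂ := fun y => if 0 < ⟪y - p, n⟫ then f y else 0 with hF
  have hpos : ∀ x, 0 < ⟪x - p, n⟫ → F =ᶠ[𝓝 x] f := fun x hx => by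
    filter_upwards [hin.continuousAt.eventually_const_lt hx] with y hy
    simp [hF, hy]
  have hFne : ∀ x, F x ≠ 0 → 0 < ⟪x - p, n⟫ := by
    intro x hx
    by_contra hcon
    exact hx (by simp [hF, hcon])
  have hcont : ContinuousOn F U := by
    intro x hx
    apply ContinuousAt.continuousWithinAt
    have hfx : ContinuousAt f x := h.contDiffOn.continuousOn.continuousAt (h.isOpen.mem_nhds hx)
    rcases lt_trichotomy ⟪x - p, n⟫ 0 with h1 | h1 | h1
    · have : F =ᶠ[𝓝 x] fun _ => 0 := by
        filter_upwards [hin.continuousAt.eventually_lt_const h1] with y hy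
        simp [hF, not_lt.mpr hy.le]
      exact continuousAt_const.congr this.symm
    · have hfx0 : f x = 0 := hzero x hx h1
      have hFx : F x = 0 := by simp [hF, h1]
      rw [ContinuousAt, hFx]
      refine squeeze_zero_norm (a := fun y => ‖f y‖) (fun y => ?_) ?_
      · by_cases hy : 0 < ⟪y - p, n⟫
        · simp [hF, hy]
        · simp [hF, hy]
      · have := hfx.norm
        rw [ContinuousAt, hfx0, norm_zero] at this
        exact this
    · exact hfx.congr (hpos x h1).symm
  have key : ∀ᶠ y in 𝓝 p, F y = 0 := by
    -- The ball of centre $p-n$ and radius $\|n\|$ touches the hyperplane at $p$ from the side where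
    -- `F` is zero.
    refine eventually_eq_zero_of_ball h.isOpen h.contDiffOn_field hcont ?_ ?_ hp
      (x₁ := p - n) (by simpa [eq_sub_iff_add_eq] using hn) ?_
    · intro x hx hFx
      exact (h.contDiffOn.contDiffAt (h.isOpen.mem_nhds hx)).congr_of_eventuallyEq
        (hpos x (hFne x hFx))
    · intro x hx hFx v
      rw [(hpos x (hFne x hFx)).fderiv_eq]
      exact h.eq_I_mul x hx v
    · intro y _ hy
      have h1 : y - (p - n) = (y - p) + n := by abel
      have h2 : p - (p - n) = n := by abel
      rw [h1, h2] at hy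
      have h3 : ‖y - p + n‖ ^ 2 ≤ ‖n‖ ^ 2 := by gcongr
      rw [norm_add_sq_real] at h3
      have : ¬ 0 < ⟪y - p, n⟫ := by nlinarith [sq_nonneg ‖y - p‖]
      simp [hF, this]
  filter_upwards [key] with y hy hpos'
  simpa [hF, hpos'] using hy

/-- The one-sided result applies to $n$ and to $-n$, and the hyperplane itself is covered by
assumption. -/
theorem eventually_eq_zero_of_hyperplane_inner {φ : V → V →L[ℝ] V} {f : V → ℂ} {U : Set V}
    (h : IsHolomorphicOn φ f U) {p n : V} (hp : p ∈ U) (hn : n ≠ 0)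
    (hzero : ∀ y ∈ U, ⟪y - p, n⟫ = 0 → f y = 0) : ∀ᶠ y in 𝓝 p, f y = 0 := by
  have h1 := h.eventually_eq_zero_of_hyperplane_side hp hn hzero
  have h2 := h.eventually_eq_zero_of_hyperplane_side hp (neg_ne_zero.mpr hn)
    (fun y hy h0 => hzero y hy (by simpa using h0))
  filter_upwards [h1, h2, h.isOpen.mem_nhds hp] with y hy1 hy2 hyU
  rw [inner_neg_right] at hy2
  rcases lt_trichotomy ⟪y - p, n⟫ 0 with h0 | h0 | h0
  · exact hy2 (by linarith)
  · exact hzero y hyU h0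
  · exact hy1 h0

/-- Start from a point $q$ close to $p$ near which $f$ vanishes and take the point $p'$ nearest to
$q$ at which $f$ is not locally zero. Then $f$ vanishes on the open ball about $q$ through $p'$, and
continuation across its sphere contradicts the choice of $p'$. -/
theorem eventually_eq_zero_of_frequently_inner {φ : V → V →L[ℝ] V} {f : V → ℂ} {U : Set V}
    (h : IsHolomorphicOn φ f U) {p : V} (hp : p ∈ U)
    (hfreq : ∃ᶠ q in 𝓝 p, ∀ᶠ y in 𝓝 q, f y = 0) : ∀ᶠ y in 𝓝 p, f y = 0 := by
  obtain ⟨r, hr, hrU⟩ := Metric.isOpen_iff.mp h.isOpen p hp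
  obtain ⟨q, hq, hqr⟩ := (hfreq.and_eventually
    (ball_mem_nhds p (by positivity : 0 < r / 4))).exists
  replace hqr : dist q p < r / 4 := hqr
  by_contra hcon
  -- With $q$ within $r/4$ of $p$, the closed ball of radius $r/2$ about $q$ contains $p$ and stays
  -- inside $U$.
  set N : Set V := closedBall q (r / 2) ∩ {y | ∀ᶠ z in 𝓝 y, f z = 0}ᶜ with hN
  have hopen : IsOpen {y | ∀ᶠ z in 𝓝 y, f z = 0} := isOpen_setOfPred_eventually_nhds
  have hNc : IsCompact N := (isCompact_closedBall q (r / 2)).inter_right hopen.isClosed_compl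
  have hpN : p ∈ N := ⟨by rw [mem_closedBall, dist_comm]; linarith, hcon⟩
  obtain ⟨p', hp'N, hmin⟩ := hNc.exists_isMinOn ⟨p, hpN⟩
    (f := fun y => dist y q) (by fun_prop)
  have hsubU : closedBall q (r / 2) ⊆ U := fun y hy => hrU (by
    rw [mem_closedBall] at hy
    rw [mem_ball]
    linarith [dist_triangle y q p])
  have hp'U : p' ∈ U := hsubU hp'N.1
  have hne : p' ≠ q := by
    rintro rfl
    exact hp'N.2 hq
  have hball : ∀ y ∈ ball q (dist p' q), f y = 0 := by
    intro y hy
    by_contra hfy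
    have hyN : y ∈ N := by
      refine ⟨?_, fun hev => hfy hev.self_of_nhds⟩
      rw [mem_closedBall]
      exact (mem_ball.mp hy).le.trans (mem_closedBall.mp hp'N.1)
    exact absurd (hmin hyN) (not_le.mpr (mem_ball.mp hy))
  refine hp'N.2 (eventually_eq_zero_of_ball h.isOpen h.contDiffOn_field
    h.contDiffOn.continuousOn
    (fun x hx _ => h.contDiffOn.contDiffAt (h.isOpen.mem_nhds hx))
    (fun x hx _ => h.eq_I_mul x hx) hp'U hne ?_)
  intro y hyU hy
  rw [← dist_eq_norm, ← dist_eq_norm] at hy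
  have hycl : y ∈ closure (ball q (dist p' q)) := by
    rw [closure_ball q (dist_ne_zero.mpr hne)]
    exact hy
  have hcy : ContinuousAt f y := h.contDiffOn.continuousOn.continuousAt (h.isOpen.mem_nhds hyU)
  have := hcy.continuousWithinAt.mem_closure_image hycl
  have hsub : closure (f '' ball q (dist p' q)) ⊆ {0} :=
    closure_minimal (by rintro _ ⟨z, hz, rfl⟩; exact hball z hz) isClosed_singleton
  exact hsub this

theorem eventually_eq_zero_of_conj {E : Type*} [NormedAddCommGroup E] [NormedSpace ℝ E]
    {V : Type*} [NormedAddCommGroup V] [NormedSpace ℝ V]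
    (L : E ≃L[ℝ] V) {f : E → ℂ} {p : E}
    (h : ∀ᶠ y in 𝓝 (L p), f (L.symm y) = 0) : ∀ᶠ y in 𝓝 p, f y = 0 := by
  filter_upwards [L.continuous.continuousAt.eventually h] with y hy
  simpa using hy

variable {E : Type*} [NormedAddCommGroup E] [NormedSpace ℝ E] [FiniteDimensional ℝ E]

/-- Unique continuation from a hyperplane. -/
theorem eventually_eq_zero_of_hyperplane {φ : E → E →L[ℝ] E} {f : E → ℂ} {U : Set E}
    (h : IsHolomorphicOn φ f U) {p : E} (hp : p ∈ U) {l : E →L[ℝ] ℝ} (hl : l ≠ 0)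
    (hzero : ∀ y ∈ U, l (y - p) = 0 → f y = 0) : ∀ᶠ y in 𝓝 p, f y = 0 := by
  set L := toEuclidean (E := E)
  set l' : EuclideanSpace ℝ (Fin (Module.finrank ℝ E)) →L[ℝ] ℝ :=
    l.comp (L.symm : _ →L[ℝ] E) with hl'
  have hl'0 : l' ≠ 0 := by
    intro h0
    apply hl
    ext v
    have := congrArg (fun k => k (L v)) h0
    simpa [hl'] using this
  set n := (InnerProductSpace.toDual ℝ _).symm l' with hn
  have hinner : ∀ v, ⟪v, n⟫ = l' v := fun v => by
    rw [real_inner_comm, hn, InnerProductSpace.toDual_symm_apply]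
  refine eventually_eq_zero_of_conj L
    ((h.conj_equiv L).eventually_eq_zero_of_hyperplane_inner (p := L p) (n := n) ?_ ?_ ?_)
  · simpa using hp
  · simpa [hn] using hl'0
  · intro y hy h0
    rw [hinner] at h0
    exact hzero _ hy (by simpa [hl'] using h0)

/-- The zero set of `f` in the interior sense is closed. -/
theorem eventually_eq_zero_of_frequently {φ : E → E →L[ℝ] E} {f : E → ℂ} {U : Set E}
    (h : IsHolomorphicOn φ f U) {p : E} (hp : p ∈ U)
    (hfreq : ∃ᶠ q in 𝓝 p, ∀ᶠ y in 𝓝 q, f y = 0) : ∀ᶠ y in 𝓝 p, f y = 0 := by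
  set L := toEuclidean (E := E)
  refine eventually_eq_zero_of_conj L
    ((h.conj_equiv L).eventually_eq_zero_of_frequently_inner (p := L p) (by simpa using hp) ?_)
  have h1 : ∃ᶠ q in 𝓝 p, ∀ᶠ y in 𝓝 (L q), f (L.symm y) = 0 := by
    refine hfreq.mono fun q hq => ?_
    have : Tendsto L.symm (𝓝 (L q)) (𝓝 q) := by
      simpa using L.symm.continuous.tendsto (L q)
    exact this.eventually hq
  exact (L.continuous.tendsto p).frequently h1

end IsHolomorphicOn

end UniqueContinuation

end

/-! ### Unique continuation from codimension two. -/

section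


section UniqueContinuation

open Filter Set Metric

/-- A subspace of codimension two is the intersection of two hyperplanes, the first of which avoids
a given vector outside of the subspace. -/
theorem exists_functionals_of_codim_two {E : Type*} [AddCommGroup E] [Module ℝ E]
    [FiniteDimensional ℝ E] {W : Submodule ℝ E}
    (hW : Module.finrank ℝ W + 2 = Module.finrank ℝ E) {w : E} (hw : w ∉ W) :
    ∃ l₁ l₂ : E →ₗ[ℝ] ℝ, (∀ v ∈ W, l₁ v = 0) ∧ l₁ w = 1 ∧
      (∃ v, l₁ v = 0 ∧ l₂ v ≠ 0) ∧ ∀ v, l₁ v = 0 → l₂ v = 0 → v ∈ W := by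
  have hw0 : w ≠ 0 := fun h => hw (h ▸ W.zero_mem)
  obtain ⟨l, hlw, hlW⟩ := Submodule.exists_le_ker_of_notMem hw
  have hdisj : Disjoint W (Submodule.span ℝ {w}) := by
    rw [Submodule.disjoint_span_singleton' hw0]; exact hw
  have h1 : Module.finrank ℝ ↥(W ⊔ Submodule.span ℝ {w}) + 1 = Module.finrank ℝ E := by
    have := Submodule.finrank_sup_add_finrank_inf_eq W (Submodule.span ℝ {w})
    rw [hdisj.eq_bot, finrank_bot, finrank_span_singleton hw0] at this
    omega
  have hne : W ⊔ Submodule.span ℝ {w} ≠ ⊤ := by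
    intro h; rw [h, finrank_top] at h1; omega
  obtain ⟨u, hu⟩ : ∃ u, u ∉ W ⊔ Submodule.span ℝ {w} := by
    by_contra! hcon
    exact hne (Submodule.eq_top_iff'.mpr hcon)
  have hu0 : u ≠ 0 := fun h => hu (h ▸ Submodule.zero_mem _)
  obtain ⟨l₂, hl₂u, hl₂W⟩ := Submodule.exists_le_ker_of_notMem hu
  have htop : (W ⊔ Submodule.span ℝ {w}) ⊔ Submodule.span ℝ {u} = ⊤ := by
    apply Submodule.eq_top_of_finrank_eq
    have hd : Disjoint (W ⊔ Submodule.span ℝ {w}) (Submodule.span ℝ {u}) := by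
      rw [Submodule.disjoint_span_singleton' hu0]; exact hu
    have := Submodule.finrank_sup_add_finrank_inf_eq (W ⊔ Submodule.span ℝ {w})
      (Submodule.span ℝ {u})
    rw [hd.eq_bot, finrank_bot, finrank_span_singleton hu0] at this
    omega
  have hlW' : ∀ v ∈ W, l v = 0 := fun v hv => hlW hv
  have hl₂W' : ∀ v ∈ W, l₂ v = 0 := fun v hv => hl₂W (Submodule.mem_sup_left hv)
  have hl₂w : l₂ w = 0 :=
    hl₂W (Submodule.mem_sup_right (Submodule.mem_span_singleton_self w))
  -- The witness on which $l_1$ vanishes and $l_2$ does not is $u$ corrected by a multiple of $w$;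
  -- this does not affect $l_2$, which vanishes at $w$.
  refine ⟨(l w)⁻¹ • l, l₂, fun v hv => by simp [hlW' v hv], by simp [hlw],
    ⟨u - (l u / l w) • w, by simp; field_simp; simp, by simpa [hl₂w] using hl₂u⟩, ?_⟩
  intro v hv1 hv2
  have hv : v ∈ (W ⊔ Submodule.span ℝ {w}) ⊔ Submodule.span ℝ {u} := htop ▸ Submodule.mem_top
  obtain ⟨a, ha, b, hb, rfl⟩ := Submodule.mem_sup.mp hv
  obtain ⟨c, hc, d, hd, rfl⟩ := Submodule.mem_sup.mp ha
  obtain ⟨s, rfl⟩ := Submodule.mem_span_singleton.mp hb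
  obtain ⟨t, rfl⟩ := Submodule.mem_span_singleton.mp hd
  have hs : s = 0 := by
    simpa [hl₂W' c hc, hl₂w, hl₂u] using hv2
  have ht : t = 0 := by
    simpa [hlW' c hc, hs, hlw] using hv1
  simpa [hs, ht] using hc

/-- Unique continuation from a submanifold of codimension two which is transverse to a field `ξ`
along which `f` is constant. -/
theorem IsHolomorphicOn.eventually_eq_zero_of_codim_two
    {E : Type*} [NormedAddCommGroup E] [NormedSpace ℝ E] [FiniteDimensional ℝ E]
    {E' : Type*} [NormedAddCommGroup E'] [NormedSpace ℝ E'] [FiniteDimensional ℝ E']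
    (hdim : Module.finrank ℝ E' + 2 = Module.finrank ℝ E)
    {φ : E → E →L[ℝ] E} {f : E → ℂ} {U : Set E} (h : IsHolomorphicOn φ f U)
    {ξ : E → E} (hξ : ContDiffOn ℝ 1 ξ U) (hfξ : ∀ y ∈ U, fderiv ℝ f y (ξ y) = 0)
    {L : E' →L[ℝ] E} (hL : Function.Injective L) {z₀ : E'} (hz₀ : L z₀ ∈ U)
    (htrans : ∀ v, L v ≠ ξ (L z₀)) (hzero : ∀ᶠ z in 𝓝 z₀, f (L z) = 0) :
    ∀ᶠ y in 𝓝 (L z₀), f y = 0 := by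
  set p := L z₀
  set W : Submodule ℝ E := LinearMap.range L.toLinearMap
  have hW : Module.finrank ℝ W + 2 = Module.finrank ℝ E := by
    rw [LinearMap.finrank_range_of_inj hL, hdim]
  have hξW : ξ p ∉ W := by
    rintro ⟨v, hv⟩
    exact htrans v hv
  obtain ⟨k₁, k₂, hk₁W, hk₁ξ, ⟨u, hu1, hu2⟩, hk⟩ := exists_functionals_of_codim_two hW hξW
  set l₁ : E →L[ℝ] ℝ := LinearMap.toContinuousLinearMap k₁
  set l₂ : E →L[ℝ] ℝ := LinearMap.toContinuousLinearMap k₂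
  have hl₁W : ∀ v, l₁ (L v) = 0 := fun v => hk₁W _ ⟨v, rfl⟩
  have hl₁ξ : l₁ (ξ p) = 1 := hk₁ξ
  obtain ⟨π₀, hπ₀⟩ := LinearMap.exists_leftInverse_of_injective L.toLinearMap
    (LinearMap.ker_eq_bot.mpr hL)
  set π : E →L[ℝ] E' := LinearMap.toContinuousLinearMap π₀
  have hπ : ∀ v, π (L v) = v := fun v => LinearMap.congr_fun hπ₀ v
  -- `Q` is a hyperplane through $p$ that contains the submanifold and is transverse to $\xi$ near
  -- $p$. Vanishing is first propagated inside `Q`, where the submanifold is a hyperplane, and then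
  -- from `Q` to `E`.
  set Q : Submodule ℝ E := LinearMap.ker k₁
  have hpQ : p ∈ Q := hl₁W z₀
  set P : E →L[ℝ] Q := (ContinuousLinearMap.id ℝ E - l₁.smulRight (ξ p)).codRestrict Q (by
    intro v
    change l₁ _ = 0
    simp [hl₁ξ])
  have hP : ∀ v, l₁ v = 0 → (P v : E) = v := by
    intro v hv
    change v - l₁ v • ξ p = v
    simp [hv]
  -- the region where everything is defined
  have hξc : ContinuousOn (fun y => l₁ (ξ y)) U := l₁.continuous.comp_continuousOn hξ.continuousOn
  obtain ⟨O, hOsub, hO, hpO⟩ : ∃ O ⊆ U, IsOpen O ∧ p ∈ O ∧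
      ∀ y ∈ O, l₁ (ξ y) ≠ 0 ∧ f (L (π y)) = 0 := by
    have h1 : ∀ᶠ y in 𝓝 p, l₁ (ξ y) ≠ 0 :=
      (hξc.continuousAt (h.isOpen.mem_nhds hz₀)).eventually_ne (by simp [hl₁ξ])
    have h2 : ∀ᶠ y in 𝓝 p, f (L (π y)) = 0 := by
      have : Tendsto π (𝓝 p) (𝓝 z₀) := by
        have := π.continuous.tendsto p
        rwa [hπ] at this
      exact this.eventually hzero
    obtain ⟨O, hO1, hO2, hO3⟩ := _root_.eventually_nhds_iff.mp
      ((h1.and h2).and (h.isOpen.mem_nhds hz₀))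
    exact ⟨O, fun y hy => (hO1 y hy).2, hO2, hO3, fun y hy => (hO1 y hy).1⟩
  -- A multiple of $\xi(y)$ is subtracted from $\varphi_yv$ so that the result lies in `Q`. As
  -- $df(\xi)=0$, this leaves the equation for $f|_Q$ intact. The projection `P` acts trivially
  -- there and only adjusts the codomain.
  set φQ : Q → Q →L[ℝ] Q := fun y => P.comp ((φ y - ((l₁ (ξ y))⁻¹ • l₁.comp (φ y)).smulRight
    (ξ y)).comp Q.subtypeL)
  have hmaps : MapsTo (Q.subtypeL : Q → E) (Q.subtypeL ⁻¹' O) O := mapsTo_preimage _ _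
  have hol : IsHolomorphicOn φQ (fun y : Q => f y) (Q.subtypeL ⁻¹' O) := by
    refine ⟨hO.preimage Q.subtypeL.continuous, ?_, ?_, ?_⟩
    · have e1 : ContDiffOn ℝ 1 (fun y : Q => φ y) (Q.subtypeL ⁻¹' O) :=
        (h.contDiffOn_field.mono hOsub).comp Q.subtypeL.contDiff.contDiffOn hmaps
      have e2 : ContDiffOn ℝ 1 (fun y : Q => ξ y) (Q.subtypeL ⁻¹' O) :=
        (hξ.mono hOsub).comp Q.subtypeL.contDiff.contDiffOn hmaps
      have e3 : ContDiffOn ℝ 1 (fun y : Q => (l₁ (ξ y))⁻¹) (Q.subtypeL ⁻¹' O) :=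
        (l₁.contDiff.comp_contDiffOn e2).inv fun y hy => (hpO.2 _ hy).1
      have e4 := e3.smul ((contDiffOn_const (c := l₁)).clm_comp e1)
      have e5 := e4.smulRight e2
      exact contDiffOn_const.clm_comp ((e1.sub e5).clm_comp contDiffOn_const)
    · exact (h.contDiffOn.mono hOsub).comp Q.subtypeL.contDiff.contDiffOn hmaps
    · intro y hy v
      have hyU : (y : E) ∈ U := hOsub hy
      have hd : DifferentiableAt ℝ f (y : E) :=
        (h.contDiffOn.contDiffAt (h.isOpen.mem_nhds hyU)).differentiableAt two_ne_zero
      have h1 : HasFDerivAt (fun y : Q => f y) ((fderiv ℝ f (y : E)).comp Q.subtypeL) y :=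
        HasFDerivAt.comp (g := f) y hd.hasFDerivAt Q.subtypeL.hasFDerivAt
      rw [h1.fderiv]
      have hne : l₁ (ξ y) ≠ 0 := (hpO.2 _ hy).1
      have h2 : ((φQ y v : Q) : E) =
          φ y v - ((l₁ (ξ y))⁻¹ * l₁ (φ y v)) • ξ y := by
        apply hP
        simp
        rw [mul_right_comm, inv_mul_cancel₀ hne, one_mul, sub_self]
      have h3 := hfξ y hyU
      simp only [ContinuousLinearMap.comp_apply, Submodule.subtypeL_apply] at *
      rw [h2, map_sub, map_smul, h3, smul_zero, sub_zero]
      exact h.eq_I_mul y hyU v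
  have hl₂0 : l₂.comp Q.subtypeL ≠ 0 := by
    intro h0
    exact hu2 (congrArg (fun k => k ⟨u, hu1⟩) h0)
  -- Inside `Q` the kernel of $l_2$ is the range of `L`, and `O` was chosen so that $f(L(\pi y))=0$;
  -- on the range of `L` this says $f(y)=0$.
  have hQ := hol.eventually_eq_zero_of_hyperplane (p := ⟨p, hpQ⟩) hpO.1 hl₂0 (by
    intro y hy hy0
    have hyp : ((y : E) - p) ∈ W := hk _ (by
      have hy1 : k₁ (y : E) = 0 := y.2
      have hp1 : k₁ p = 0 := hpQ
      rw [map_sub, hy1, hp1, sub_zero]) hy0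
    obtain ⟨v, hv⟩ := hyp
    have hyL : (y : E) = L (v + z₀) := by
      rw [map_add]
      exact (sub_eq_iff_eq_add.mp hv.symm)
    have := (hpO.2 _ hy).2
    rw [Submodule.subtypeL_apply, hyL, hπ, ← hyL] at this
    exact this)
  have hPp : P p = ⟨p, hpQ⟩ := Subtype.ext (hP p (hl₁W z₀))
  have hQ' : ∀ᶠ y in 𝓝 p, l₁ y = 0 → f y = 0 := by
    have h1 : Tendsto P (𝓝 p) (𝓝 ⟨p, hpQ⟩) := by
      have := P.continuous.tendsto p
      rwa [hPp] at this
    filter_upwards [h1.eventually hQ] with y hy hy0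
    rwa [hP y hy0] at hy
  obtain ⟨O', hO'1, hO'2, hO'3⟩ := _root_.eventually_nhds_iff.mp (hQ'.and (h.isOpen.mem_nhds hz₀))
  -- Second application, now with the original `φ` and with `Q` as the hyperplane on which $f$
  -- vanishes.
  refine (h.mono hO'2 fun y hy => (hO'1 y hy).2).eventually_eq_zero_of_hyperplane hO'3
    (l := l₁) ?_ ?_
  · intro h0
    rw [h0] at hl₁ξ
    simp at hl₁ξ
  · intro y hy hy0
    refine (hO'1 y hy).1 ?_
    have hp1 : l₁ p = 0 := hl₁W z₀
    rwa [map_sub, hp1, sub_zero] at hy0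

end UniqueContinuation

end

/-! ### Linear algebra: the complex form of a contact B-structure and curvature tensors commuting
with φ. -/

section


/-- An almost contact B-metric structure on a real vector space. -/
structure ContactBForm (V : Type*) [AddCommGroup V] [Module ℝ V] where
  phi : V →ₗ[ℝ] V
  xi : V
  eta : V →ₗ[ℝ] ℝ
  g : V →ₗ[ℝ] V →ₗ[ℝ] ℝ
  phi_sq : ∀ u, phi (phi u) = -u + eta u • xi
  eta_xi : eta xi = 1
  g_symm : ∀ u v, g u v = g v u
  g_nondegenerate : ∀ u, (∀ v, g u v = 0) → u = 0
  g_phi : ∀ u v, g (phi u) (phi v) = - g u v + eta u * eta v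

namespace ContactBForm

variable {V : Type*} [AddCommGroup V] [Module ℝ V] (B : ContactBForm V)

theorem xi_ne_zero : B.xi ≠ 0 := by
  intro h
  have := B.eta_xi
  rw [h, map_zero] at this
  exact zero_ne_one this

/-- The relation for $\varphi^2$ at $\xi$ gives $\varphi^2\xi=0$, and at $\varphi\xi$ it gives
$\varphi\xi=\eta(\varphi\xi)\xi$. Applying $\varphi$ once more yields $\eta(\varphi\xi)^2=0$. -/
theorem phi_xi : B.phi B.xi = 0 := by
  have h1 : B.phi (B.phi B.xi) = 0 := by
    rw [B.phi_sq, B.eta_xi, one_smul, neg_add_cancel]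
  have h2 : B.phi B.xi = B.eta (B.phi B.xi) • B.xi := by
    have := B.phi_sq (B.phi B.xi)
    rw [h1, map_zero] at this
    exact (neg_add_eq_zero.mp this.symm)
  have h3 : (B.eta (B.phi B.xi) * B.eta (B.phi B.xi)) • B.xi = 0 := by
    rw [mul_smul, ← h2, ← map_smul, ← h2, h1]
  have h4 : B.eta (B.phi B.xi) = 0 := by
    rcases smul_eq_zero.mp h3 with h | h
    · exact mul_self_eq_zero.mp h
    · exact absurd h B.xi_ne_zero
  rw [h2, h4, zero_smul]

theorem eta_phi (u : V) : B.eta (B.phi u) = 0 := by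
  have h1 := B.phi_sq (B.phi u)
  have h2 : B.phi (B.phi (B.phi u)) = -B.phi u := by
    rw [B.phi_sq u, map_add, map_neg, map_smul, B.phi_xi, smul_zero, add_zero]
  rw [h2] at h1
  have h3 : B.eta (B.phi u) • B.xi = 0 := by
    simpa using h1.symm
  exact (smul_eq_zero.mp h3).resolve_right B.xi_ne_zero

theorem g_xi (u : V) : B.g u B.xi = B.eta u := by
  have := B.g_phi u B.xi
  rw [B.phi_xi, map_zero, B.eta_xi] at this
  linarith

theorem g_xi_left (u : V) : B.g B.xi u = B.eta u := by rw [B.g_symm, B.g_xi]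

theorem g_phi_left (u v : V) : B.g (B.phi u) v = B.g u (B.phi v) := by
  have h := B.g_phi u (B.phi v)
  rw [B.phi_sq, map_add, map_neg, map_smul, B.g_xi, B.eta_phi, B.eta_phi] at h
  simp at h
  linarith

theorem ext_g {u v : V} (h : ∀ w, B.g u w = B.g v w) : u = v := by
  rw [← sub_eq_zero]
  apply B.g_nondegenerate
  intro w
  rw [map_sub, LinearMap.sub_apply, h w, sub_self]

/-- The complex bilinear form of the structure. -/
def G : V →ₗ[ℝ] V →ₗ[ℝ] ℂ :=
  LinearMap.mk₂ ℝ (fun u v => (⟨-B.g (B.phi u) (B.phi v), -B.g u (B.phi v)⟩ : ℂ))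
    (fun u u' v => by apply Complex.ext <;> simp <;> ring)
    (fun c u v => by apply Complex.ext <;> simp)
    (fun u v v' => by apply Complex.ext <;> simp <;> ring)
    (fun c u v => by apply Complex.ext <;> simp)

theorem G_re (u v : V) : (B.G u v).re = -B.g (B.phi u) (B.phi v) := rfl

theorem G_im (u v : V) : (B.G u v).im = -B.g u (B.phi v) := rfl

theorem G_re' (u v : V) : (B.G u v).re = B.g u v - B.eta u * B.eta v := by
  rw [G_re, B.g_phi]; ring

theorem G_symm (u v : V) : B.G u v = B.G v u := by
  apply Complex.ext
  · rw [G_re, G_re, B.g_symm]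
  · rw [G_im, G_im, ← B.g_phi_left, B.g_symm]

/-- Multiplication by a complex number, `i` acting as `φ` (and `ξ` being mapped to `0`). -/
def J (a : ℂ) : V →ₗ[ℝ] V := -(a.re • (B.phi ∘ₗ B.phi)) + a.im • B.phi

theorem J_apply (a : ℂ) (u : V) : B.J a u = -(a.re • B.phi (B.phi u)) + a.im • B.phi u := rfl

theorem phi_cube (u : V) : B.phi (B.phi (B.phi u)) = -B.phi u := by
  rw [B.phi_sq (B.phi u), B.eta_phi, zero_smul, add_zero]

theorem eta_J (a : ℂ) (u : V) : B.eta (B.J a u) = 0 := by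
  rw [J_apply]; simp [B.eta_phi]

theorem J_mul (a b : ℂ) (u : V) : B.J (a * b) u = B.J a (B.J b u) := by
  simp only [J_apply, map_add, map_neg, map_smul, B.phi_cube, Complex.mul_re, Complex.mul_im]
  module

theorem J_add (a b : ℂ) (u : V) : B.J (a + b) u = B.J a u + B.J b u := by
  simp only [J_apply, Complex.add_re, Complex.add_im]
  module

theorem J_neg (a : ℂ) (u : V) : B.J (-a) u = -B.J a u := by
  simp only [J_apply, Complex.neg_re, Complex.neg_im]
  module

theorem J_zero (u : V) : B.J 0 u = 0 := by simp [J_apply]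

theorem J_real_smul (c : ℝ) (a : ℂ) (u : V) : B.J (c • a) u = c • B.J a u := by
  simp only [J_apply, Complex.real_smul, Complex.re_ofReal_mul, Complex.im_ofReal_mul]
  module

theorem J_phi (a : ℂ) (u : V) : B.J a (B.phi u) = B.phi (B.J a u) := by
  simp only [J_apply, map_add, map_neg, map_smul]

theorem J_I (u : V) : B.J Complex.I u = B.phi u := by simp [J_apply]

theorem J_I_mul (a : ℂ) (u : V) : B.J (Complex.I * a) u = B.phi (B.J a u) := by
  rw [B.J_mul, J_I]

/-- With the sign chosen for its imaginary part, `G` is complex bilinear when $i$ acts as $\varphi$;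
`G_J_left` extends this to all scalars. -/
theorem G_phi_left (u v : V) : B.G (B.phi u) v = Complex.I * B.G u v := by
  apply Complex.ext
  · simp only [G_re, Complex.mul_re, Complex.I_re, Complex.I_im, G_im]
    rw [B.g_phi_left (B.phi u), B.g_phi_left u, B.phi_cube, map_neg]
    ring
  · simp only [G_im, Complex.mul_im, Complex.I_re, Complex.I_im, G_re]
    ring

theorem G_phi_right (u v : V) : B.G u (B.phi v) = Complex.I * B.G u v := by
  rw [B.G_symm, B.G_phi_left, B.G_symm]

theorem G_J_left (a : ℂ) (u v : V) : B.G (B.J a u) v = a * B.G u v := by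
  rw [J_apply, map_add, LinearMap.add_apply, map_neg, LinearMap.neg_apply, map_smul, map_smul,
    LinearMap.smul_apply, LinearMap.smul_apply, B.G_phi_left, B.G_phi_left]
  simp only [Complex.real_smul]
  conv_rhs => rw [← Complex.re_add_im a]
  linear_combination (-(a.re : ℂ) * B.G u v) * Complex.I_mul_I

theorem G_J_right (a : ℂ) (u v : V) : B.G u (B.J a v) = a * B.G u v := by
  rw [B.G_symm, B.G_J_left, B.G_symm]

theorem eq_zero_of_G {u : V} (hu : B.eta u = 0) (h : ∀ v, B.G u v = 0) : u = 0 := by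
  apply B.g_nondegenerate
  intro v
  have := B.G_re' u v
  rw [h v, hu] at this
  simpa using this.symm

theorem J_eq_zero {a : ℂ} {u : V} (hu : B.G u u ≠ 0) (h : B.J a u = 0) : a = 0 := by
  have := B.G_J_left a u u
  rw [h, map_zero, LinearMap.zero_apply] at this
  exact (mul_eq_zero.mp this.symm).resolve_right hu

/-- Polarization of the symmetric form `G`. -/
theorem exists_G_self_ne_zero_of {S : Submodule ℝ V} {y w : V} (hy : y ∈ S) (hw : w ∈ S)
    (h : B.G y w ≠ 0) : ∃ z ∈ S, B.G z z ≠ 0 := by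
  by_contra! hcon
  apply h
  have h1 := hcon y hy
  have h2 := hcon w hw
  have h3 := hcon (y + w) (S.add_mem hy hw)
  simp only [map_add, LinearMap.add_apply, h1, h2, B.G_symm w y, zero_add, add_zero] at h3
  have : (2 : ℂ) * B.G y w = 0 := by linear_combination h3
  simpa using this

theorem exists_G_self_ne_zero [FiniteDimensional ℝ V] (hV : 2 ≤ Module.finrank ℝ V) :
    ∃ x, B.G x x ≠ 0 := by
  obtain ⟨u, hu, hu0⟩ : ∃ u ∈ LinearMap.ker B.eta, u ≠ 0 := by
    apply Submodule.exists_mem_ne_zero_of_ne_bot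
    intro h
    have h1 := LinearMap.finrank_range_add_finrank_ker B.eta
    have h2 := (LinearMap.range B.eta).finrank_le
    rw [h, finrank_bot] at h1
    rw [Module.finrank_self] at h2
    omega
  obtain ⟨w, hw⟩ : ∃ w, B.G u w ≠ 0 := by
    by_contra! hcon
    exact hu0 (B.eq_zero_of_G hu hcon)
  obtain ⟨z, -, hz⟩ := B.exists_G_self_ne_zero_of (S := ⊤) trivial trivial hw
  exact ⟨z, hz⟩

/-- Every vector `x` with `G (x, x) ≠ 0` is part of a `G`-orthogonal pair. -/
theorem exists_G_orthogonal [FiniteDimensional ℝ V] (hV : 4 ≤ Module.finrank ℝ V) {x : V}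
    (hx : B.G x x ≠ 0) : ∃ y, B.G x y = 0 ∧ B.G y y ≠ 0 := by
  set S : Submodule ℝ V := LinearMap.ker (B.G x)
  -- The map $(G(x,\cdot),\eta)$ takes values in $\mathbb C\times\mathbb R$, of real dimension
  -- three; this is where dimension at least four is needed.
  obtain ⟨y, hy, hy0⟩ : ∃ y ∈ LinearMap.ker ((B.G x).prod B.eta), y ≠ 0 := by
    apply Submodule.exists_mem_ne_zero_of_ne_bot
    intro h
    have h1 := LinearMap.finrank_range_add_finrank_ker ((B.G x).prod B.eta)
    have h2 := (LinearMap.range ((B.G x).prod B.eta)).finrank_le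
    rw [h, finrank_bot] at h1
    rw [Module.finrank_prod, Complex.finrank_real_complex, Module.finrank_self] at h2
    omega
  have hy1 : B.G x y = 0 := congrArg Prod.fst hy
  have hy2 : B.eta y = 0 := congrArg Prod.snd hy
  obtain ⟨w, hw⟩ : ∃ w, B.G y w ≠ 0 := by
    by_contra! hcon
    exact hy0 (B.eq_zero_of_G hy2 hcon)
  -- Replacing $w$ by its component orthogonal to $x$ keeps $G(y,w)\neq0$ and places it in `S`,
  -- where polarization supplies the desired vector.
  have hw' : B.G y (w - B.J (B.G x w / B.G x x) x) ≠ 0 := by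
    rw [map_sub, B.G_J_right, B.G_symm y x, hy1, mul_zero, sub_zero]
    exact hw
  have hwS : w - B.J (B.G x w / B.G x x) x ∈ S := by
    change B.G x _ = 0
    rw [map_sub, B.G_J_right, div_mul_cancel₀ _ hx, sub_self]
  obtain ⟨z, hz, hzz⟩ := B.exists_G_self_ne_zero_of (S := S) hy1 hwS hw'
  exact ⟨z, hz, hzz⟩

/-- Algebraic curvature tensors which commute with `φ`. -/
structure IsCurvature (R : V → V → V → V) : Prop where
  add₁ : ∀ x x' y z, R (x + x') y z = R x y z + R x' y z
  smul₁ : ∀ (c : ℝ) x y z, R (c • x) y z = c • R x y z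
  add₃ : ∀ x y z z', R x y (z + z') = R x y z + R x y z'
  smul₃ : ∀ (c : ℝ) x y z, R x y (c • z) = c • R x y z
  skew : ∀ x y z, R x y z = -R y x z
  skew_g : ∀ x y z w, B.g (R x y z) w = -B.g (R x y w) z
  bianchi : ∀ x y z, R x y z + R y z x + R z x y = 0
  phi_comm : ∀ x y z, R x y (B.phi z) = B.phi (R x y z)

namespace IsCurvature

variable {B} {R : V → V → V → V} (h : B.IsCurvature R)

include h

theorem add₂ (x y y' z : V) : R x (y + y') z = R x y z + R x y' z := by
  rw [h.skew, h.add₁, h.skew y, h.skew y']; abel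

theorem smul₂ (c : ℝ) (x y z : V) : R x (c • y) z = c • R x y z := by
  rw [h.skew, h.smul₁, h.skew y, smul_neg, neg_neg]

/-- The classical argument: four instances of the first Bianchi identity combined with the two skew
symmetries. -/
theorem pair_symm (x y z w : V) : B.g (R x y z) w = B.g (R z w x) y := by
  have b : ∀ x y z w, B.g (R x y z) w + B.g (R y z x) w + B.g (R z x y) w = 0 := by
    intro x y z w
    have := congrArg (fun u => B.g u w) (h.bianchi x y z)
    simpa using this
  have s : ∀ x y z w, B.g (R x y z) w = -B.g (R y x z) w := by
    intro x y z w
    rw [h.skew]; simp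
  have t := h.skew_g
  have b1 := b x y z w
  have b2 := b y z w x
  have b3 := b z w x y
  have b4 := b w x y z
  linarith [s x y z w, s y x z w, t x y z w, t z w x y, s z w x y, t y z x w, t y z w x, t z x y w,
    t w x y z, t x y w z, s z w y x, t z w y x, s w y z x, s w y x z, t w y z x, t y w x z,
    s x z w y, s x z y w, t x z w y, s y w z x, t z x w y, s w x z y, t w x z y, s y z w x]

/-- Commuting with $\varphi$ gives $\varphi(R\xi)=0$, and skewness gives $\eta(R\xi)=g(R\xi,\xi)=0$;
the formula for $\varphi^2$ then kills $R\xi$. -/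
theorem xi_right (x y : V) : R x y B.xi = 0 := by
  have h1 : B.phi (R x y B.xi) = 0 := by
    rw [← h.phi_comm, B.phi_xi]
    have := h.smul₃ 0 x y 0
    simpa using this
  have h2 : B.g (R x y B.xi) B.xi = 0 := by linarith [h.skew_g x y B.xi B.xi]
  have h3 := B.phi_sq (R x y B.xi)
  rw [h1, map_zero, ← B.g_xi, h2, zero_smul, add_zero] at h3
  exact neg_eq_zero.mp h3.symm

theorem eta_eq_zero (x y z : V) : B.eta (R x y z) = 0 := by
  rw [← B.g_xi, h.skew_g, h.xi_right]; simp

/-- Pair symmetry turns the first two slots into the last two, where $\varphi$ commutes with the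
curvature and is self-adjoint. -/
theorem phi_swap (x y z : V) : R (B.phi x) y z = R x (B.phi y) z := by
  apply B.ext_g
  intro w
  rw [h.pair_symm, h.phi_comm, B.g_phi_left, ← h.pair_symm]

/-- Insert $\varphi$ in each slot of the Bianchi identity in turn. Adding the three relations and
using the identity for $\varphi R$ shows that $R(\varphi x,y)z+R(\varphi y,z)x+R(\varphi z,x)y=0$.
Comparison with the relation having $\varphi$ on $z$ isolates the first term. -/
theorem phi_left (x y z : V) : R (B.phi x) y z = B.phi (R x y z) := by
  have b0 := congrArg B.phi (h.bianchi x y z)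
  simp only [map_add, map_zero] at b0
  have b1 := h.bianchi (B.phi x) y z
  have b2 := h.bianchi x (B.phi y) z
  have b3 := h.bianchi x y (B.phi z)
  rw [h.phi_comm] at b1 b2 b3
  rw [← h.phi_swap z x, ] at b1
  rw [← h.phi_swap x y] at b2
  rw [← h.phi_swap y z] at b3
  have hsum : (2 : ℝ) • (R (B.phi x) y z + R (B.phi y) z x + R (B.phi z) x y) = 0 := by
    have := congrArg₂ (· + ·) (congrArg₂ (· + ·) b1 b2) b3
    simp only [add_zero] at this
    rw [two_smul, ← this]
    have h4 : B.phi (R x y z) + B.phi (R y z x) + B.phi (R z x y) = 0 := b0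
    calc _ = (R (B.phi x) y z + R (B.phi y) z x + R (B.phi z) x y) +
        (R (B.phi x) y z + R (B.phi y) z x + R (B.phi z) x y) +
        (B.phi (R x y z) + B.phi (R y z x) + B.phi (R z x y)) := by rw [h4, add_zero]
      _ = _ := by abel
  have hsum' := (smul_eq_zero.mp hsum).resolve_left two_ne_zero
  have := hsum'.trans b3.symm
  have h5 : R (B.phi x) y z + (R (B.phi y) z x + R (B.phi z) x y) =
      B.phi (R x y z) + (R (B.phi y) z x + R (B.phi z) x y) := by
    rw [← add_assoc, ← add_assoc, this]
  exact add_right_cancel h5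

theorem J_left (a : ℂ) (x y z : V) : R (B.J a x) y z = B.J a (R x y z) := by
  have hneg : ∀ x, R (-x) y z = -R x y z := fun x => by
    have := h.smul₁ (-1) x y z
    simpa using this
  rw [B.J_apply, h.add₁, hneg, h.smul₁, h.smul₁, h.phi_left, h.phi_left, B.J_apply]

theorem J_middle (a : ℂ) (x y z : V) : R x (B.J a y) z = B.J a (R x y z) := by
  rw [h.skew, h.J_left, h.skew y, map_neg, neg_neg]

theorem J_right (a : ℂ) (x y z : V) : R x y (B.J a z) = B.J a (R x y z) := by
  have hneg : ∀ z, R x y (-z) = -R x y z := fun z => by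
    have := h.smul₃ (-1) x y z
    simpa using this
  rw [B.J_apply, h.add₃, hneg, h.smul₃, h.smul₃, h.phi_comm, h.phi_comm, B.J_apply]

theorem self (x z : V) : R x x z = 0 := by
  have := h.skew x x z
  have h2 : (2 : ℝ) • R x x z = 0 := by
    rw [two_smul]; nth_rewrite 1 [this]; exact neg_add_cancel _
  exact (smul_eq_zero.mp h2).resolve_left two_ne_zero

theorem skew_G (x y z w : V) : B.G (R x y z) w = -B.G (R x y w) z := by
  apply Complex.ext
  · rw [B.G_re', Complex.neg_re, B.G_re', h.skew_g, h.eta_eq_zero, h.eta_eq_zero]; ring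
  · rw [B.G_im, Complex.neg_im, B.G_im, ← B.g_phi_left, ← h.phi_comm, h.skew_g]

end IsCurvature

end ContactBForm

end

/-! ### Totally real sectional curvatures determine the curvature tensor. -/

section


/-- A polynomial of degree four which vanishes near `0` has vanishing leading coefficient. -/
theorem quartic_coeff_eq_zero {c₀ c₁ c₂ c₃ c₄ : ℂ}
    (h : ∀ᶠ s : ℝ in 𝓝 0, c₀ + c₁ * s + c₂ * s ^ 2 + c₃ * s ^ 3 + c₄ * s ^ 4 = 0) : c₄ = 0 := by
  open Polynomial in
  set p : ℂ[X] := C c₀ + C c₁ * X + C c₂ * X ^ 2 + C c₃ * X ^ 3 + C c₄ * X ^ 4 with hp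
  have hinf : Set.Infinite {z | p.IsRoot z} := by
    have h1 : Set.Infinite {s : ℝ | c₀ + c₁ * s + c₂ * s ^ 2 + c₃ * s ^ 3 + c₄ * s ^ 4 = 0} :=
      infinite_of_mem_nhds 0 h
    refine (h1.image (f := fun s : ℝ => (s : ℂ)) Complex.ofReal_injective.injOn).mono ?_
    rintro _ ⟨s, hs, rfl⟩
    simpa [hp, Polynomial.IsRoot] using hs
  have h0 := Polynomial.eq_zero_of_infinite_isRoot p hinf
  have h4 : p.coeff 4 = c₄ := by
    simp [hp]
  rw [← h4, h0, Polynomial.coeff_zero]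

namespace ContactBForm

variable {V : Type*} [AddCommGroup V] [Module ℝ V] (B : ContactBForm V)

namespace IsCurvature

variable {B} {R : V → V → V → V} (h : B.IsCurvature R)

include h

/-- A curvature tensor with vanishing sectional curvatures vanishes. -/
theorem eq_zero_of_sectional (h0 : ∀ x y, B.g (R x y y) x = 0) (x y z : V) : R x y z = 0 := by
  have s : ∀ x y z w, B.g (R x y z) w = -B.g (R y x z) w := by
    intro x y z w
    rw [h.skew]; simp
  -- Polarization in the second vector; `h2` then polarizes in the first. The three terms of the
  -- Bianchi identity become equal, hence zero.
  have h1 : ∀ x y z, B.g (R x y z) x = 0 := by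
    intro x y z
    have e1 := h0 x (y + z)
    rw [h.add₂, h.add₃, h.add₃] at e1
    simp only [map_add, LinearMap.add_apply] at e1
    have e2 := h.pair_symm x z y x
    have e3 := h.skew_g y x x z
    have e4 := s y x z x
    have e5 := h.pair_symm x y z x
    linarith [h0 x y, h0 x z, h.skew_g y x z x, h.pair_symm y x x z]
  have h2 : ∀ x y z w, B.g (R x y z) w = -B.g (R w y z) x := by
    intro x y z w
    have e1 := h1 (x + w) y z
    rw [h.add₁] at e1
    simp only [map_add, LinearMap.add_apply] at e1
    linarith [h1 x y z, h1 w y z]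
  apply B.g_nondegenerate
  intro w
  have b := congrArg (fun u => B.g u w) (h.bianchi x y z)
  simp only [map_add, LinearMap.add_apply, map_zero, LinearMap.zero_apply] at b
  have e1 : B.g (R y z x) w = B.g (R x y z) w := by
    linarith [h2 y z x w, h.skew_g w z x y, h2 w z y x, s x z y w, h2 z x y w, h.skew_g w x y z,
      h2 w x z y, s y x z w, h.skew_g y z x w, h2 y z w x, h.skew_g x z w y, s x z y w,
      h2 x z y w, h2 x y z w]
  have e2 : B.g (R z x y) w = B.g (R x y z) w := by
    linarith [h2 z x y w, h.skew_g w x y z, h2 w x z y, s y x z w]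
  linarith

/-- Only the coefficient of $s^4$ matters: it is the sectional curvature of an arbitrary pair,
recovered from generic pairs near $(x_0,y_0)$. -/
theorem sectional_expand (x₀ y₀ x y : V) (s : ℝ) :
    B.G (R (x₀ + s • x) (y₀ + s • y) (y₀ + s • y)) (x₀ + s • x) =
      B.G (R x₀ y₀ y₀) x₀ +
      (B.G (R x y₀ y₀) x₀ + B.G (R x₀ y y₀) x₀ + B.G (R x₀ y₀ y) x₀ + B.G (R x₀ y₀ y₀) x) * s +
      (B.G (R x y y₀) x₀ + B.G (R x y₀ y) x₀ + B.G (R x y₀ y₀) x + B.G (R x₀ y y) x₀ +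
        B.G (R x₀ y y₀) x + B.G (R x₀ y₀ y) x) * s ^ 2 +
      (B.G (R x y y) x₀ + B.G (R x y y₀) x + B.G (R x y₀ y) x + B.G (R x₀ y y) x) * s ^ 3 +
      B.G (R x y y) x * s ^ 4 := by
  simp only [h.add₁, h.add₂, h.add₃, h.smul₁, h.smul₂, h.smul₃, map_add, map_smul,
    LinearMap.add_apply, LinearMap.smul_apply, Complex.real_smul]
  ring

/-- If the totally real sectional curvatures vanish, so does the curvature tensor. -/
theorem eq_zero_of_totallyReal [FiniteDimensional ℝ V] (hV : 4 ≤ Module.finrank ℝ V)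
    (h0 : ∀ x y, B.eta x = 0 → B.eta y = 0 → B.g (B.phi x) x = 0 → B.g (B.phi x) y = 0 →
      B.g (B.phi y) y = 0 → B.g x x * B.g y y - B.g x y ^ 2 ≠ 0 →
      B.g (R x y y) x = 0 ∧ B.g (R x y y) (B.phi x) = 0) (x y z : V) : R x y z = 0 := by
  have hG : ∀ x y, B.g (R x y y) x = 0 → B.g (R x y y) (B.phi x) = 0 →
      B.G (R x y y) x = 0 := by
    intro x y h1 h2
    apply Complex.ext
    · rw [B.G_re', h1, h.eta_eq_zero]; simp
    · rw [B.G_im, h2]; simp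
  -- orthonormal pairs
  have horth : ∀ x y, B.eta x = 0 → B.eta y = 0 → B.G x x = 1 → B.G y y = 1 → B.G x y = 0 →
      B.G (R x y y) x = 0 := by
    intro x y hx hy hxx hyy hxy
    have g1 : ∀ u v, B.g (B.phi u) v = -(B.G u v).im := fun u v => by
      rw [B.G_im, B.g_phi_left]; ring
    have g2 : ∀ u v, B.eta u = 0 → B.g u v = (B.G u v).re := fun u v hu => by
      rw [B.G_re', hu]; ring
    have h1 := h0 x y hx hy (by simp [g1, hxx]) (by simp [g1, hxy]) (by simp [g1, hyy])
      (by simp [g2 x _ hx, g2 y _ hy, hxx, hyy, hxy])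
    exact hG x y h1.1 h1.2
  have hself : ∀ x y z, B.G (R y z x) x = 0 := fun x y z => by
    have := h.skew_G y z x x
    have h2 : (2 : ℂ) * B.G (R y z x) x = 0 := by linear_combination this
    simpa using h2
  -- generic pairs
  have hgen : ∀ x y, B.G x x ≠ 0 → B.G x x * B.G y y - B.G x y ^ 2 ≠ 0 →
      B.G (R x y y) x = 0 := by
    intro x y hxx hΔ
    obtain ⟨s, hs⟩ := IsAlgClosed.exists_pow_nat_eq (B.G x x) (n := 2) (by norm_num)
    have hs0 : s ≠ 0 := by rintro rfl; apply hxx; rw [← hs]; simp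
    set a := B.G x y / B.G x x with ha
    have hax : a * B.G x x = B.G x y := div_mul_cancel₀ _ hxx
    set y' := y - B.J a x with hy'
    have hxy' : B.G x y' = 0 := by
      rw [hy', map_sub, B.G_J_right, hax, sub_self]
    have hyy' : B.G y' y' * B.G x x = B.G x x * B.G y y - B.G x y ^ 2 := by
      have : B.G y' y' = B.G y y - a * B.G x y := by
        calc B.G y' y' = B.G y' (y - B.J a x) := by rw [← hy']
          _ = B.G y' y := by rw [map_sub, B.G_J_right, B.G_symm y' x, hxy', mul_zero, sub_zero]
          _ = _ := by rw [hy', map_sub, LinearMap.sub_apply, B.G_J_left]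
      rw [this]
      linear_combination -(B.G x y) * hax
    have hyy0 : B.G y' y' ≠ 0 := fun h => hΔ (by rw [← hyy', h, zero_mul])
    obtain ⟨t, ht⟩ := IsAlgClosed.exists_pow_nat_eq (B.G y' y') (n := 2) (by norm_num)
    have ht0 : t ≠ 0 := by rintro rfl; apply hyy0; rw [← ht]; simp
    have key := horth (B.J s⁻¹ x) (B.J t⁻¹ y') (B.eta_J _ _) (B.eta_J _ _)
      (by rw [B.G_J_left, B.G_J_right, ← hs]; field_simp)
      (by rw [B.G_J_left, B.G_J_right, ← ht]; field_simp)
      (by rw [B.G_J_left, B.G_J_right, hxy', mul_zero, mul_zero])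
    rw [h.J_left, h.J_middle, h.J_right, B.G_J_left, B.G_J_left, B.G_J_left, B.G_J_right] at key
    have key2 : B.G (R x y' y') x = 0 := by
      have : s⁻¹ ≠ 0 := inv_ne_zero hs0
      have : t⁻¹ ≠ 0 := inv_ne_zero ht0
      simpa [hs0, ht0] using key
    have e1 : ∀ z, R x y' z = R x y z := by
      intro z
      have : y = y' + B.J a x := by rw [hy']; abel
      rw [this, h.add₂, h.J_middle, h.self, map_zero, add_zero]
    rw [e1, hy', sub_eq_add_neg, ← neg_one_smul ℝ (B.J a x), h.add₃, h.smul₃, h.J_right, map_add,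
      LinearMap.add_apply, map_smul, LinearMap.smul_apply, B.G_J_left, hself, mul_zero, smul_zero,
      add_zero] at key2
    exact key2
  obtain ⟨x₀, hx₀⟩ := B.exists_G_self_ne_zero (by omega : 2 ≤ Module.finrank ℝ V)
  obtain ⟨y₀, hxy₀, hy₀⟩ := B.exists_G_orthogonal hV hx₀
  have hall : ∀ x y, B.G (R x y y) x = 0 := by
    intro x y
    have hGc : ∀ u v u' v' : V, Continuous fun s : ℝ => B.G (u + s • u') (v + s • v') := by
      intro u v u' v'
      simp only [map_add, map_smul, LinearMap.add_apply, LinearMap.smul_apply]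
      fun_prop
    have ev1 : ∀ᶠ s : ℝ in 𝓝 0, B.G (x₀ + s • x) (x₀ + s • x) ≠ 0 :=
      (hGc x₀ x₀ x x).continuousAt.eventually_ne (by simpa using hx₀)
    have ev2 : ∀ᶠ s : ℝ in 𝓝 0, B.G (x₀ + s • x) (x₀ + s • x) * B.G (y₀ + s • y) (y₀ + s • y) -
        B.G (x₀ + s • x) (y₀ + s • y) ^ 2 ≠ 0 :=
      (((hGc x₀ x₀ x x).mul (hGc y₀ y₀ y y)).sub
        ((hGc x₀ y₀ x y).pow 2)).continuousAt.eventually_ne (by simp [hx₀, hy₀, hxy₀])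
    exact quartic_coeff_eq_zero ((ev1.and ev2).mono fun s hs =>
      (h.sectional_expand x₀ y₀ x y s).symm.trans (hgen _ _ hs.1 hs.2))
  refine h.eq_zero_of_sectional (fun x y => ?_) x y z
  have := congrArg Complex.re (hall x y)
  rw [B.G_re', h.eta_eq_zero] at this
  simpa using this

end IsCurvature

/-- The curvature tensor of constant holomorphic sectional curvature `c`. -/
def model (c : ℂ) (x y z : V) : V := B.J (c * B.G y z) x - B.J (c * B.G x z) y

theorem J_sub (a b : ℂ) (u : V) : B.J (a - b) u = B.J a u - B.J b u := by
  rw [sub_eq_add_neg, J_add, J_neg, sub_eq_add_neg]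

theorem isCurvature_model (c : ℂ) : B.IsCurvature (B.model c) where
  add₁ x x' y z := by
    simp only [model, map_add, LinearMap.add_apply, mul_add, B.J_add]; abel
  smul₁ a x y z := by
    simp only [model, map_smul, LinearMap.smul_apply, mul_smul_comm, B.J_real_smul, smul_sub]
  add₃ x y z z' := by
    simp only [model, map_add, mul_add, B.J_add]; abel
  smul₃ a x y z := by
    simp only [model, map_smul, mul_smul_comm, B.J_real_smul, smul_sub]
  skew x y z := by simp only [model]; abel
  skew_g x y z w := by
    have e : ∀ u a v, B.g (B.J a u) v = (a * B.G u v).re := by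
      intro u a v
      have := B.G_re' (B.J a u) v
      rw [B.eta_J, B.G_J_left] at this
      linarith
    simp only [model, map_sub, LinearMap.sub_apply, e]
    rw [← Complex.sub_re, ← Complex.sub_re, ← Complex.neg_re]
    congr 1
    ring
  bianchi x y z := by
    simp only [model]
    rw [B.G_symm z x, B.G_symm z y, B.G_symm y x]
    abel
  phi_comm x y z := by
    simp only [model, B.G_phi_right, map_sub, ← B.J_I_mul]
    congr 2
    · congr 1; ring
    · congr 1; ring

/-- A curvature tensor with constant totally real sectional curvatures has constant holomorphic
sectional curvature. -/
theorem IsCurvature.eq_model [FiniteDimensional ℝ V] (hV : 4 ≤ Module.finrank ℝ V)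
    {B : ContactBForm V} {R : V → V → V → V} (h : B.IsCurvature R) {ν ν' : ℝ}
    (h0 : ∀ x y, B.eta x = 0 → B.eta y = 0 → B.g (B.phi x) x = 0 → B.g (B.phi x) y = 0 →
      B.g (B.phi y) y = 0 → B.g x x * B.g y y - B.g x y ^ 2 ≠ 0 →
      B.g (R x y y) x = ν * (B.g x x * B.g y y - B.g x y ^ 2) ∧
      B.g (R x y y) (B.phi x) = ν' * (B.g x x * B.g y y - B.g x y ^ 2)) (x y z : V) :
    R x y z = B.model ⟨ν, -ν'⟩ x y z := by
  -- The minus sign matches the imaginary part of `G`, which is $-g(\cdot,\varphi\,\cdot)$.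
  set c : ℂ := ⟨ν, -ν'⟩
  have hm := B.isCurvature_model c
  have hd : B.IsCurvature (fun x y z => R x y z - B.model c x y z) := by
    constructor
    · intro x x' y z; rw [h.add₁, hm.add₁]; abel
    · intro a x y z; rw [h.smul₁, hm.smul₁, smul_sub]
    · intro x y z z'; rw [h.add₃, hm.add₃]; abel
    · intro a x y z; rw [h.smul₃, hm.smul₃, smul_sub]
    · intro x y z; rw [h.skew, hm.skew]; abel
    · intro x y z w
      rw [map_sub, map_sub, LinearMap.sub_apply, LinearMap.sub_apply, h.skew_g, hm.skew_g]; ring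
    · intro x y z
      have h1 := h.bianchi x y z
      have h2 := hm.bianchi x y z
      calc _ = (R x y z + R y z x + R z x y) -
          (B.model c x y z + B.model c y z x + B.model c z x y) := by abel
        _ = 0 := by rw [h1, h2, sub_zero]
    · intro x y z; rw [h.phi_comm, hm.phi_comm, map_sub]
  rw [← sub_eq_zero]
  refine hd.eq_zero_of_totallyReal hV ?_ x y z
  intro x y hx hy hxx hxy hyy hg
  obtain ⟨h1, h2⟩ := h0 x y hx hy hxx hxy hyy hg
  have e : ∀ u v, B.eta u = 0 → B.g u v = (B.G u v).re := fun u v hu => by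
    rw [B.G_re', hu]; ring
  have im0 : ∀ u v, B.g (B.phi u) v = 0 → (B.G u v).im = 0 := fun u v huv => by
    rw [B.G_im, ← B.g_phi_left, huv, neg_zero]
  have Gx : B.G x x = (B.g x x : ℂ) := Complex.ext (by simp [e x x hx]) (by simp [im0 _ _ hxx])
  have Gy : B.G y y = (B.g y y : ℂ) := Complex.ext (by simp [e y y hy]) (by simp [im0 _ _ hyy])
  have Gxy : B.G x y = (B.g x y : ℂ) := Complex.ext (by simp [e x y hx]) (by simp [im0 _ _ hxy])
  have hM : B.G (B.model c x y y) x =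
      c * ((B.g x x * B.g y y - B.g x y ^ 2 : ℝ) : ℂ) := by
    simp only [model, map_sub, LinearMap.sub_apply, B.G_J_left]
    rw [B.G_symm y x, Gx, Gy, Gxy]
    push_cast
    ring
  constructor
  · have h3 : B.g (B.model c x y y) x = ν * (B.g x x * B.g y y - B.g x y ^ 2) := by
      rw [e _ _ (hm.eta_eq_zero _ _ _), hM, Complex.re_mul_ofReal]
    rw [map_sub, LinearMap.sub_apply, h1, h3, sub_self]
  · have h3 : B.g (B.model c x y y) (B.phi x) = ν' * (B.g x x * B.g y y - B.g x y ^ 2) := by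
      have := B.G_im (B.model c x y y) x
      rw [hM, Complex.im_mul_ofReal] at this
      linarith
    rw [map_sub, LinearMap.sub_apply, h2, h3, sub_self]

end ContactBForm

end

/-! ### F₀-structures on open sets: symmetries of the curvature and the second Bianchi identity. -/

section


open Filter Set

/-- An `F₀` almost contact B-metric structure with its Levi-Civita connection, on an open subset
`U` of a normed space: `Gam y u w` is `∇_u w` at `y`, for constant fields `u` and `w`. -/
structure F0Data (E : Type*) [NormedAddCommGroup E] [NormedSpace ℝ E] (U : Set E) where
  phi : E → E →L[ℝ] E
  xi : E → E
  eta : E → E →L[ℝ] ℝ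
  g : E → E →L[ℝ] E →L[ℝ] ℝ
  Gam : E → E →L[ℝ] E →L[ℝ] E
  isOpen : IsOpen U
  smooth_phi : ContDiffOn ℝ ∞ phi U
  smooth_g : ContDiffOn ℝ ∞ g U
  smooth_Gam : ContDiffOn ℝ ∞ Gam U
  phi_sq : ∀ y ∈ U, ∀ u, phi y (phi y u) = -u + eta y u • xi y
  eta_xi : ∀ y ∈ U, eta y (xi y) = 1
  g_symm : ∀ y ∈ U, ∀ u v, g y u v = g y v u
  g_nondegenerate : ∀ y ∈ U, ∀ u, (∀ v, g y u v = 0) → u = 0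
  g_phi : ∀ y ∈ U, ∀ u v, g y (phi y u) (phi y v) = - g y u v + eta y u * eta y v
  Gam_symm : ∀ y ∈ U, ∀ u v, Gam y u v = Gam y v u
  metric : ∀ y ∈ U, ∀ u v w, fderiv ℝ g y u v w = g y (Gam y u v) w + g y v (Gam y u w)
  parallel_phi : ∀ y ∈ U, ∀ u v, fderiv ℝ phi y u v = phi y (Gam y u v) - Gam y u (phi y v)

/-- The curvature of the connection with Christoffel symbols `Gam` (for constant fields). -/
def chartCurvature {E : Type*} [NormedAddCommGroup E] [NormedSpace ℝ E]
    (Gam : E → E →L[ℝ] E →L[ℝ] E) (y u v w : E) : E :=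
  fderiv ℝ Gam y u v w - fderiv ℝ Gam y v u w + Gam y u (Gam y v w) - Gam y v (Gam y u w)

namespace F0Data

variable {E : Type*} [NormedAddCommGroup E] [NormedSpace ℝ E] {U : Set E} (D : F0Data E U)

/-- The algebraic structure at a point. -/
def form {y : E} (hy : y ∈ U) : ContactBForm E where
  phi := (D.phi y).toLinearMap
  xi := D.xi y
  eta := (D.eta y).toLinearMap
  g := LinearMap.mk₂ ℝ (fun u v => D.g y u v) (by simp) (by simp) (by simp) (by simp)
  phi_sq := D.phi_sq y hy
  eta_xi := D.eta_xi y hy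
  g_symm := D.g_symm y hy
  g_nondegenerate := D.g_nondegenerate y hy
  g_phi := D.g_phi y hy

theorem hasDerivAt_line {F : Type*} [NormedAddCommGroup F] [NormedSpace ℝ F] {f : E → F}
    {f' : E →L[ℝ] F} {y : E} (hf : HasFDerivAt f f' y) (u : E) :
    HasDerivAt (fun t : ℝ => f (y + t • u)) (f' u) 0 := by
  have h1 : HasDerivAt (fun t : ℝ => y + t • u) u 0 := by
    simpa using ((hasDerivAt_id (0 : ℝ)).smul_const u).const_add y
  have h2 : HasFDerivAt f f' (y + (0 : ℝ) • u) := by simpa using hf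
  exact HasFDerivAt.comp_hasDerivAt (0 : ℝ) (f := fun t : ℝ => y + t • u) h2 h1

theorem eventually_line {y : E} (u : E) {p : E → Prop} (h : ∀ᶠ z in 𝓝 y, p z) :
    ∀ᶠ t : ℝ in 𝓝 0, p (y + t • u) := by
  have h1 : ContinuousAt (fun t : ℝ => y + t • u) 0 := by fun_prop
  have h2 : Tendsto (fun t : ℝ => y + t • u) (𝓝 0) (𝓝 y) := by simpa using h1.tendsto
  exact h2.eventually h

variable {y : E} (hy : y ∈ U)

include D hy

theorem mem_nhds : U ∈ 𝓝 y := D.isOpen.mem_nhds hy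

theorem hasFDerivAt_g : HasFDerivAt D.g (fderiv ℝ D.g y) y :=
  ((D.smooth_g.contDiffAt (D.mem_nhds hy)).differentiableAt (by simp)).hasFDerivAt

theorem hasFDerivAt_phi : HasFDerivAt D.phi (fderiv ℝ D.phi y) y :=
  ((D.smooth_phi.contDiffAt (D.mem_nhds hy)).differentiableAt (by simp)).hasFDerivAt

theorem hasFDerivAt_Gam : HasFDerivAt D.Gam (fderiv ℝ D.Gam y) y :=
  ((D.smooth_Gam.contDiffAt (D.mem_nhds hy)).differentiableAt (by simp)).hasFDerivAt

theorem hasFDerivAt_fderiv {F : Type*} [NormedAddCommGroup F] [NormedSpace ℝ F] {f : E → F}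
    (hf : ContDiffOn ℝ ∞ f U) :
    HasFDerivAt (fderiv ℝ f) (fderiv ℝ (fderiv ℝ f) y) y :=
  (((hf.contDiffAt (D.mem_nhds hy)).fderiv_right (m := 1) (by
    exact WithTop.coe_le_coe.mpr le_top)).differentiableAt one_ne_zero).hasFDerivAt

theorem fderiv_fderiv_symm {F : Type*} [NormedAddCommGroup F] [NormedSpace ℝ F] {f : E → F}
    (hf : ContDiffOn ℝ ∞ f U) (u v : E) :
    fderiv ℝ (fderiv ℝ f) y u v = fderiv ℝ (fderiv ℝ f) y v u := by
  refine second_derivative_symmetric_of_eventually (f := f) ?_ (D.hasFDerivAt_fderiv hy hf) u v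
  filter_upwards [D.mem_nhds hy] with z hz
  exact ((hf.contDiffAt (D.isOpen.mem_nhds hz)).differentiableAt (by simp)).hasFDerivAt

theorem fderiv_Gam_symm (u v w : E) : fderiv ℝ D.Gam y u v w = fderiv ℝ D.Gam y u w v := by
  have h1 := ((hasDerivAt_line (D.hasFDerivAt_Gam hy) u).clm_apply
    (hasDerivAt_const (0 : ℝ) v)).clm_apply (hasDerivAt_const (0 : ℝ) w)
  have h2 := ((hasDerivAt_line (D.hasFDerivAt_Gam hy) u).clm_apply
    (hasDerivAt_const (0 : ℝ) w)).clm_apply (hasDerivAt_const (0 : ℝ) v)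
  have h3 := h1.unique (h2.congr_of_eventuallyEq
    ((eventually_line u (D.mem_nhds hy)).mono fun t ht => D.Gam_symm _ ht v w))
  simpa using h3

/-- Differentiate metric compatibility once more and antisymmetrize: the second derivatives of the
metric cancel. -/
theorem curvature_skew_g (u v z w : E) :
    D.g y (chartCurvature D.Gam y u v z) w = -D.g y (chartCurvature D.Gam y u v w) z := by
  have key : ∀ u v, fderiv ℝ (fderiv ℝ D.g) y u v z w =
      (D.g y (D.Gam y u (D.Gam y v z)) w + D.g y (D.Gam y v z) (D.Gam y u w) +
        D.g y (fderiv ℝ D.Gam y u v z) w) +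
      (D.g y (D.Gam y u z) (D.Gam y v w) + D.g y z (D.Gam y u (D.Gam y v w)) +
        D.g y z (fderiv ℝ D.Gam y u v w)) := by
    intro u v
    have hg := hasDerivAt_line (D.hasFDerivAt_g hy) u
    have hG := hasDerivAt_line (D.hasFDerivAt_Gam hy) u
    have hc : ∀ a : E, HasDerivAt (fun _ : ℝ => a) 0 0 := fun a => hasDerivAt_const 0 a
    have h1 := (((hasDerivAt_line (D.hasFDerivAt_fderiv hy D.smooth_g) u).clm_apply
      (hc v)).clm_apply (hc z)).clm_apply (hc w)
    have h2 := (hg.clm_apply ((hG.clm_apply (hc v)).clm_apply (hc z))).clm_apply (hc w)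
    have h3 := (hg.clm_apply (hc z)).clm_apply ((hG.clm_apply (hc v)).clm_apply (hc w))
    have h4 := h1.unique ((h2.add h3).congr_of_eventuallyEq
      ((eventually_line u (D.mem_nhds hy)).mono fun t ht => D.metric _ ht v z w))
    simp [D.metric y hy] at h4
    rw [h4]
  have h1 := D.fderiv_fderiv_symm hy D.smooth_g u v
  have h2 := congrArg (fun L => L z w) h1
  simp only [key] at h2
  simp only [chartCurvature, map_add, map_sub, add_apply, sub_apply]
  have s := D.g_symm y hy
  rw [s _ z, s _ z, s _ z, s _ z]
  linarith [s (D.Gam y v z) (D.Gam y u w), s (D.Gam y u z) (D.Gam y v w)]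

/-- The Ricci identity for the parallel tensor $\varphi$: second derivatives of $\varphi$ are
symmetric, so the antisymmetrized derivative of the parallelism equation leaves the commutator with
the curvature. -/
theorem curvature_phi_comm (u v w : E) :
    chartCurvature D.Gam y u v (D.phi y w) = D.phi y (chartCurvature D.Gam y u v w) := by
  have key : ∀ u v, fderiv ℝ (fderiv ℝ D.phi) y u v w =
      D.phi y (D.Gam y u (D.Gam y v w)) - D.Gam y u (D.phi y (D.Gam y v w)) +
        D.phi y (fderiv ℝ D.Gam y u v w) - fderiv ℝ D.Gam y u v (D.phi y w) -
        D.Gam y v (D.phi y (D.Gam y u w)) + D.Gam y v (D.Gam y u (D.phi y w)) := by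
    intro u v
    have hp := hasDerivAt_line (D.hasFDerivAt_phi hy) u
    have hG := hasDerivAt_line (D.hasFDerivAt_Gam hy) u
    have hc : ∀ a : E, HasDerivAt (fun _ : ℝ => a) 0 0 := fun a => hasDerivAt_const 0 a
    have h1 := ((hasDerivAt_line (D.hasFDerivAt_fderiv hy D.smooth_phi) u).clm_apply
      (hc v)).clm_apply (hc w)
    have h2 := hp.clm_apply ((hG.clm_apply (hc v)).clm_apply (hc w))
    have h3 := (hG.clm_apply (hc v)).clm_apply (hp.clm_apply (hc w))
    have h4 := h1.unique ((h2.sub h3).congr_of_eventuallyEq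
      ((eventually_line u (D.mem_nhds hy)).mono fun t ht => D.parallel_phi _ ht v w))
    simp [D.parallel_phi y hy] at h4
    rw [h4]; abel
  have h1 := D.fderiv_fderiv_symm hy D.smooth_phi u v
  have h2 := congrArg (fun L => L w) h1
  simp only [key] at h2
  simp only [chartCurvature, map_add, map_sub]
  rw [← sub_eq_zero] at h2 ⊢
  rw [← neg_eq_zero, ← h2]
  abel

theorem isCurvature : (D.form hy).IsCurvature (chartCurvature D.Gam y) where
  add₁ x x' v z := by simp [chartCurvature]; abel
  smul₁ c x v z := by simp [chartCurvature, smul_sub, smul_add]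
  add₃ x v z z' := by simp [chartCurvature]; abel
  smul₃ c x v z := by simp [chartCurvature, smul_sub, smul_add]
  skew x v z := by simp only [chartCurvature]; abel
  skew_g x v z w := D.curvature_skew_g hy x v z w
  bianchi x v z := by
    simp only [chartCurvature]
    rw [D.fderiv_Gam_symm hy x z v, D.fderiv_Gam_symm hy z v x, D.fderiv_Gam_symm hy v z x,
      D.Gam_symm y hy z v, D.Gam_symm y hy z x, D.Gam_symm y hy x v]
    abel
  phi_comm x v z := D.curvature_phi_comm hy x v z

/-- The derivative of the curvature tensor along a line. -/
theorem hasDerivAt_curvature (u v w z : E) :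
    HasDerivAt (fun t : ℝ => chartCurvature D.Gam (y + t • u) v w z)
      (fderiv ℝ (fderiv ℝ D.Gam) y u v w z - fderiv ℝ (fderiv ℝ D.Gam) y u w v z +
        (fderiv ℝ D.Gam y u v (D.Gam y w z) + D.Gam y v (fderiv ℝ D.Gam y u w z)) -
        (fderiv ℝ D.Gam y u w (D.Gam y v z) + D.Gam y w (fderiv ℝ D.Gam y u v z))) 0 := by
  have hG := hasDerivAt_line (D.hasFDerivAt_Gam hy) u
  have hG' := hasDerivAt_line (D.hasFDerivAt_fderiv hy D.smooth_Gam) u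
  have hc : ∀ a : E, HasDerivAt (fun _ : ℝ => a) 0 0 := fun a => hasDerivAt_const 0 a
  have h1 : ∀ a b : E, HasDerivAt (fun t : ℝ => fderiv ℝ D.Gam (y + t • u) a b z)
      (fderiv ℝ (fderiv ℝ D.Gam) y u a b z) 0 := fun a b => by
    simpa using ((hG'.clm_apply (hc a)).clm_apply (hc b)).clm_apply (hc z)
  have h2 : ∀ a b : E, HasDerivAt (fun t : ℝ => D.Gam (y + t • u) a (D.Gam (y + t • u) b z))
      (fderiv ℝ D.Gam y u a (D.Gam y b z) + D.Gam y a (fderiv ℝ D.Gam y u b z)) 0 := fun a b => by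
    simpa using (hG.clm_apply (hc a)).clm_apply ((hG.clm_apply (hc b)).clm_apply (hc z))
  exact (((h1 v w).sub (h1 w v)).add (h2 v w)).sub (h2 w v)

/-- The second Bianchi identity. -/
theorem second_bianchi {z : E} {δ : E → E → E → E}
    (hδ : ∀ u v w, HasDerivAt (fun t : ℝ => chartCurvature D.Gam (y + t • u) v w z) (δ u v w) 0)
    (u v w : E) :
    (δ u v w + D.Gam y u (chartCurvature D.Gam y v w z) -
        chartCurvature D.Gam y v w (D.Gam y u z)) +
      (δ v w u + D.Gam y v (chartCurvature D.Gam y w u z) -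
        chartCurvature D.Gam y w u (D.Gam y v z)) +
      (δ w u v + D.Gam y w (chartCurvature D.Gam y u v z) -
        chartCurvature D.Gam y u v (D.Gam y w z)) = 0 := by
  -- The terms $R(\Gamma_uv,w)z$ of the full covariant derivative do not appear, since they cancel
  -- in the cyclic sum by symmetry of $\Gamma$. Keeping `δ` arbitrary lets any formula for the
  -- derivative of the curvature be inserted.
  have e : ∀ u v w, δ u v w = _ := fun u v w => (hδ u v w).unique (D.hasDerivAt_curvature hy u v w z)
  have s := fun a b => D.fderiv_fderiv_symm hy D.smooth_Gam a b
  rw [e, e, e, s v w, s w u, s u v]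
  simp only [chartCurvature, map_add, map_sub]
  abel

end F0Data

end

/-! ### Holomorphy and smoothness of the curvature function. -/

section


open Filter Set

/-- The differential identity for the sectional curvature which comes from the second Bianchi
identity means that the function is holomorphic. -/
theorem ContactBForm.holomorphic_of_model {V : Type*} [AddCommGroup V] [Module ℝ V]
    [FiniteDimensional ℝ V] (B : ContactBForm V) (hV : 4 ≤ Module.finrank ℝ V) (d : V →ₗ[ℝ] ℂ)
    (h : ∀ u v w z, B.model (d u) v w z + B.model (d v) w u z + B.model (d w) u v z = 0) (v : V) :
    d (B.phi v) = Complex.I * d v := by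
  have good : ∀ x, B.G x x ≠ 0 → d (B.phi x) = Complex.I * d x := by
    intro x hx
    obtain ⟨y, hxy, hyy⟩ := B.exists_G_orthogonal hV hx
    -- For $y$ orthogonal to $x$, and so also to $\varphi x$, this choice leaves only $(d(\varphi
    -- x)-i\,d(x))\,G(y,y)$ acting on $x$.
    have h1 := h (B.phi x) x y y
    simp only [ContactBForm.model, B.G_phi_left, hxy, mul_zero, B.J_zero, sub_zero, zero_sub,
      add_zero] at h1
    have h2 : B.J ((d (B.phi x) - Complex.I * d x) * B.G y y) x = 0 := by
      rw [sub_mul, B.J_sub, mul_assoc, B.J_I_mul, ← B.J_phi, sub_eq_add_neg]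
      exact h1
    have h3 := B.J_eq_zero hx h2
    exact sub_eq_zero.mp ((mul_eq_zero.mp h3).resolve_right hyy)
  obtain ⟨x₀, hx₀⟩ := B.exists_G_self_ne_zero (by omega : 2 ≤ Module.finrank ℝ V)
  by_cases hv : B.G v v = 0
  -- $G(v+x_0,v+x_0)+G(v-x_0,v-x_0)=2G(x_0,x_0)\neq0$, so an isotropic $v$ differs from an
  -- anisotropic vector by $\pm x_0$.
  · have hsum : B.G (v + x₀) (v + x₀) ≠ 0 ∨ B.G (v - x₀) (v - x₀) ≠ 0 := by
      by_contra! hcon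
      have e1 := hcon.1
      have e2 := hcon.2
      simp only [map_add, map_sub, LinearMap.add_apply, LinearMap.sub_apply, hv] at e1 e2
      apply hx₀
      linear_combination (e1 + e2) / 2
    have hx := good x₀ hx₀
    rcases hsum with h1 | h1
    · have := good _ h1
      simp only [map_add, mul_add, hx] at this
      exact add_right_cancel this
    · have := good _ h1
      simp only [map_sub, mul_sub, hx] at this
      exact sub_left_injective this
  · exact good v hv

namespace F0Data

variable {E : Type*} [NormedAddCommGroup E] [NormedSpace ℝ E] {U : Set E} (D : F0Data E U)

/-- The complex bilinear form, as a function of the point. -/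
def cform (y u v : E) : ℂ :=
  -(D.g y (D.phi y u) (D.phi y v) : ℂ) - (D.g y u (D.phi y v) : ℂ) * Complex.I

/-- Complex multiplication, as a function of the point. -/
def cmul (y : E) (a : ℂ) (u : E) : E := -(a.re • D.phi y (D.phi y u)) + a.im • D.phi y u

variable {y : E} (hy : y ∈ U)

include hy

theorem form_G (u v : E) : (D.form hy).G u v = D.cform y u v := by
  apply Complex.ext <;> simp [cform, ContactBForm.G_re, ContactBForm.G_im, form]

theorem form_J (a : ℂ) (u : E) : (D.form hy).J a u = D.cmul y a u := rfl

theorem hasDerivAt_phi (u v : E) : HasDerivAt (fun t : ℝ => D.phi (y + t • u) v)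
    (D.phi y (D.Gam y u v) - D.Gam y u (D.phi y v)) 0 := by
  have hp := hasDerivAt_line (D.hasFDerivAt_phi hy) u
  have := hp.clm_apply (hasDerivAt_const (0 : ℝ) v)
  refine this.congr_deriv ?_
  simp [D.parallel_phi y hy]

theorem hasDerivAt_phi_phi (u v : E) :
    HasDerivAt (fun t : ℝ => D.phi (y + t • u) (D.phi (y + t • u) v))
    (D.phi y (D.phi y (D.Gam y u v)) - D.Gam y u (D.phi y (D.phi y v))) 0 := by
  have hp := hasDerivAt_line (D.hasFDerivAt_phi hy) u
  have := hp.clm_apply (D.hasDerivAt_phi hy u v)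
  refine this.congr_deriv ?_
  simp [D.parallel_phi y hy]

theorem hasDerivAt_g (u : E) {v w : ℝ → E} {v' w' : E} (hv : HasDerivAt v v' 0)
    (hw : HasDerivAt w w' 0) : HasDerivAt (fun t : ℝ => D.g (y + t • u) (v t) (w t))
    (D.g y (v' + D.Gam y u (v 0)) (w 0) + D.g y (v 0) (w' + D.Gam y u (w 0))) 0 := by
  have hg := hasDerivAt_line (D.hasFDerivAt_g hy) u
  refine ((hg.clm_apply hv).clm_apply hw).congr_deriv ?_
  simp [D.metric y hy]
  ring

/-- Expresses in coordinates that `G` is parallel; `hasDerivAt_cmul` does the same for complex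
multiplication. -/
theorem hasDerivAt_cform (u v w : E) : HasDerivAt (fun t : ℝ => D.cform (y + t • u) v w)
    (D.cform y (D.Gam y u v) w + D.cform y v (D.Gam y u w)) 0 := by
  have hv := D.hasDerivAt_phi hy u v
  have hw := D.hasDerivAt_phi hy u w
  have h1 := (D.hasDerivAt_g hy u hv hw).ofReal_comp
  have h2 := (D.hasDerivAt_g hy u (hasDerivAt_const (0 : ℝ) v) hw).ofReal_comp
  refine (h1.neg.sub (h2.mul_const Complex.I)).congr_deriv ?_
  simp [cform]
  ring

theorem hasDerivAt_cmul (u v : E) {a : ℝ → ℂ} {a' : ℂ} (ha : HasDerivAt a a' 0) :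
    HasDerivAt (fun t : ℝ => D.cmul (y + t • u) (a t) v)
    (D.cmul y a' v + D.cmul y (a 0) (D.Gam y u v) - D.Gam y u (D.cmul y (a 0) v)) 0 := by
  have hre : HasDerivAt (fun t => (a t).re) a'.re 0 :=
    Complex.reCLM.hasFDerivAt.comp_hasDerivAt (0 : ℝ) ha
  have him : HasDerivAt (fun t => (a t).im) a'.im 0 :=
    Complex.imCLM.hasFDerivAt.comp_hasDerivAt (0 : ℝ) ha
  refine ((hre.smul (D.hasDerivAt_phi_phi hy u v)).neg.add
    (him.smul (D.hasDerivAt_phi hy u v))).congr_deriv ?_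
  simp [cmul]
  module

/-- If the curvature tensor has constant holomorphic sectional curvature `c` at each point, then
`c` is a holomorphic function. -/
theorem holomorphic_of_eq_model [FiniteDimensional ℝ E] (hE : 4 ≤ Module.finrank ℝ E) {c : E → ℂ}
    (hc : DifferentiableAt ℝ c y)
    (hR : ∀ z (hz : z ∈ U), ∀ u v w, chartCurvature D.Gam z u v w = (D.form hz).model (c z) u v w)
    (v : E) : fderiv ℝ c y (D.phi y v) = Complex.I * fderiv ℝ c y v := by
  refine (D.form hy).holomorphic_of_model hE (fderiv ℝ c y).toLinearMap ?_ v
  intro u v w z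
  have hδ : ∀ u v w, HasDerivAt (fun t : ℝ => chartCurvature D.Gam (y + t • u) v w z)
      ((D.cmul y (fderiv ℝ c y u * D.cform y w z +
          c y * (D.cform y (D.Gam y u w) z + D.cform y w (D.Gam y u z))) v +
        D.cmul y (c y * D.cform y w z) (D.Gam y u v) -
        D.Gam y u (D.cmul y (c y * D.cform y w z) v)) -
       (D.cmul y (fderiv ℝ c y u * D.cform y v z +
          c y * (D.cform y (D.Gam y u v) z + D.cform y v (D.Gam y u z))) w +
        D.cmul y (c y * D.cform y v z) (D.Gam y u w) -
        D.Gam y u (D.cmul y (c y * D.cform y v z) w))) 0 := by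
    intro u v w
    have hcu := hasDerivAt_line hc.hasFDerivAt u
    have h1 : ∀ v w : E, HasDerivAt (fun t : ℝ => D.cmul (y + t • u)
        (c (y + t • u) * D.cform (y + t • u) w z) v) _ 0 := fun v w =>
      D.hasDerivAt_cmul hy u v (hcu.mul (D.hasDerivAt_cform hy u w z))
    refine (((h1 v w).sub (h1 w v)).congr_of_eventuallyEq
      ((eventually_line u (D.mem_nhds hy)).mono fun t ht => ?_)).congr_deriv ?_
    · rw [hR _ ht]
      simp only [ContactBForm.model, D.form_G, D.form_J]
      rfl
    · simp
  have hb := D.second_bianchi hy hδ u v w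
  -- Because the form and the multiplication are parallel, all Christoffel terms cancel in the
  -- cyclic sum and only the terms with $dc$ survive.
  simp only [hR y hy, ContactBForm.model, ← D.form_G hy, ← D.form_J hy] at hb
  rw [D.Gam_symm y hy w u, D.Gam_symm y hy w v, D.Gam_symm y hy v u] at hb
  simp only [mul_add, ContactBForm.J_add, map_sub] at hb
  simp only [ContactBForm.model]
  rw [← hb]
  simp only [ContinuousLinearMap.coe_coe]
  abel

theorem contDiffAt_cform {u v : E → E} (hu : ContDiffAt ℝ ∞ u y) (hv : ContDiffAt ℝ ∞ v y) :
    ContDiffAt ℝ ∞ (fun z => D.cform z (u z) (v z)) y := by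
  have hg := D.smooth_g.contDiffAt (D.mem_nhds hy)
  have hp := D.smooth_phi.contDiffAt (D.mem_nhds hy)
  have h1 : ContDiffAt ℝ ∞ (fun z => D.g z (D.phi z (u z)) (D.phi z (v z))) y :=
    (hg.clm_apply (hp.clm_apply hu)).clm_apply (hp.clm_apply hv)
  have h2 : ContDiffAt ℝ ∞ (fun z => D.g z (u z) (D.phi z (v z))) y :=
    (hg.clm_apply hu).clm_apply (hp.clm_apply hv)
  exact (Complex.ofRealCLM.contDiff.contDiffAt.comp y h1).neg.sub
    ((Complex.ofRealCLM.contDiff.contDiffAt.comp y h2).mul contDiffAt_const)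

theorem contDiffAt_curvature (u v w : E) :
    ContDiffAt ℝ ∞ (fun z => chartCurvature D.Gam z u v w) y := by
  have hG := D.smooth_Gam.contDiffAt (D.mem_nhds hy)
  have hG' : ContDiffAt ℝ ∞ (fderiv ℝ D.Gam) y := hG.fderiv_right (m := ∞) le_rfl
  have hc : ∀ a : E, ContDiffAt ℝ ∞ (fun _ : E => a) y := fun a => contDiffAt_const
  have h1 : ∀ a b : E, ContDiffAt ℝ ∞ (fun z => fderiv ℝ D.Gam z a b w) y := fun a b =>
    ((hG'.clm_apply (hc a)).clm_apply (hc b)).clm_apply (hc w)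
  have h2 : ∀ a b : E, ContDiffAt ℝ ∞ (fun z => D.Gam z a (D.Gam z b w)) y := fun a b =>
    (hG.clm_apply (hc a)).clm_apply ((hG.clm_apply (hc b)).clm_apply (hc w))
  exact (((h1 u v).sub (h1 v u)).add (h2 u v)).sub (h2 v u)

/-- The curvature function is given only pointwise. Its smoothness comes from writing it as
$G(R(u,v)v,u)$ divided by the complex Gram determinant of two fixed vectors, which is nonzero near
$y$. -/
theorem contDiffAt_of_eq_model [FiniteDimensional ℝ E] (hE : 4 ≤ Module.finrank ℝ E) {c : E → ℂ}
    (hR : ∀ z (hz : z ∈ U), ∀ u v w,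
      chartCurvature D.Gam z u v w = (D.form hz).model (c z) u v w) :
    ContDiffAt ℝ ∞ c y := by
  obtain ⟨u, hu⟩ := (D.form hy).exists_G_self_ne_zero (by omega : 2 ≤ Module.finrank ℝ E)
  obtain ⟨v, huv, hv⟩ := (D.form hy).exists_G_orthogonal hE hu
  simp only [D.form_G] at hu huv hv
  have hc : ∀ a : E, ContDiffAt ℝ ∞ (fun _ : E => a) y := fun a => contDiffAt_const
  have hG : ∀ a b : E, ContDiffAt ℝ ∞ (fun z => D.cform z a b) y := fun a b =>
    D.contDiffAt_cform hy (hc a) (hc b)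
  have hden := ((hG u u).mul (hG v v)).sub ((hG u v).mul (hG u v))
  have hnum := D.contDiffAt_cform hy (D.contDiffAt_curvature hy u v v) (hc u)
  have hne : D.cform y u u * D.cform y v v - D.cform y u v * D.cform y u v ≠ 0 := by
    rw [huv, mul_zero, sub_zero]; exact mul_ne_zero hu hv
  refine (hnum.mul (hden.inv hne)).congr_of_eventuallyEq ?_
  filter_upwards [hden.continuousAt.eventually_ne hne, D.mem_nhds hy] with z hz hzU
  change c z = D.cform z (chartCurvature D.Gam z u v v) u *
    (D.cform z u u * D.cform z v v - D.cform z u v * D.cform z u v)⁻¹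
  rw [← div_eq_mul_inv, eq_div_iff hz, ← D.form_G hzU, ← D.form_G hzU, ← D.form_G hzU, ← D.form_G hzU,
    hR z hzU]
  simp only [ContactBForm.model, map_sub, LinearMap.sub_apply, ContactBForm.G_J_left]
  rw [(D.form hzU).G_symm v u]
  ring

omit hy in
theorem isHolomorphicOn_of_eq_model [FiniteDimensional ℝ E] (hE : 4 ≤ Module.finrank ℝ E)
    {c : E → ℂ} (hR : ∀ z (hz : z ∈ U), ∀ u v w,
      chartCurvature D.Gam z u v w = (D.form hz).model (c z) u v w) :
    IsHolomorphicOn D.phi c U where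
  isOpen := D.isOpen
  contDiffOn_field := D.smooth_phi.of_le (by exact_mod_cast le_top)
  contDiffOn z hz := ((D.contDiffAt_of_eq_model hz hE hR).of_le
    (WithTop.coe_le_coe.mpr le_top)).contDiffWithinAt
  eq_I_mul z hz v := D.holomorphic_of_eq_model hz hE
    ((D.contDiffAt_of_eq_model hz hE hR).differentiableAt (by simp)) hR v

theorem phi_xi : D.phi y (D.xi y) = 0 := (D.form hy).phi_xi

end F0Data

end

/-! ### Vector fields and Lie brackets in a chart. -/

section


open Filter Set VectorField

section Chart

variable {E : Type*} [NormedAddCommGroup E] [NormedSpace ℝ E] [FiniteDimensional ℝ E]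
  {M : Type*} [TopologicalSpace M] [ChartedSpace E M] [IsManifold 𝓘(ℝ, E) ∞ M]

/-- The derivative of a chart. -/
def tauto (e : OpenPartialHomeomorph M E) (p : M) : TangentSpace 𝓘(ℝ, E) p →L[ℝ] E :=
  mfderiv 𝓘(ℝ, E) 𝓘(ℝ, E) e p

/-- The derivative of the inverse of a chart. -/
def cotauto (e : OpenPartialHomeomorph M E) (p : M) : E →L[ℝ] TangentSpace 𝓘(ℝ, E) p := by
  exact (tauto e p).inverse

/-- The expression of a vector field in a chart. -/
def rep (e : OpenPartialHomeomorph M E) (X : (p : M) → TangentSpace 𝓘(ℝ, E) p) (y : E) : E :=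
  tauto e (e.symm y) (X (e.symm y))

/-- The vector field with a given expression in a chart. -/
def field (e : OpenPartialHomeomorph M E) (W : E → E) (p : M) : TangentSpace 𝓘(ℝ, E) p :=
  cotauto e p (W (e p))

omit [FiniteDimensional ℝ E] in
theorem mdifferentiableAt_vectorSpace_iff {V : E → E} {y : E} :
    MDifferentiableAt 𝓘(ℝ, E) (𝓘(ℝ, E).prod 𝓘(ℝ, E))
      (fun z => (⟨z, V z⟩ : TangentBundle 𝓘(ℝ, E) E)) y ↔ DifferentiableAt ℝ V y := by
  refine ⟨fun h => ?_, fun h => ?_⟩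
  · have h1 := ((contMDiff_snd_tangentBundle_modelSpace (n := 1) E 𝓘(ℝ, E)).contMDiffAt
      (x := (⟨y, V y⟩ : TangentBundle 𝓘(ℝ, E) E))).mdifferentiableAt (by simp)
    exact (h1.comp y h).differentiableAt
  · rw [mdifferentiableAt_totalSpace]
    refine ⟨mdifferentiableAt_id, ?_⟩
    convert! h.mdifferentiableAt with z
    simp

omit [FiniteDimensional ℝ E] in
theorem mlieBracket_vectorSpace (V W : (y : E) → TangentSpace 𝓘(ℝ, E) y) (y : E) :
    mlieBracket 𝓘(ℝ, E) V W y = lieBracket ℝ V W y := by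
  rw [← mlieBracketWithin_univ, mlieBracketWithin_eq_lieBracketWithin]
  exact congrFun lieBracketWithin_univ y

variable {e : OpenPartialHomeomorph M E} (he : e ∈ IsManifold.maximalAtlas 𝓘(ℝ, E) ∞ M)

include he

theorem contMDiffAt_chart {p : M} (hp : p ∈ e.source) :
    ContMDiffAt 𝓘(ℝ, E) 𝓘(ℝ, E) ∞ e p := contMDiffAt_of_mem_maximalAtlas he hp

theorem contMDiffAt_chart_symm {y : E} (hy : y ∈ e.target) :
    ContMDiffAt 𝓘(ℝ, E) 𝓘(ℝ, E) ∞ e.symm y := contMDiffAt_symm_of_mem_maximalAtlas he hy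

theorem mdifferentiable_chart : e.MDifferentiable 𝓘(ℝ, E) 𝓘(ℝ, E) :=
  ⟨fun _ hp => ((contMDiffAt_chart he hp).mdifferentiableAt (by simp)).mdifferentiableWithinAt,
   fun _ hp => ((contMDiffAt_chart_symm he hp).mdifferentiableAt (by simp)).mdifferentiableWithinAt⟩

theorem isInvertible_tauto {p : M} (hp : p ∈ e.source) : (tauto e p).IsInvertible :=
  ⟨(mdifferentiable_chart he).mfderiv hp, rfl⟩

@[simp] theorem cotauto_tauto {p : M} (hp : p ∈ e.source) (v : TangentSpace 𝓘(ℝ, E) p) :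
    cotauto e p (tauto e p v) = v := by
  simpa using! congr($((isInvertible_tauto he hp).inverse_comp_self) v)

@[simp] theorem tauto_cotauto {p : M} (hp : p ∈ e.source) (v : E) :
    tauto e p (cotauto e p v) = v := by
  simpa using! congr($((isInvertible_tauto he hp).self_comp_inverse) v)

theorem mfderiv_symm_eq {y : E} (hy : y ∈ e.target) :
    mfderiv 𝓘(ℝ, E) 𝓘(ℝ, E) e.symm y = cotauto e (e.symm y) := by
  have hp := e.map_target hy
  ext v
  have h1 := congr($((mdifferentiable_chart he).comp_symm_deriv hy) v)
  have h2 : tauto e (e.symm y) (mfderiv 𝓘(ℝ, E) 𝓘(ℝ, E) e.symm y v) = v := h1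
  have h3 := cotauto_tauto he hp (mfderiv 𝓘(ℝ, E) 𝓘(ℝ, E) e.symm y v)
  exact h3.symm.trans (congrArg (cotauto e (e.symm y)) h2)

theorem isInvertible_mfderiv_symm {y : E} (hy : y ∈ e.target) :
    (mfderiv 𝓘(ℝ, E) 𝓘(ℝ, E) e.symm y).IsInvertible := by
  rw [mfderiv_symm_eq he hy]
  exact (isInvertible_tauto he (e.map_target hy)).inverse

/-- Coordinate expressions are pullbacks under the inverse chart, so regularity and naturality of
the bracket can be taken from the general theory of pullbacks. -/
theorem rep_eq_mpullback {y : E} (hy : y ∈ e.target) (X : (p : M) → TangentSpace 𝓘(ℝ, E) p) :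
    rep e X y = mpullback 𝓘(ℝ, E) 𝓘(ℝ, E) e.symm X y := by
  have h1 : (tauto e (e.symm y)).inverse.inverse = tauto e (e.symm y) :=
    (isInvertible_tauto he (e.map_target hy)).inverse_inverse
  rw [mpullback_apply, mfderiv_symm_eq he hy]
  exact congr($h1.symm (X (e.symm y)))

theorem rep_eventuallyEq {y : E} (hy : y ∈ e.target) (X : (p : M) → TangentSpace 𝓘(ℝ, E) p) :
    rep e X =ᶠ[𝓝 y] mpullback 𝓘(ℝ, E) 𝓘(ℝ, E) e.symm X := by
  filter_upwards [e.open_target.mem_nhds hy] with z hz using rep_eq_mpullback he hz X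

theorem rep_field {y : E} (hy : y ∈ e.target) (W : E → E) : rep e (field e W) y = W y := by
  rw [rep, field, tauto_cotauto he (e.map_target hy), e.right_inv hy]

theorem field_rep {p : M} (hp : p ∈ e.source) (X : (p : M) → TangentSpace 𝓘(ℝ, E) p) :
    field e (rep e X) p = X p := by
  rw [field, rep, e.left_inv hp, cotauto_tauto he hp]

theorem contMDiffAt_field {p : M} (hp : p ∈ e.source) {W : E → E} (hW : ContDiffAt ℝ ∞ W (e p)) :
    ContMDiffAt 𝓘(ℝ, E) (𝓘(ℝ, E).prod 𝓘(ℝ, E)) ∞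
      (fun q => (⟨q, field e W q⟩ : TangentBundle 𝓘(ℝ, E) M)) p := by
  have : IsManifold 𝓘(ℝ, E) 1 M := IsManifold.of_le (n := ∞) (by simp)
  have h1 := contMDiffAt_vectorSpace_iff_contDiffAt.2 hW
  exact h1.mpullback_vectorField_preimage (contMDiffAt_chart he hp) (isInvertible_tauto he hp)
    (by simp)

theorem mdifferentiableAt_field {p : M} (hp : p ∈ e.source) {W : E → E}
    (hW : DifferentiableAt ℝ W (e p)) :
    MDifferentiableAt 𝓘(ℝ, E) (𝓘(ℝ, E).prod 𝓘(ℝ, E))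
      (fun q => (⟨q, field e W q⟩ : TangentBundle 𝓘(ℝ, E) M)) p := by
  have : IsManifold 𝓘(ℝ, E) 1 M := IsManifold.of_le (n := ∞) (by simp)
  have h1 := mdifferentiableAt_vectorSpace_iff.2 hW
  exact h1.mpullback_vectorField (contMDiffAt_chart he hp) (isInvertible_tauto he hp)
    (WithTop.coe_le_coe.mpr le_top)

theorem contDiffAt_rep {y : E} (hy : y ∈ e.target) {X : (p : M) → TangentSpace 𝓘(ℝ, E) p}
    (hX : ContMDiffAt 𝓘(ℝ, E) (𝓘(ℝ, E).prod 𝓘(ℝ, E)) ∞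
      (fun q => (⟨q, X q⟩ : TangentBundle 𝓘(ℝ, E) M)) (e.symm y)) : ContDiffAt ℝ ∞ (rep e X) y := by
  have : IsManifold 𝓘(ℝ, E) 1 M := IsManifold.of_le (n := ∞) (by simp)
  refine ContDiffAt.congr_of_eventuallyEq ?_ (rep_eventuallyEq he hy X)
  exact contMDiffAt_vectorSpace_iff_contDiffAt.1 (hX.mpullback_vectorField_preimage
    (contMDiffAt_chart_symm he hy) (isInvertible_mfderiv_symm he hy) (by simp))

theorem differentiableAt_rep {y : E} (hy : y ∈ e.target) {X : (p : M) → TangentSpace 𝓘(ℝ, E) p}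
    (hX : MDifferentiableAt 𝓘(ℝ, E) (𝓘(ℝ, E).prod 𝓘(ℝ, E))
      (fun q => (⟨q, X q⟩ : TangentBundle 𝓘(ℝ, E) M)) (e.symm y)) :
    DifferentiableAt ℝ (rep e X) y := by
  have : IsManifold 𝓘(ℝ, E) 1 M := IsManifold.of_le (n := ∞) (by simp)
  refine DifferentiableAt.congr_of_eventuallyEq ?_ (rep_eventuallyEq he hy X)
  exact mdifferentiableAt_vectorSpace_iff.1 (hX.mpullback_vectorField
    (contMDiffAt_chart_symm he hy) (isInvertible_mfderiv_symm he hy)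
    (WithTop.coe_le_coe.mpr le_top))

theorem rep_mlieBracket {y : E} (hy : y ∈ e.target) {X Y : (p : M) → TangentSpace 𝓘(ℝ, E) p}
    (hX : MDifferentiableAt 𝓘(ℝ, E) (𝓘(ℝ, E).prod 𝓘(ℝ, E))
      (fun q => (⟨q, X q⟩ : TangentBundle 𝓘(ℝ, E) M)) (e.symm y))
    (hY : MDifferentiableAt 𝓘(ℝ, E) (𝓘(ℝ, E).prod 𝓘(ℝ, E))
      (fun q => (⟨q, Y q⟩ : TangentBundle 𝓘(ℝ, E) M)) (e.symm y)) :
    rep e (mlieBracket 𝓘(ℝ, E) X Y) y =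
      fderiv ℝ (rep e Y) y (rep e X y) - fderiv ℝ (rep e X) y (rep e Y y) := by
  have : IsManifold 𝓘(ℝ, E) (minSmoothness ℝ 3) M :=
    IsManifold.of_le (n := ∞) (by
      rw [minSmoothness_of_isRCLikeNormedField]; exact WithTop.coe_le_coe.mpr le_top)
  have h1 := mpullback_mlieBracket hX hY (contMDiffAt_chart_symm he hy) (n := ∞) (by
    rw [minSmoothness_of_isRCLikeNormedField]; exact WithTop.coe_le_coe.mpr le_top)
  have h2 := (rep_eventuallyEq he hy X).mlieBracket_vectorField_eq (I := 𝓘(ℝ, E))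
    (rep_eventuallyEq he hy Y)
  exact (rep_eq_mpullback he hy _).trans (h1.trans (h2.symm.trans (mlieBracket_vectorSpace _ _ _)))

end Chart

end

/-! ### Christoffel symbols as the difference from the flat connection of a chart. -/

section


open Filter Set VectorField

section ChartConnection

variable {E : Type*} [NormedAddCommGroup E] [NormedSpace ℝ E] [FiniteDimensional ℝ E]
  {M : Type*} [TopologicalSpace M] [ChartedSpace E M] [IsManifold 𝓘(ℝ, E) ∞ M]
  {e : OpenPartialHomeomorph M E} (he : e ∈ IsManifold.maximalAtlas 𝓘(ℝ, E) ∞ M)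

/-- The flat connection of a chart. -/
def flatConnection (e : OpenPartialHomeomorph M E) (X : (p : M) → TangentSpace 𝓘(ℝ, E) p) (p : M) :
    TangentSpace 𝓘(ℝ, E) p →L[ℝ] TangentSpace 𝓘(ℝ, E) p :=
  (cotauto e p).comp ((fderiv ℝ (rep e X) (e p)).comp (tauto e p))

theorem rep_add (X Y : (p : M) → TangentSpace 𝓘(ℝ, E) p) : rep e (X + Y) = rep e X + rep e Y := by
  ext y
  simp [rep]

theorem rep_smul (f : M → ℝ) (X : (p : M) → TangentSpace 𝓘(ℝ, E) p) :
    rep e (f • X) = fun y => f (e.symm y) • rep e X y := by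
  ext y
  simp [rep]

include he

theorem differentiableAt_comp_chart_symm {p : M} (hp : p ∈ e.source) {f : M → ℝ}
    (hf : MDifferentiableAt 𝓘(ℝ, E) 𝓘(ℝ) f p) : DifferentiableAt ℝ (fun y => f (e.symm y)) (e p) := by
  have h1 : MDifferentiableAt 𝓘(ℝ, E) 𝓘(ℝ) f (e.symm (e p)) := by rwa [e.left_inv hp]
  exact (h1.comp (e p) ((contMDiffAt_chart_symm he (e.map_source hp)).mdifferentiableAt
    (by simp))).differentiableAt

theorem fderiv_comp_chart_symm {p : M} (hp : p ∈ e.source) {f : M → ℝ}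
    (hf : MDifferentiableAt 𝓘(ℝ, E) 𝓘(ℝ) f p) (v : TangentSpace 𝓘(ℝ, E) p) :
    fderiv ℝ (fun y => f (e.symm y)) (e p) (tauto e p v) = mvfderiv 𝓘(ℝ, E) f p v := by
  have h1 := (differentiableAt_comp_chart_symm he hp hf).hasFDerivAt.hasMFDerivAt
  have h2 := h1.comp p ((contMDiffAt_chart he hp).mdifferentiableAt (by simp)).hasMFDerivAt
  have h3 := h2.congr_of_eventuallyEq (f₁ := f) (by
    filter_upwards [e.open_source.mem_nhds hp] with q hq
    simp [e.left_inv hq])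
  rw [mvfderiv, h3.mfderiv]
  rfl

theorem isCovariantDerivativeOn_flatConnection :
    IsCovariantDerivativeOn E (flatConnection e) e.source where
  add {X Y p} hX hY hp := by
    have hX' := differentiableAt_rep he (e.map_source hp) (X := X) (by rwa [e.left_inv hp])
    have hY' := differentiableAt_rep he (e.map_source hp) (X := Y) (by rwa [e.left_inv hp])
    ext v
    simp only [flatConnection, rep_add, fderiv_add hX' hY']
    simp
  leibniz {X f p} hX hf hp := by
    have hX' := differentiableAt_rep he (e.map_source hp) (X := X) (by rwa [e.left_inv hp])
    have hf' := differentiableAt_comp_chart_symm he hp hf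
    ext v
    have h1 := fderiv_comp_chart_symm he hp hf v
    simp only [flatConnection, rep_smul, fderiv_fun_smul hf' hX', ContinuousLinearMap.comp_apply,
      add_apply, smul_apply, ContinuousLinearMap.smulRight_apply, map_add, map_smul, h1,
      e.left_inv hp]
    have h2 : cotauto e p (rep e X (e p)) = X p := field_rep he hp X
    rw [h2]

/-- The Christoffel symbols of a connection in a chart. -/
def christoffel (nabla : CovariantDerivative 𝓘(ℝ, E) E (TangentSpace 𝓘(ℝ, E) : M → Type _))
    (y : E) : E →L[ℝ] E →L[ℝ] E := by
  have : IsManifold 𝓘(ℝ, E) 1 M := IsManifold.of_le (n := ∞) (by simp)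
  exact LinearMap.toContinuousLinearMap (LinearMap.toContinuousLinearMap.toLinearMap ∘ₗ
    LinearMap.mk₂ ℝ (fun u w => tauto e (e.symm y)
      ((nabla.isCovariantDerivativeOn (s := e.source)).difference (isCovariantDerivativeOn_flatConnection he)
        (e.symm y) (cotauto e (e.symm y) w) (cotauto e (e.symm y) u)))
      (by simp) (by simp) (by simp) (by simp))

/-- The difference of two covariant derivatives is tensorial, so the deviation from the coordinate
derivative depends only on the value of the field at the point. -/
theorem tauto_nabla (nabla : CovariantDerivative 𝓘(ℝ, E) E (TangentSpace 𝓘(ℝ, E) : M → Type _))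
    {X : (p : M) → TangentSpace 𝓘(ℝ, E) p} {p : M} (hp : p ∈ e.source)
    (hX : MDiffAt (T% X) p) (v : TangentSpace 𝓘(ℝ, E) p) :
    tauto e p (nabla X p v) = fderiv ℝ (rep e X) (e p) (tauto e p v) +
      christoffel he nabla (e p) (tauto e p v) (rep e X (e p)) := by
  obtain ⟨y, hy, rfl⟩ : ∃ y ∈ e.target, e.symm y = p := ⟨e p, e.map_source hp, e.left_inv hp⟩
  have : IsManifold 𝓘(ℝ, E) 1 M := IsManifold.of_le (n := ∞) (by simp)
  have h1 := (nabla.isCovariantDerivativeOn (s := e.source)).difference_apply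
    (isCovariantDerivativeOn_flatConnection he) hp hX
  have h2 : christoffel he nabla y (tauto e (e.symm y) v) (rep e X y) = tauto e (e.symm y)
      ((nabla.isCovariantDerivativeOn (s := e.source)).difference
        (isCovariantDerivativeOn_flatConnection he)
        (e.symm y) (cotauto e (e.symm y) (rep e X y))
          (cotauto e (e.symm y) (tauto e (e.symm y) v))) := rfl
  have h3 : cotauto e (e.symm y) (rep e X y) = X (e.symm y) := cotauto_tauto he hp _
  rw [cotauto_tauto he hp, h3, h1] at h2
  rw [e.right_inv hy, h2]
  simp only [sub_apply, map_sub, flatConnection, ContinuousLinearMap.comp_apply]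
  rw [tauto_cotauto he hp, e.right_inv hy]
  abel

end ChartConnection

end

/-! ### Torsion, curvature and the Koszul formula in a chart. -/

section


open Filter Set VectorField

section ChartCurvature

variable {E : Type*} [NormedAddCommGroup E] [NormedSpace ℝ E] [FiniteDimensional ℝ E]
  {M : Type*} [TopologicalSpace M] [ChartedSpace E M] [IsManifold 𝓘(ℝ, E) ∞ M]
  {e : OpenPartialHomeomorph M E} (he : e ∈ IsManifold.maximalAtlas 𝓘(ℝ, E) ∞ M)
  (nabla : CovariantDerivative 𝓘(ℝ, E) E (TangentSpace 𝓘(ℝ, E) : M → Type _))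

include he

theorem rep_field_eventuallyEq {y : E} (hy : y ∈ e.target) (W : E → E) :
    rep e (field e W) =ᶠ[𝓝 y] W := by
  filter_upwards [e.open_target.mem_nhds hy] with z hz using rep_field he hz W

theorem fderiv_rep_field {y : E} (hy : y ∈ e.target) (W : E → E) :
    fderiv ℝ (rep e (field e W)) y = fderiv ℝ W y :=
  (rep_field_eventuallyEq he hy W).fderiv_eq

theorem rep_nabla {y : E} (hy : y ∈ e.target) {X Z : (p : M) → TangentSpace 𝓘(ℝ, E) p}
    (hZ : MDiffAt (T% Z) (e.symm y)) :
    rep e (fun q => nabla Z q (X q)) y = fderiv ℝ (rep e Z) y (rep e X y) +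
      christoffel he nabla y (rep e X y) (rep e Z y) := by
  have h1 := tauto_nabla he nabla (e.map_target hy) hZ (X (e.symm y))
  rwa [e.right_inv hy] at h1

theorem tauto_nabla_field {p : M} (hp : p ∈ e.source) {W : E → E}
    (hW : DifferentiableAt ℝ W (e p)) (v : TangentSpace 𝓘(ℝ, E) p) :
    tauto e p (nabla (field e W) p v) = fderiv ℝ W (e p) (tauto e p v) +
      christoffel he nabla (e p) (tauto e p v) (W (e p)) := by
  rw [tauto_nabla he nabla hp (mdifferentiableAt_field he hp hW),
    fderiv_rep_field he (e.map_source hp), rep_field he (e.map_source hp)]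

/-- Coordinate-constant fields have vanishing bracket, so absence of torsion is symmetry of the
Christoffel symbols. -/
theorem christoffel_symm (h : nabla.torsion = 0) {y : E} (hy : y ∈ e.target) (u v : E) :
    christoffel he nabla y u v = christoffel he nabla y v u := by
  have : IsManifold 𝓘(ℝ, E) 1 M := IsManifold.of_le (n := ∞) (by simp)
  have hp := e.map_target hy
  have hd : ∀ w : E, MDiffAt (T% (field e (fun _ : E => w))) (e.symm y) := fun w =>
    mdifferentiableAt_field he hp (differentiableAt_const w)
  have h1 := congrArg (tauto e (e.symm y))
    ((CovariantDerivative.torsion_eq_zero_iff nabla).1 h (hd u) (hd v))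
  have h2 := rep_mlieBracket he hy (hd u) (hd v)
  have h3 : ∀ u : E, tauto e (e.symm y) (field e (fun _ : E => u) (e.symm y)) = u :=
    fun u => rep_field he hy _
  simp only [fderiv_rep_field he hy, fderiv_fun_const, Pi.zero_apply, zero_apply, sub_zero] at h2
  rw [map_sub, tauto_nabla_field he nabla hp (differentiableAt_const v),
    tauto_nabla_field he nabla hp (differentiableAt_const u), e.right_inv hy, h3, h3] at h1
  simp only [fderiv_fun_const, Pi.zero_apply, zero_apply, zero_add] at h1
  exact sub_eq_zero.1 (h1.trans h2)

/-- The curvature tensor of a connection in a chart. -/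
theorem tauto_curvature {p : M} (hp : p ∈ e.source)
    (hΓ : DifferentiableAt ℝ (christoffel he nabla) (e p))
    {X Y Z : (p : M) → TangentSpace 𝓘(ℝ, E) p}
    (hX : SmoothField X) (hY : SmoothField Y) (hZ : SmoothField Z) :
    tauto e p (curvature nabla X Y Z p) = chartCurvature (christoffel he nabla) (e p)
      (tauto e p (X p)) (tauto e p (Y p)) (tauto e p (Z p)) := by
  obtain ⟨y, hy, rfl⟩ : ∃ y ∈ e.target, e.symm y = p := ⟨e p, e.map_source hp, e.left_inv hp⟩
  rw [e.right_inv hy] at hΓ ⊢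
  have hm : ∀ {X : (p : M) → TangentSpace 𝓘(ℝ, E) p}, SmoothField X → ∀ p, MDiffAt (T% X) p :=
    fun h p => h.contMDiffAt.mdifferentiableAt (by simp)
  have hd : ∀ {X : (p : M) → TangentSpace 𝓘(ℝ, E) p}, SmoothField X →
    ContDiffAt ℝ ∞ (rep e X) y := fun h => contDiffAt_rep he hy h.contMDiffAt
  have hd1 : ∀ {X : (p : M) → TangentSpace 𝓘(ℝ, E) p}, SmoothField X →
    HasFDerivAt (rep e X) (fderiv ℝ (rep e X) y) y := fun h =>
      ((hd h).differentiableAt (by simp)).hasFDerivAt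
  have key : ∀ {Y X : (p : M) → TangentSpace 𝓘(ℝ, E) p}, SmoothField Y → SmoothField X →
      tauto e (e.symm y) (nabla (fun q => nabla Z q (Y q)) (e.symm y) (X (e.symm y))) =
      fderiv ℝ (fderiv ℝ (rep e Z)) y (rep e X y) (rep e Y y) +
      fderiv ℝ (rep e Z) y (fderiv ℝ (rep e Y) y (rep e X y)) +
      (fderiv ℝ (christoffel he nabla) y (rep e X y) (rep e Y y) (rep e Z y) +
      christoffel he nabla y (fderiv ℝ (rep e Y) y (rep e X y)) (rep e Z y) +
      christoffel he nabla y (rep e Y y) (fderiv ℝ (rep e Z) y (rep e X y))) +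
      christoffel he nabla y (rep e X y) (fderiv ℝ (rep e Z) y (rep e Y y) +
        christoffel he nabla y (rep e Y y) (rep e Z y)) := by
    intro Y X hY hX
    set A : E → E := fun z => fderiv ℝ (rep e Z) z (rep e Y z) +
      christoffel he nabla z (rep e Y z) (rep e Z z) with hA
    have hAd : HasFDerivAt A _ y :=
      ((((hd hZ).fderiv_right (m := ∞) le_rfl).differentiableAt (by simp)).hasFDerivAt.clm_apply
        (hd1 hY)).add ((hΓ.hasFDerivAt.clm_apply (hd1 hY)).clm_apply (hd1 hZ))
    have h1 : rep e (fun q => nabla Z q (Y q)) =ᶠ[𝓝 y] A := by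
      filter_upwards [e.open_target.mem_nhds hy] with z hz using rep_nabla he nabla hz (hm hZ _)
    -- Differentiability of $\nabla_YZ$ is read off its coordinate expression `A`, using that of the
    -- Christoffel symbols.
    have h2 : MDiffAt (T% (fun q => nabla Z q (Y q))) (e.symm y) := by
      refine (mdifferentiableAt_field he hp (W := A)
        (by rw [e.right_inv hy]; exact hAd.differentiableAt)).congr_of_eventuallyEq ?_
      filter_upwards [e.open_source.mem_nhds hp] with q hq
      rw [← field_rep he hq (fun q => nabla Z q (Y q))]
      simp only [field, rep_nabla he nabla (e.map_source hq) (hm hZ _), hA]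
    rw [tauto_nabla he nabla hp h2, e.right_inv hy, h1.fderiv_eq, hAd.fderiv, h1.eq_of_nhds]
    simp only [add_apply, ContinuousLinearMap.comp_apply, ContinuousLinearMap.flip_apply, hA, rep]
    abel
  have hsymm := ((hd hZ).isSymmSndFDerivAt
    (by rw [minSmoothness_of_isRCLikeNormedField]; exact WithTop.coe_le_coe.mpr le_top)).eq (rep e X y) (rep e Y y)
  have hb := rep_mlieBracket he hy (hm hX _) (hm hY _)
  rw [curvature, map_sub, map_sub, key hY hX, key hX hY, tauto_nabla he nabla hp (hm hZ _),
    e.right_inv hy]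
  have hb' : tauto e (e.symm y) (mlieBracket 𝓘(ℝ, E) X Y (e.symm y)) =
    fderiv ℝ (rep e Y) y (rep e X y) - fderiv ℝ (rep e X) y (rep e Y y) := hb
  rw [hb', hsymm]
  simp only [chartCurvature, map_sub, map_add, sub_apply]
  simp only [rep]
  abel

end ChartCurvature

section Koszul

variable {E : Type*} [NormedAddCommGroup E] [NormedSpace ℝ E]

/-- The Koszul formula in a chart. -/
theorem koszul {Γ : E →L[ℝ] E →L[ℝ] E} {h : E →L[ℝ] E →L[ℝ] ℝ} {dh : E → E → E → ℝ}
    (hh : ∀ u v, h u v = h v u)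
    (hΓ : ∀ u v, Γ u v = Γ v u) (hm : ∀ u v w, dh u v w = h (Γ u v) w + h v (Γ u w))
    (u v w : E) : h (Γ u v) w = (dh u v w + dh v u w - dh w u v) / 2 := by
  have h1 := hm u v w
  have h2 := hm v u w
  have h3 := hm w u v
  rw [hΓ v u] at h2
  rw [hΓ w u, hΓ w v, hh] at h3
  rw [hh v] at h1
  rw [hh u] at h2
  have h4 := hh u (Γ v w)
  linarith [hh (Γ u w) v]

/-- The Koszul formula expresses $h(\Gamma_uv,w)$ through the derivative of the metric alone, and
nondegeneracy recovers $\Gamma_uv$. -/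
theorem christoffel_unique {Γ Γ' : E →L[ℝ] E →L[ℝ] E} {h : E →L[ℝ] E →L[ℝ] ℝ}
    {dh : E → E → E → ℝ} (hh : ∀ u v, h u v = h v u) (hn : ∀ u, (∀ v, h u v = 0) → u = 0)
    (hΓ : ∀ u v, Γ u v = Γ v u) (hm : ∀ u v w, dh u v w = h (Γ u v) w + h v (Γ u w))
    (hΓ' : ∀ u v, Γ' u v = Γ' v u) (hm' : ∀ u v w, dh u v w = h (Γ' u v) w + h v (Γ' u w)) :
    Γ = Γ' := by
  ext u v
  refine sub_eq_zero.1 (hn _ fun w => ?_)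
  rw [map_sub, sub_apply, koszul hh hΓ hm, koszul hh hΓ' hm', sub_self]

end Koszul

end

/-! ### Cut-off extension of fields and the structure tensors in a chart. -/

section


open Filter Set VectorField

section Extension

variable {E : Type*} [NormedAddCommGroup E] [NormedSpace ℝ E] [FiniteDimensional ℝ E]
  {M : Type*} [TopologicalSpace M] [T2Space M] [ChartedSpace E M] [IsManifold 𝓘(ℝ, E) ∞ M]
  {e : OpenPartialHomeomorph M E} (he : e ∈ IsManifold.maximalAtlas 𝓘(ℝ, E) ∞ M)

include he in
/-- A vector field given in a chart coincides near a point with a globally defined field. -/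
theorem exists_smoothField_eventually_eq {p : M} (hp : p ∈ e.source) {W : E → E}
    (hW : ContDiffOn ℝ ∞ W e.target) :
    ∃ X : (p : M) → TangentSpace 𝓘(ℝ, E) p, SmoothField X ∧ ∀ᶠ q in 𝓝 p, X q = field e W q := by
  obtain ⟨f, -, hf⟩ := (SmoothBumpFunction.nhds_basis_tsupport (I := 𝓘(ℝ, E)) p).mem_iff.1
    (e.open_source.mem_nhds hp)
  refine ⟨(f : M → ℝ) • field e W, ?_, ?_⟩
  · refine ContMDiffOn.smul_section_of_tsupport (u := e.source) f.contMDiff.contMDiffOn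
      e.open_source hf fun q hq => ?_
    exact (contMDiffAt_field he hq
      (hW.contDiffAt (e.open_target.mem_nhds (e.map_source hq)))).contMDiffWithinAt
  · filter_upwards [f.eventuallyEq_one] with q hq
    simp [hq]

theorem exists_smoothField_eq (p : M) (v : TangentSpace 𝓘(ℝ, E) p) :
    ∃ X : (p : M) → TangentSpace 𝓘(ℝ, E) p, SmoothField X ∧ X p = v := by
  have he := IsManifold.chart_mem_maximalAtlas (I := 𝓘(ℝ, E)) (n := ∞) p
  have hp := mem_chart_source E p
  obtain ⟨X, hX, h⟩ := exists_smoothField_eventually_eq he hp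
    (W := fun _ => tauto (chartAt E p) p v) contDiffOn_const
  refine ⟨X, hX, h.self_of_nhds.trans ?_⟩
  exact cotauto_tauto he hp v

end Extension

namespace AlmostContactBMetric

variable {E : Type*} [NormedAddCommGroup E] [NormedSpace ℝ E] [FiniteDimensional ℝ E]
  {M : Type*} [TopologicalSpace M] [ChartedSpace E M] [IsManifold 𝓘(ℝ, E) ∞ M]
  (A : AlmostContactBMetric E M)
  (e : OpenPartialHomeomorph M E)

/-- The tensor `φ` in a chart. -/
def chartPhi (y : E) : E →L[ℝ] E :=
  (tauto e (e.symm y)).comp ((A.phi (e.symm y)).comp (cotauto e (e.symm y)))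

/-- The form `η` in a chart. -/
def chartEta (y : E) : E →L[ℝ] ℝ := (A.eta (e.symm y)).comp (cotauto e (e.symm y))

/-- The metric in a chart. -/
def chartG (y : E) : E →L[ℝ] E →L[ℝ] ℝ :=
  LinearMap.toContinuousLinearMap (LinearMap.toContinuousLinearMap.toLinearMap ∘ₗ
    LinearMap.mk₂ ℝ (fun u w => A.g (e.symm y) (cotauto e (e.symm y) u) (cotauto e (e.symm y) w))
      (by simp) (by simp) (by simp) (by simp))

theorem chartPhi_apply (y u : E) : A.chartPhi e y u =
    tauto e (e.symm y) (A.phi (e.symm y) (cotauto e (e.symm y) u)) := rfl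

theorem chartEta_apply (y u : E) :
    A.chartEta e y u = A.eta (e.symm y) (cotauto e (e.symm y) u) := rfl

theorem chartG_apply (y u v : E) : A.chartG e y u v =
    A.g (e.symm y) (cotauto e (e.symm y) u) (cotauto e (e.symm y) v) := rfl

variable {e} (he : e ∈ IsManifold.maximalAtlas 𝓘(ℝ, E) ∞ M)

include he

theorem contMDiffAt_field_const {p : M} (hp : p ∈ e.source) (v : E) :
    ContMDiffAt 𝓘(ℝ, E) (𝓘(ℝ, E).prod 𝓘(ℝ, E)) ∞
      (fun q => (⟨q, field e (fun _ => v) q⟩ : TangentBundle 𝓘(ℝ, E) M)) p :=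
  contMDiffAt_field he hp contDiffAt_const

theorem contDiffOn_chartPhi : ContDiffOn ℝ ∞ (A.chartPhi e) e.target := by
  rw [contDiffOn_clm_apply]
  intro v y hy
  have hp := e.map_target hy
  have h1 := A.smooth_phi.contMDiffAt.clm_bundle_apply (contMDiffAt_field_const he hp v)
  refine ((contDiffAt_rep he hy h1).congr_of_eventuallyEq ?_).contDiffWithinAt
  filter_upwards [e.open_target.mem_nhds hy] with z hz
  simp only [rep, field, chartPhi_apply]

theorem contDiffOn_rep_xi : ContDiffOn ℝ ∞ (rep e A.xi) e.target := fun _ hy =>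
  (contDiffAt_rep he hy A.smooth_xi.contMDiffAt).contDiffWithinAt

theorem contDiffOn_chartG : ContDiffOn ℝ ∞ (A.chartG e) e.target := by
  rw [contDiffOn_clm_apply]
  intro u
  rw [contDiffOn_clm_apply]
  intro v y hy
  have hp := e.map_target hy
  have h1 : ContMDiffAt 𝓘(ℝ, E) (𝓘(ℝ, E).prod 𝓘(ℝ)) ∞
      (fun q => Bundle.TotalSpace.mk' ℝ (E := Bundle.Trivial M ℝ) q
        (A.g q (field e (fun _ => u) q) (field e (fun _ => v) q))) (e.symm y) := by
    apply ContMDiffAt.clm_bundle_apply₂ (F₁ := E) (F₂ := E)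
    · exact A.smooth_g.contMDiffAt
    · exact contMDiffAt_field_const he hp u
    · exact contMDiffAt_field_const he hp v
  rw [Bundle.contMDiffAt_totalSpace] at h1
  have h2 := (ContMDiffAt.comp y h1.2 (contMDiffAt_chart_symm he hy)).contDiffAt
  refine (h2.congr_of_eventuallyEq ?_).contDiffWithinAt
  filter_upwards [e.open_target.mem_nhds hy] with z hz
  simp [field, chartG_apply]

theorem chartPhi_sq {y : E} (hy : y ∈ e.target) (u : E) :
    A.chartPhi e y (A.chartPhi e y u) = -u + A.chartEta e y u • rep e A.xi y := by
  have hp := e.map_target hy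
  simp only [chartPhi_apply, chartEta_apply, rep, cotauto_tauto he hp, A.phi_sq, map_add, map_neg,
    map_smul, tauto_cotauto he hp]

theorem chartEta_xi {y : E} (hy : y ∈ e.target) : A.chartEta e y (rep e A.xi y) = 1 := by
  simp only [chartEta_apply, rep, cotauto_tauto he (e.map_target hy), A.eta_xi]

omit he in
theorem chartG_symm (y u v : E) : A.chartG e y u v = A.chartG e y v u := A.g_symm _ _ _

theorem chartG_nondegenerate {y : E} (hy : y ∈ e.target) (u : E)
    (h : ∀ v, A.chartG e y u v = 0) : u = 0 := by
  have hp := e.map_target hy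
  have h1 : cotauto e (e.symm y) u = 0 := A.g_nondegenerate _ _ fun v => by
    have h2 := h (tauto e (e.symm y) v)
    rwa [chartG_apply, cotauto_tauto he hp] at h2
  rw [← tauto_cotauto he hp u, h1, map_zero]

theorem chartG_phi {y : E} (hy : y ∈ e.target) (u v : E) :
    A.chartG e y (A.chartPhi e y u) (A.chartPhi e y v) =
      - A.chartG e y u v + A.chartEta e y u * A.chartEta e y v := by
  have hp := e.map_target hy
  simp only [chartPhi_apply, chartEta_apply, chartG_apply, cotauto_tauto he hp, A.g_phi]

/-- Compatibility with the metric in a chart. -/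
theorem fderiv_chart_metric {h : (p : M) → TangentSpace 𝓘(ℝ, E) p → TangentSpace 𝓘(ℝ, E) p → ℝ}
    {nabla : CovariantDerivative 𝓘(ℝ, E) E (TangentSpace 𝓘(ℝ, E) : M → Type _)}
    (hn : IsLeviCivita nabla h) {k : E → E →L[ℝ] E →L[ℝ] ℝ} (hk : ContDiffOn ℝ ∞ k e.target)
    (hkh : ∀ y ∈ e.target, ∀ u v, k y u v = h (e.symm y) (cotauto e (e.symm y) u)
      (cotauto e (e.symm y) v)) {y : E} (hy : y ∈ e.target) (u v w : E) :
    fderiv ℝ k y u v w =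
      k y (christoffel he nabla y u v) w + k y v (christoffel he nabla y u w) := by
  have hp := e.map_target hy
  have hd : ∀ w : E, MDiffAt (T% (field e (fun _ : E => w))) (e.symm y) := fun w =>
    mdifferentiableAt_field he hp (differentiableAt_const w)
  have h1 := hn.metric (field e fun _ => v) (field e fun _ => w) (e.symm y)
    (cotauto e (e.symm y) u) (hd v) (hd w)
  have hkd := ((hk.contDiffAt (e.open_target.mem_nhds hy)).differentiableAt (by simp)).hasFDerivAt
  have hkd' : HasFDerivAt (fun z => k z v w) _ y :=
    (hkd.clm_apply (hasFDerivAt_const v y)).clm_apply (hasFDerivAt_const w y)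
  have hf : (fun q => h q (field e (fun _ => v) q) (field e (fun _ => w) q)) =ᶠ[𝓝 (e.symm y)]
      (fun z => k z v w) ∘ e := by
    filter_upwards [e.open_source.mem_nhds hp] with q hq
    obtain ⟨z, hz, rfl⟩ : ∃ z ∈ e.target, e.symm z = q := ⟨e q, e.map_source hq, e.left_inv hq⟩
    simp only [Function.comp_apply, e.right_inv hz, hkh z hz, field]
  have hkd2 : HasFDerivAt (fun z => k z v w) (fderiv ℝ (fun z => k z v w) y) (e (e.symm y)) := by
    rw [e.right_inv hy]; exact hkd'.differentiableAt.hasFDerivAt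
  have h2 := (hkd2.hasMFDerivAt.comp _ ((contMDiffAt_chart he hp).mdifferentiableAt
    (by simp)).hasMFDerivAt).congr_of_eventuallyEq hf
  have h3 : mvfderiv 𝓘(ℝ, E) (fun q => h q (field e (fun _ => v) q) (field e (fun _ => w) q))
      (e.symm y) (cotauto e (e.symm y) u) =
      fderiv ℝ (fun z => k z v w) y (tauto e (e.symm y) (cotauto e (e.symm y) u)) := by
    rw [mvfderiv, h2.mfderiv]; rfl
  have hc : ∀ w, nabla (field e fun _ => w) (e.symm y) (cotauto e (e.symm y) u) =
      cotauto e (e.symm y) (christoffel he nabla y u w) := by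
    intro w
    rw [← cotauto_tauto he hp (nabla (field e fun _ => w) (e.symm y) (cotauto e (e.symm y) u)),
      tauto_nabla_field he nabla hp (differentiableAt_const w), tauto_cotauto he hp,
      e.right_inv hy]
    simp
  rw [h3, tauto_cotauto he hp, hkd'.fderiv, hc, hc] at h1
  simp only [add_apply, ContinuousLinearMap.comp_apply, ContinuousLinearMap.flip_apply,
    zero_apply, map_zero, zero_add] at h1
  rw [hkh y hy, hkh y hy, h1]
  simp only [field]

-- Eliminating $\eta\otimes\eta$ writes the associated metric through $g$ and $\varphi$ only, whose
-- smoothness and parallelism in a chart are at hand.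
omit [FiniteDimensional ℝ E] he in
theorem assocMetric_eq (p : M) (u v : TangentSpace 𝓘(ℝ, E) p) :
    A.assocMetric p u v = A.g p u (A.phi p v) + A.g p (A.phi p u) (A.phi p v) + A.g p u v := by
  rw [assocMetric, A.g_phi]; ring

end AlmostContactBMetric

end

/-! ### Smoothness of the connection, parallelism of φ, and equality of the two Levi-Civita
connections. -/

section


open Filter Set VectorField

theorem isInvertible_of_nondegenerate {E : Type*} [NormedAddCommGroup E] [NormedSpace ℝ E]
    [FiniteDimensional ℝ E] {h : E →L[ℝ] E →L[ℝ] ℝ} (hn : ∀ u, (∀ v, h u v = 0) → u = 0) :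
    h.IsInvertible := by
  have h1 : Function.Injective h.toLinearMap := by
    rw [← LinearMap.ker_eq_bot, LinearMap.ker_eq_bot']
    exact fun u hu => hn u fun v => congr($hu v)
  have h2 : Module.finrank ℝ E = Module.finrank ℝ (E →L[ℝ] ℝ) := by
    rw [← (LinearMap.toContinuousLinearMap (𝕜 := ℝ) (E := E) (F' := ℝ)).finrank_eq]
    exact (Subspace.dual_finrank_eq (K := ℝ) (V := E)).symm
  exact ⟨(LinearEquiv.ofInjectiveOfFinrankEq h.toLinearMap h1 h2).toContinuousLinearEquiv, by
    ext; rfl⟩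

namespace AlmostContactBMetric

variable {E : Type*} [NormedAddCommGroup E] [NormedSpace ℝ E] [FiniteDimensional ℝ E]
  {M : Type*} [TopologicalSpace M] [ChartedSpace E M] [IsManifold 𝓘(ℝ, E) ∞ M]
  (A : AlmostContactBMetric E M)
  {e : OpenPartialHomeomorph M E} (he : e ∈ IsManifold.maximalAtlas 𝓘(ℝ, E) ∞ M)
  {nabla : CovariantDerivative 𝓘(ℝ, E) E (TangentSpace 𝓘(ℝ, E) : M → Type _)}

theorem fderiv_chartG (hn : IsLeviCivita nabla A.metric) {y : E} (hy : y ∈ e.target) (u v w : E) :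
    fderiv ℝ (A.chartG e) y u v w = A.chartG e y (christoffel he nabla y u v) w +
      A.chartG e y v (christoffel he nabla y u w) :=
  fderiv_chart_metric he hn (A.contDiffOn_chartG he) (fun _ _ _ _ => rfl) hy u v w

/-- Smoothness of the connection is deduced from that of the metric: lowering an index gives the
smooth covector `κ` of the Koszul formula, and inversion of the metric is smooth. -/
theorem contDiffOn_christoffel (hn : IsLeviCivita nabla A.metric) :
    ContDiffOn ℝ ∞ (christoffel he nabla) e.target := by
  rw [contDiffOn_clm_apply]
  intro u
  rw [contDiffOn_clm_apply]
  intro v y hy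
  have hG := (A.contDiffOn_chartG he).contDiffAt (e.open_target.mem_nhds hy)
  have hG' : ContDiffAt ℝ ∞ (fderiv ℝ (A.chartG e)) y := hG.fderiv_right (m := ∞) le_rfl
  have hc : ∀ a : E, ContDiffAt ℝ ∞ (fun _ : E => a) y := fun a => contDiffAt_const
  let κ : E → E →L[ℝ] ℝ := fun z => (1 / 2 : ℝ) • (fderiv ℝ (A.chartG e) z u v +
    fderiv ℝ (A.chartG e) z v u - ((fderiv ℝ (A.chartG e) z).flip u).flip v)
  have hκ : ContDiffAt ℝ ∞ κ y := by
    have hf1 : ContDiff ℝ ∞ (fun f : E →L[ℝ] E →L[ℝ] E →L[ℝ] ℝ => f.flip) :=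
      (ContinuousLinearMap.flipₗᵢ ℝ E E (E →L[ℝ] ℝ)).contDiff
    have hf2 : ContDiff ℝ ∞ (fun f : E →L[ℝ] E →L[ℝ] ℝ => f.flip) :=
      (ContinuousLinearMap.flipₗᵢ ℝ E E ℝ).contDiff
    have h1 : ContDiffAt ℝ ∞ (fun z => (fderiv ℝ (A.chartG e) z).flip) y :=
      hf1.contDiffAt.comp y hG'
    have h2 : ContDiffAt ℝ ∞ (fun z => ((fderiv ℝ (A.chartG e) z).flip u).flip) y :=
      hf2.contDiffAt.comp y (h1.clm_apply (hc u))
    have h3 := h2.clm_apply (hc v)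
    have h4 := (((hG'.clm_apply (hc u)).clm_apply (hc v)).add
      ((hG'.clm_apply (hc v)).clm_apply (hc u))).sub h3
    exact h4.const_smul (1 / 2 : ℝ)
  have hinv : ∀ z ∈ e.target, (A.chartG e z).IsInvertible := fun z hz =>
    isInvertible_of_nondegenerate (A.chartG_nondegenerate he hz)
  have hi : ContDiffAt ℝ ∞ (fun z => (A.chartG e z).inverse) y := by
    obtain ⟨L, hL⟩ := hinv y hy
    have h3 := contDiffAt_map_inverse (n := ∞) L
    rw [hL] at h3
    exact h3.comp y hG
  refine ((hi.clm_apply hκ).congr_of_eventuallyEq ?_).contDiffWithinAt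
  filter_upwards [e.open_target.mem_nhds hy] with z hz
  have h4 : A.chartG e z (christoffel he nabla z u v) = κ z := by
    ext w
    rw [koszul (A.chartG_symm z) (christoffel_symm he nabla hn.torsion_free hz)
      (A.fderiv_chartG he hn hz)]
    simp only [κ, smul_apply, add_apply, sub_apply, ContinuousLinearMap.flip_apply, smul_eq_mul]
    ring
  rw [← h4, (hinv z hz).inverse_apply_self]

/-- The class condition concerns global smooth fields, so it is tested on a cut-off of a
coordinate-constant field, for which $\nabla(\varphi Y)=\varphi\nabla Y$ at the point is the
asserted formula. -/
theorem parallel_chartPhi [T2Space M] (hF0 : A.IsF0 nabla) {y : E} (hy : y ∈ e.target) (u v : E) :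
    fderiv ℝ (A.chartPhi e) y u v = A.chartPhi e y (christoffel he nabla y u v) -
      christoffel he nabla y u (A.chartPhi e y v) := by
  have hp := e.map_target hy
  obtain ⟨X, hX, hXp⟩ := exists_smoothField_eq (e.symm y) (cotauto e (e.symm y) u)
  obtain ⟨Y, hY, hYe⟩ := exists_smoothField_eventually_eq he hp (W := fun _ => v) contDiffOn_const
  have h1 : nabla (fun q => A.phi q (Y q)) (e.symm y) (X (e.symm y)) -
      A.phi (e.symm y) (nabla Y (e.symm y) (X (e.symm y))) = 0 := by
    refine A.g_nondegenerate _ _ fun w => ?_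
    obtain ⟨Z, hZ, rfl⟩ := exists_smoothField_eq (e.symm y) w
    exact hF0 X Y Z hX hY hZ (e.symm y)
  have hYd : MDiffAt (T% Y) (e.symm y) := hY.contMDiffAt.mdifferentiableAt (by simp)
  have hPd : MDiffAt (T% (fun q => A.phi q (Y q))) (e.symm y) :=
    (A.smooth_phi.contMDiffAt.clm_bundle_apply hY.contMDiffAt).mdifferentiableAt (by simp)
  have hr : rep e Y =ᶠ[𝓝 y] fun _ => v := by
    have h2 := (contMDiffAt_chart_symm he hy).continuousAt.eventually hYe
    filter_upwards [h2, e.open_target.mem_nhds hy] with z hz hzt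
    rw [rep, hz]
    exact rep_field he hzt _
  have hrp : rep e (fun q => A.phi q (Y q)) =ᶠ[𝓝 y] fun z => A.chartPhi e z v := by
    filter_upwards [hr, e.open_target.mem_nhds hy] with z hz hzt
    rw [← hz, chartPhi_apply, rep, rep, cotauto_tauto he (e.map_target hzt)]
  have hd := (((A.contDiffOn_chartPhi he).contDiffAt (e.open_target.mem_nhds hy)).differentiableAt
    (by simp)).hasFDerivAt.clm_apply (hasFDerivAt_const v y)
  have h3 := tauto_nabla he nabla hp hPd (X (e.symm y))
  have h4 := tauto_nabla he nabla hp hYd (X (e.symm y))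
  rw [e.right_inv hy, hXp, tauto_cotauto he hp, hrp.fderiv_eq, hd.fderiv, hrp.eq_of_nhds] at h3
  rw [e.right_inv hy, hXp, tauto_cotauto he hp, hr.fderiv_eq, hr.eq_of_nhds] at h4
  simp only [fderiv_fun_const, Pi.zero_apply, zero_apply, zero_add] at h4
  simp only [add_apply, ContinuousLinearMap.comp_apply, ContinuousLinearMap.flip_apply,
    zero_apply, map_zero, zero_add] at h3
  rw [hXp, sub_eq_zero] at h1
  rw [h1] at h3
  rw [← h4, chartPhi_apply, cotauto_tauto he hp, eq_sub_iff_add_eq, ← h3]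

/-- An `F₀`-manifold in a chart. -/
def chartData [T2Space M] (hn : IsLeviCivita nabla A.metric) (hF0 : A.IsF0 nabla) :
    F0Data E e.target where
  phi := A.chartPhi e
  xi := rep e A.xi
  eta := A.chartEta e
  g := A.chartG e
  Gam := christoffel he nabla
  isOpen := e.open_target
  smooth_phi := A.contDiffOn_chartPhi he
  smooth_g := A.contDiffOn_chartG he
  smooth_Gam := A.contDiffOn_christoffel he hn
  phi_sq _ hy := A.chartPhi_sq he hy
  eta_xi _ hy := A.chartEta_xi he hy
  g_symm y _ := A.chartG_symm y
  g_nondegenerate _ hy := A.chartG_nondegenerate he hy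
  g_phi _ hy := A.chartG_phi he hy
  Gam_symm _ hy := christoffel_symm he nabla hn.torsion_free hy
  metric _ hy := A.fderiv_chartG he hn hy
  parallel_phi _ hy := A.parallel_chartPhi he hF0 hy

/-- On an `F₀`-manifold the Levi-Civita connections of both B-metrics agree. -/
theorem christoffel_assoc [T2Space M] (hn : IsLeviCivita nabla A.metric) (hF0 : A.IsF0 nabla)
    {nablaT : CovariantDerivative 𝓘(ℝ, E) E (TangentSpace 𝓘(ℝ, E) : M → Type _)}
    (hnT : IsLeviCivita nablaT A.assocMetric) {y : E} (hy : y ∈ e.target) :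
    christoffel he nablaT y = christoffel he nabla y := by
  have hp := e.map_target hy
  set D := A.chartData he hn hF0 with hD
  let P : E → E →L[ℝ] E := A.chartPhi e
  let G : E → E →L[ℝ] E →L[ℝ] ℝ := A.chartG e
  -- The associated metric in coordinates, in the form without $\eta$; `hm` shows it is parallel for
  -- $\nabla$ because $g$ and $\varphi$ are.
  let k : E → E →L[ℝ] E →L[ℝ] ℝ := fun z => ((G z).flip.comp (P z)).flip +
    ((G z).comp (P z)).flip.comp (P z) + G z
  have hk_apply : ∀ z u v, k z u v = G z u (P z v) + G z (P z v) (P z u) + G z u v := by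
    intro z u v
    simp [k]
  have hPs := A.contDiffOn_chartPhi he
  have hGs := A.contDiffOn_chartG he
  have hk : ContDiffOn ℝ ∞ k e.target := by
    rw [contDiffOn_clm_apply]
    intro u
    rw [contDiffOn_clm_apply]
    intro v
    simp only [hk_apply]
    have hPv : ∀ v : E, ContDiffOn ℝ ∞ (fun z => P z v) e.target := fun v =>
      hPs.clm_apply contDiffOn_const
    exact (((hGs.clm_apply contDiffOn_const).clm_apply (hPv v)).add
      ((hGs.clm_apply (hPv v)).clm_apply (hPv u))).add
      ((hGs.clm_apply contDiffOn_const).clm_apply contDiffOn_const)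
  have hkh : ∀ y ∈ e.target, ∀ u v, k y u v = A.assocMetric (e.symm y)
      (cotauto e (e.symm y) u) (cotauto e (e.symm y) v) := by
    intro z hz u v
    have hp := e.map_target hz
    rw [hk_apply, assocMetric_eq]
    simp only [G, P, chartG_apply, chartPhi_apply, cotauto_tauto he hp]
    rw [A.g_symm _ (A.phi _ _)]
  have hmT := fderiv_chart_metric he hnT hk hkh hy
  have hm : ∀ u v w, fderiv ℝ k y u v w = k y (christoffel he nabla y u v) w +
      k y v (christoffel he nabla y u w) := by
    intro u v w
    have hkd := ((hk.contDiffAt (e.open_target.mem_nhds hy)).differentiableAt (by simp)).hasFDerivAt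
    have h1 := (hkd.clm_apply (hasFDerivAt_const v y)).clm_apply (hasFDerivAt_const w y)
    have hGd : HasFDerivAt G (fderiv ℝ G y) y := D.hasFDerivAt_g hy
    have hPd : HasFDerivAt P (fderiv ℝ P y) y := D.hasFDerivAt_phi hy
    have hPv : ∀ v : E, HasFDerivAt (fun z => P z v) _ y := fun v =>
      hPd.clm_apply (hasFDerivAt_const v y)
    have h2 := (((hGd.clm_apply (hasFDerivAt_const v y)).clm_apply (hPv w)).add
      ((hGd.clm_apply (hPv w)).clm_apply (hPv v))).add
      ((hGd.clm_apply (hasFDerivAt_const v y)).clm_apply (hasFDerivAt_const w y))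
    have h3 : (fun z => k z v w) = fun z => G z v (P z w) + G z (P z w) (P z v) + G z v w :=
      funext fun z => hk_apply z v w
    rw [h3] at h1
    have h4 := congr($(h1.unique h2) u)
    have hGm : ∀ a b, fderiv ℝ G y u a b = G y (christoffel he nabla y u a) b +
      G y a (christoffel he nabla y u b) := fun a b => A.fderiv_chartG he hn hy u a b
    have hPm : ∀ a, fderiv ℝ P y u a = P y (christoffel he nabla y u a) -
      christoffel he nabla y u (P y a) := fun a => A.parallel_chartPhi he hF0 hy u a
    simp only [add_apply, ContinuousLinearMap.comp_apply, ContinuousLinearMap.flip_apply,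
      zero_apply, map_zero, zero_add, hGm, hPm, map_sub, sub_apply] at h4
    rw [h4, hk_apply, hk_apply]
    ring
  have hks : ∀ u v, k y u v = k y v u := by
    intro u v
    have h1 : G y u (P y v) = G y (P y u) v := ((D.form hy).g_phi_left u v).symm
    rw [hk_apply, hk_apply, h1, A.chartG_symm y (P y u) v, A.chartG_symm y (P y v) (P y u),
      A.chartG_symm y u v]
  refine christoffel_unique hks (fun u hu => ?_)
    (christoffel_symm he nablaT hnT.torsion_free hy) hmT
    (christoffel_symm he nabla hn.torsion_free hy) hm
  have hz : ∀ v, G y u v = A.chartEta e y u * A.chartEta e y v - G y (P y u) (P y v) := by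
    intro v
    have := A.chartG_phi he hy u v
    simp only [G, P]; linarith
  -- Nondegeneracy of the associated metric: testing against $\xi$ gives $\eta(u)=0$, and testing
  -- against $\varphi v$ then leaves $-g(u,v)$.
  have hxi : A.chartEta e y u = 0 := by
    have h1 := hu (rep e A.xi y)
    have h2 : P y (rep e A.xi y) = 0 := D.phi_xi hy
    have h3 := hz (rep e A.xi y)
    rw [hk_apply, h2] at h1
    rw [h2, A.chartEta_xi he hy] at h3
    simp at h1 h3
    linarith
  refine A.chartG_nondegenerate he hy u fun v => ?_
  have h1 := hu (P y v)
  have h2 : G y u (P y (P y v)) = - G y u v := by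
    have h3 : P y (P y v) = -v + A.chartEta e y v • rep e A.xi y := A.chartPhi_sq he hy v
    have h4 := hz (rep e A.xi y)
    have h5 : P y (rep e A.xi y) = 0 := D.phi_xi hy
    rw [h5, hxi] at h4
    rw [h3, map_add, map_smul, h4]
    simp
  have h3 := hz (P y v)
  rw [hk_apply, A.chartG_symm y (P y (P y v)), h3, h2, hxi] at h1
  change -G y u v + G y (P y u) (P y (P y v)) + _ = 0 at h1
  change G y u v = 0
  linarith

end AlmostContactBMetric

end

/-! ### The ambient manifold: form of the curvature and global unique continuation. -/

section


open Filter Set VectorField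

namespace AlmostContactBMetric

variable {E : Type*} [NormedAddCommGroup E] [NormedSpace ℝ E] [FiniteDimensional ℝ E]
  {M : Type*} [TopologicalSpace M] [T2Space M] [ChartedSpace E M] [IsManifold 𝓘(ℝ, E) ∞ M]
  (A : AlmostContactBMetric E M)
  {e : OpenPartialHomeomorph M E} (he : e ∈ IsManifold.maximalAtlas 𝓘(ℝ, E) ∞ M)
  {nabla nablaT : CovariantDerivative 𝓘(ℝ, E) E (TangentSpace 𝓘(ℝ, E) : M → Type _)}

include he in
theorem differentiableAt_christoffel (hn : IsLeviCivita nabla A.metric) {y : E}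
    (hy : y ∈ e.target) : DifferentiableAt ℝ (christoffel he nabla) y :=
  ((A.contDiffOn_christoffel he hn).contDiffAt (e.open_target.mem_nhds hy)).differentiableAt
    (by simp)

/-- The curvature tensor of an `F₀`-manifold of pointwise constant totally real sectional
curvatures. -/
theorem chartCurvature_eq_model (hE : 4 ≤ Module.finrank ℝ E) (hn : IsLeviCivita nabla A.metric)
    (hnT : IsLeviCivita nablaT A.assocMetric) (hF0 : A.IsF0 nabla) {nu nuT : M → ℝ}
    (hnu : A.HasTotallyRealCurvatures nabla nablaT nu nuT) {y : E} (hy : y ∈ e.target)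
    (u v w : E) :
    chartCurvature (christoffel he nabla) y u v w = ((A.chartData he hn hF0).form hy).model
      ⟨nu (e.symm y), -nuT (e.symm y)⟩ u v w := by
  have hp := e.map_target hy
  set D := A.chartData he hn hF0 with hD
  refine ContactBForm.IsCurvature.eq_model hE (D.isCurvature hy) ?_ u v w
  intro a b ha hb h1 h2 h3 h4
  set p := e.symm y with hpdef
  obtain ⟨X, hX, hXp⟩ := exists_smoothField_eq p (cotauto e p a)
  obtain ⟨Y, hY, hYp⟩ := exists_smoothField_eq p (cotauto e p b)
  have hG : ∀ u v, (D.form hy).g u v = A.g p (cotauto e p u) (cotauto e p v) := fun u v => rfl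
  have hP : ∀ u, A.phi p (cotauto e p u) = cotauto e p ((D.form hy).phi u) := fun u =>
    (cotauto_tauto he hp _).symm
  have hGφ : ∀ u v, (D.form hy).g ((D.form hy).phi u) v =
      A.g p (A.phi p (cotauto e p u)) (cotauto e p v) := fun u v => by rw [hG, hP]
  have hη : ∀ u, (D.form hy).eta u = A.eta p (cotauto e p u) := fun u => rfl
  have hξ : ∀ u, A.g p (cotauto e p u) (A.xi p) = (D.form hy).eta u := fun u => by
    rw [← (D.form hy).g_xi, hG]
    congr 1
    exact (cotauto_tauto he hp _).symm
  have hgram : A.gram p (X p) (Y p) =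
      (D.form hy).g a a * (D.form hy).g b b - (D.form hy).g a b ^ 2 := by
    rw [gram, hXp, hYp, hG, hG, hG]
  have h5 : (D.form hy).g ((D.form hy).phi b) a = 0 := by
    rw [(D.form hy).g_phi_left, (D.form hy).g_symm, h2]
  have hreal : A.IsTotallyReal p (Submodule.span ℝ {X p, Y p}) := by
    intro s hs t ht
    obtain ⟨s₁, s₂, rfl⟩ := Submodule.mem_span_pair.1 hs
    obtain ⟨t₁, t₂, rfl⟩ := Submodule.mem_span_pair.1 ht
    rw [hXp, hYp]
    rw [hGφ] at h1 h2 h3 h5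
    simp only [map_add, map_smul, add_apply, smul_apply, h1, h2, h3, h5]
    simp
  have horth : ∀ s ∈ Submodule.span ℝ {X p, Y p}, A.g p s (A.xi p) = 0 := by
    intro s hs
    obtain ⟨s₁, s₂, rfl⟩ := Submodule.mem_span_pair.1 hs
    rw [hXp, hYp]
    simp only [map_add, map_smul, add_apply, smul_apply, hξ, ha, hb]
    simp
  obtain ⟨h6, h7⟩ := hnu X Y hX hY p (by rwa [hgram]) hreal horth
  rw [hgram, div_eq_iff h4] at h6 h7
  have hd := A.differentiableAt_christoffel he hn hy
  -- Equality near $y$, not only at $y$, is needed since the curvature involves derivatives of the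
  -- Christoffel symbols.
  have heq : christoffel he nablaT =ᶠ[𝓝 y] christoffel he nabla := by
    filter_upwards [e.open_target.mem_nhds hy] with z hz using A.christoffel_assoc he hn hF0 hnT hz
  have hyp : e p = y := e.right_inv hy
  have hR := tauto_curvature he nabla hp (by rwa [hyp]) hX hY hY
  have hRT := tauto_curvature he nablaT hp (by rw [hyp]; exact heq.symm.differentiableAt_iff.1 hd)
    hX hY hY
  have hcc : chartCurvature (christoffel he nablaT) y a b b =
      chartCurvature (christoffel he nabla) y a b b := by
    simp only [chartCurvature, heq.fderiv_eq, heq.eq_of_nhds]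
  rw [hyp, hXp, hYp, tauto_cotauto he hp, tauto_cotauto he hp] at hR hRT
  rw [hcc] at hRT
  have hR' : curvature nabla X Y Y p =
      cotauto e p (chartCurvature (christoffel he nabla) y a b b) := by
    rw [← hR, cotauto_tauto he hp]
  have hRT' : curvature nablaT X Y Y p =
      cotauto e p (chartCurvature (christoffel he nabla) y a b b) := by
    rw [← hRT, cotauto_tauto he hp]
  rw [hR', metric, hXp, ← hG] at h6
  -- As $\eta(x)=0$, pairing with $x$ in the associated metric is pairing with $\varphi x$ in $g$.
  -- This turns $\widetilde\nu$ into the second sectional condition.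
  rw [hRT', assocMetric, hXp, ← hη a, ha, mul_zero, add_zero, hP, ← hG] at h7
  exact ⟨h6, h7⟩

include he in
/-- The curvature function is holomorphic in a chart. -/
theorem isHolomorphicOn (hE : 4 ≤ Module.finrank ℝ E) (hn : IsLeviCivita nabla A.metric)
    (hnT : IsLeviCivita nablaT A.assocMetric) (hF0 : A.IsF0 nabla) {nu nuT : M → ℝ}
    (hnu : A.HasTotallyRealCurvatures nabla nablaT nu nuT) :
    IsHolomorphicOn (A.chartPhi e) (fun y => (⟨nu (e.symm y), -nuT (e.symm y)⟩ : ℂ)) e.target :=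
  (A.chartData he hn hF0).isHolomorphicOn_of_eq_model hE fun _ hz u v w =>
    A.chartCurvature_eq_model he hE hn hnT hF0 hnu hz u v w

/-- If the curvature function vanishes, the manifold is flat. -/
theorem isFlat_of_forall_eq_zero (hE : 4 ≤ Module.finrank ℝ E) (hn : IsLeviCivita nabla A.metric)
    (hnT : IsLeviCivita nablaT A.assocMetric) (hF0 : A.IsF0 nabla) {nu nuT : M → ℝ}
    (hnu : A.HasTotallyRealCurvatures nabla nablaT nu nuT)
    (h0 : ∀ p, (⟨nu p, -nuT p⟩ : ℂ) = 0) : IsFlat nabla := by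
  intro X Y Z hX hY hZ p
  have he := IsManifold.chart_mem_maximalAtlas (I := 𝓘(ℝ, E)) (n := ∞) p
  have hp := mem_chart_source E p
  have hy := (chartAt E p).map_source hp
  have h1 := tauto_curvature he nabla hp (A.differentiableAt_christoffel he hn hy) hX hY hZ
  rw [A.chartCurvature_eq_model he hE hn hnT hF0 hnu hy, h0] at h1
  rw [← cotauto_tauto he hp (curvature nabla X Y Z p), h1]
  simp [ContactBForm.model, ContactBForm.J_zero]

/-- Unique continuation for the curvature function. -/
theorem eq_zero_of_eventually_eq_zero [ConnectedSpace M] (hE : 4 ≤ Module.finrank ℝ E)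
    (hn : IsLeviCivita nabla A.metric)
    (hnT : IsLeviCivita nablaT A.assocMetric) (hF0 : A.IsF0 nabla) {nu nuT : M → ℝ}
    (hnu : A.HasTotallyRealCurvatures nabla nablaT nu nuT) {p₀ : M}
    (h0 : ∀ᶠ p in 𝓝 p₀, (⟨nu p, -nuT p⟩ : ℂ) = 0) (p : M) : (⟨nu p, -nuT p⟩ : ℂ) = 0 := by
  set c : M → ℂ := fun p => ⟨nu p, -nuT p⟩
  have hopen : IsOpen {p | ∀ᶠ q in 𝓝 p, c q = 0} := isOpen_setOfPred_eventually_nhds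
  -- The set where $c$ is locally zero is open by definition; unique continuation in a chart makes
  -- it closed.
  have hclosed : IsClosed {p | ∀ᶠ q in 𝓝 p, c q = 0} := by
    refine isClosed_iff_frequently.2 fun p hp => ?_
    have he := IsManifold.chart_mem_maximalAtlas (I := 𝓘(ℝ, E)) (n := ∞) p
    have hps := mem_chart_source E p
    set e := chartAt E p
    have hhol := A.isHolomorphicOn he hE hn hnT hF0 hnu
    have htend : Tendsto e (𝓝 p) (𝓝 (e p)) := e.continuousAt hps
    have h1 : ∃ᶠ z in 𝓝 (e p), ∀ᶠ y in 𝓝 z, c (e.symm y) = 0 := by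
      refine htend.frequently ((hp.and_eventually (e.open_source.mem_nhds hps)).mono ?_)
      rintro q ⟨hq, hqs⟩
      have h2 : Tendsto e.symm (𝓝 (e q)) (𝓝 q) := by
        have := e.continuousAt_symm (e.map_source hqs)
        rwa [ContinuousAt, e.left_inv hqs] at this
      exact h2.eventually hq
    have h2 := hhol.eventually_eq_zero_of_frequently (e.map_source hps) h1
    filter_upwards [htend.eventually h2, e.open_source.mem_nhds hps] with q hq hqs
    rwa [e.left_inv hqs] at hq
  have huniv := IsClopen.eq_univ ⟨hclosed, hopen⟩ ⟨p₀, h0⟩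
  have hmem : p ∈ {p | ∀ᶠ q in 𝓝 p, c q = 0} := by rw [huniv]; trivial
  exact hmem.self_of_nhds

end AlmostContactBMetric

end

/-! ### Linear algebra of ascreen radical screen transversal subspaces. -/

section


open Filter Set VectorField

/-- The linear algebra of an ascreen radical screen transversal half lightlike subspace, the image
of `L`, with radical spanned by `L ζ` and screen space `S`. -/
structure IsAdapted {V V' : Type*} [AddCommGroup V] [Module ℝ V] [AddCommGroup V'] [Module ℝ V']
    (B : ContactBForm V) (L : V' →ₗ[ℝ] V) (S : Submodule ℝ V') (ζ : V') : Prop where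
  g_zeta : ∀ w, B.g (L ζ) (L w) = 0
  g_phi_zeta : ∀ w, B.g (B.phi (L ζ)) (L w) = 0
  normal : ∀ u, (∀ w, B.g u (L w) = 0) → ∃ a b : ℝ, u = a • L ζ + b • B.phi (L ζ)
  eta_ne : B.eta (L ζ) ≠ 0
  eta_screen : ∀ s ∈ S, B.eta (L s) = 0
  exists_ne : ∃ s ∈ S, L s ≠ 0

namespace IsAdapted

variable {V V' : Type*} [AddCommGroup V] [Module ℝ V] [AddCommGroup V'] [Module ℝ V']
  {B : ContactBForm V} {L : V' →ₗ[ℝ] V} {S : Submodule ℝ V'} {ζ : V'} (h : IsAdapted B L S ζ)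

include h

theorem g_phi_phi : B.g (B.phi (L ζ)) (B.phi (L ζ)) = B.eta (L ζ) ^ 2 := by
  rw [B.g_phi, h.g_zeta]; ring

theorem g_phi_self : B.g (L ζ) (B.phi (L ζ)) = 0 := by
  rw [B.g_symm, h.g_phi_zeta]

/-- The tangent space is its own double orthogonal, and its orthogonal is spanned by $\zeta$ and
$\varphi\zeta$. -/
theorem mem_range [FiniteDimensional ℝ V] {u : V} (h1 : B.g u (L ζ) = 0)
    (h2 : B.g u (B.phi (L ζ)) = 0) : ∃ w, u = L w := by
  have hr : LinearMap.BilinForm.IsRefl B.g := fun a b hab => by rw [B.g_symm, hab]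
  have hn : LinearMap.BilinForm.Nondegenerate B.g :=
    ⟨fun a ha => B.g_nondegenerate a ha,
      fun a ha => B.g_nondegenerate a fun b => by rw [B.g_symm, ha]⟩
  have h3 : u ∈ LinearMap.BilinForm.orthogonal B.g
      (LinearMap.BilinForm.orthogonal B.g (LinearMap.range L)) := by
    intro m hm
    obtain ⟨a, b, rfl⟩ := h.normal m fun w => by
      rw [B.g_symm]; exact hm _ ⟨w, rfl⟩
    change B.g _ u = 0
    rw [B.g_symm, map_add, map_smul, map_smul, h1, h2]
    simp
  rw [LinearMap.BilinForm.orthogonal_orthogonal hn hr] at h3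
  obtain ⟨w, hw⟩ := h3
  exact ⟨w, hw.symm⟩

/-- $\varphi s$ is orthogonal to both normal directions: $g(\varphi s,\zeta)=g(s,\varphi\zeta)=0$,
and $g(\varphi s,\varphi\zeta)=0$ because $\eta(s)=0$. -/
theorem phi_screen [FiniteDimensional ℝ V] {s : V'} (hs : s ∈ S) : ∃ w, B.phi (L s) = L w := by
  refine h.mem_range ?_ ?_
  · rw [B.g_phi_left, B.g_symm, h.g_phi_zeta]
  · rw [B.g_phi, h.eta_screen s hs, B.g_symm, h.g_zeta]; simp

/-- A tangent vector orthogonal to the tangent space is a multiple of $\zeta$, since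
$g(\varphi\zeta,\varphi\zeta)=\eta(\zeta)^2\neq0$ excludes a $\varphi\zeta$-component; and
$\eta(\zeta)\neq0$. -/
theorem eq_zero_of_eta {u : V'} (h1 : ∀ w, B.g (L u) (L w) = 0) (h2 : B.eta (L u) = 0) :
    L u = 0 := by
  obtain ⟨a, b, hab⟩ := h.normal _ h1
  have h3 : B.g (L u) (B.phi (L ζ)) = 0 := by rw [B.g_symm, h.g_phi_zeta]
  rw [hab, map_add, map_smul, map_smul, LinearMap.add_apply, LinearMap.smul_apply,
    LinearMap.smul_apply, h.g_phi_phi, h.g_phi_self] at h3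
  have hb : b = 0 := by
    have := pow_ne_zero 2 h.eta_ne
    simpa [this] using h3
  rw [hab, hb] at h2
  have ha : a = 0 := by simpa [h.eta_ne] using h2
  rw [hab, ha, hb]; simp

/-- The vector $as-b\varphi s$ is tangent, orthogonal to the tangent space and killed by $\eta$,
hence zero. Applying $\varphi$ to $as=b\varphi s$ gives $(a^2+b^2)s=0$. -/
theorem eq_zero_of_proportional [FiniteDimensional ℝ V] {s : V'} (hs : s ∈ S) (hs0 : L s ≠ 0)
    {a b : ℝ} (hab : ∀ t, a * B.g (L t) (L s) = b * B.g (L t) (B.phi (L s))) : a = 0 ∧ b = 0 := by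
  obtain ⟨w, hw⟩ := h.phi_screen hs
  have h1 : L (a • s - b • w) = 0 := by
    refine h.eq_zero_of_eta (fun t => ?_) ?_
    · have := hab t
      rw [B.g_symm, map_sub, map_smul, map_smul, ← hw, map_sub, map_smul, map_smul, smul_eq_mul,
        smul_eq_mul, this, sub_self]
    · rw [map_sub, map_smul, map_smul, ← hw, map_sub, map_smul, map_smul, B.eta_phi,
        h.eta_screen s hs]
      simp
  rw [map_sub, map_smul, map_smul, ← hw, sub_eq_zero] at h1
  have h2 := congrArg B.phi h1
  rw [map_smul, map_smul, B.phi_sq, h.eta_screen s hs, zero_smul, add_zero] at h2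
  have h3 : (a ^ 2 + b ^ 2) • L s = 0 := by
    have h4 : (a * a) • L s = a • (b • B.phi (L s)) := by rw [← h1, smul_smul]
    have h5 : a • (b • B.phi (L s)) = -((b * b) • L s) := by
      rw [smul_comm, h2, smul_smul, smul_neg]
    rw [add_smul, pow_two, pow_two, h4, h5, neg_add_cancel]
  have h6 : a ^ 2 + b ^ 2 = 0 := (smul_eq_zero.1 h3).resolve_right hs0
  constructor <;> nlinarith [sq_nonneg a, sq_nonneg b]

/-- For a screen vector $s$ one has $G(\zeta,s)=0$, so the model tensor sends $(\zeta,t,s)$ to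
$cG(t,s)$ acting on $\zeta$. Pairing this vector with $\zeta$ and $\varphi\zeta$ detects the real
and imaginary parts of the scalar, and both pairings vanish if it is tangent. -/
theorem eq_zero_of_model [FiniteDimensional ℝ V] {c : ℂ}
    (hc : ∀ t u w, ∃ r, B.model c (L t) (L u) (L w) = L r) : c = 0 := by
  obtain ⟨s, hs, hs0⟩ := h.exists_ne
  obtain ⟨w, hw⟩ := h.phi_screen hs
  have h1 : ∃ t, B.G (L s) (L t) ≠ 0 := by
    by_contra! hcon
    have h2 : L w = 0 := by
      refine h.eq_zero_of_eta (fun t => ?_) (by rw [← hw, B.eta_phi])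
      have h3 := congrArg Complex.im (hcon t)
      change -B.g (L s) (B.phi (L t)) = 0 at h3
      rw [← hw, B.g_phi_left]; linarith
    have h3 := B.phi_sq (L s)
    rw [hw, h2, map_zero, h.eta_screen s hs, zero_smul, add_zero] at h3
    exact hs0 (neg_eq_zero.1 h3.symm)
  obtain ⟨t, ht⟩ := h1
  obtain ⟨r, hr⟩ := hc ζ t s
  have hG : B.G (L ζ) (L s) = 0 := by
    apply Complex.ext
    · change -B.g (B.phi (L ζ)) (B.phi (L s)) = 0
      rw [hw, h.g_phi_zeta, neg_zero]
    · change -B.g (L ζ) (B.phi (L s)) = 0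
      rw [hw, h.g_zeta, neg_zero]
  rw [ContactBForm.model, hG, mul_zero, B.J_zero, sub_zero, B.J_apply] at hr
  set a := c * B.G (L t) (L s)
  have h2 : a.re = 0 := by
    have h3 := h.g_zeta r
    rw [B.g_symm, ← hr, map_add, map_neg, map_smul, map_smul, LinearMap.add_apply,
      LinearMap.neg_apply, LinearMap.smul_apply, LinearMap.smul_apply, B.g_phi_left, h.g_phi_phi,
      h.g_phi_zeta] at h3
    simpa [h.eta_ne] using h3
  have h3 : a.im = 0 := by
    have h4 := h.g_phi_zeta r
    rw [← hr, h2, zero_smul, neg_zero, zero_add, map_smul, h.g_phi_phi] at h4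
    simpa [h.eta_ne] using h4
  have h4 : a = 0 := Complex.ext h2 h3
  rw [B.G_symm] at ht
  exact (mul_eq_zero.1 h4).resolve_right ht

/-- Transport of the structure by linear equivalences. -/
theorem conj {W W' : Type*} [AddCommGroup W] [Module ℝ W] [AddCommGroup W'] [Module ℝ W']
    {C : ContactBForm W} {K : W' →ₗ[ℝ] W} (τ : V →ₗ[ℝ] W) (σ : V' →ₗ[ℝ] W')
    (hτ : Function.Bijective τ) (hσ : Function.Surjective σ)
    (hK : ∀ v, K (σ v) = τ (L v)) (hg : ∀ u v, C.g (τ u) (τ v) = B.g u v)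
    (hphi : ∀ u, C.phi (τ u) = τ (B.phi u)) (heta : ∀ u, C.eta (τ u) = B.eta u) :
    IsAdapted C K (S.map σ) (σ ζ) where
  g_zeta w := by
    obtain ⟨w, rfl⟩ := hσ w
    rw [hK, hK, hg, h.g_zeta]
  g_phi_zeta w := by
    obtain ⟨w, rfl⟩ := hσ w
    rw [hK, hK, hphi, hg, h.g_phi_zeta]
  normal u hu := by
    obtain ⟨u, rfl⟩ := hτ.2 u
    obtain ⟨a, b, hab⟩ := h.normal u fun w => by rw [← hg, ← hK, hu]
    exact ⟨a, b, by rw [hab, hK, hphi]; simp⟩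
  eta_ne := by rw [hK, heta]; exact h.eta_ne
  eta_screen s hs := by
    obtain ⟨s, hs, rfl⟩ := hs
    rw [hK, heta, h.eta_screen s hs]
  exists_ne := by
    obtain ⟨s, hs, hs0⟩ := h.exists_ne
    exact ⟨σ s, ⟨s, hs, rfl⟩, by rw [hK]; exact fun h0 => hs0 (hτ.1 (by rw [h0, map_zero]))⟩

end IsAdapted

end

/-! ### The adapted structure on the tangent spaces of the submanifold. -/

section


open Filter Set VectorField

/-- The algebraic structure on a tangent space. -/
def AlmostContactBMetric.form {E : Type*} [NormedAddCommGroup E] [NormedSpace ℝ E]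
    {M : Type*} [TopologicalSpace M] [ChartedSpace E M] [IsManifold 𝓘(ℝ, E) ∞ M]
    (A : AlmostContactBMetric E M) (p : M) : ContactBForm (TangentSpace 𝓘(ℝ, E) p) where
  phi := (A.phi p).toLinearMap
  xi := A.xi p
  eta := (A.eta p).toLinearMap
  g := LinearMap.mk₂ ℝ (fun u v => A.g p u v) (by simp) (by simp) (by simp) (by simp)
  phi_sq := A.phi_sq p
  eta_xi := A.eta_xi p
  g_symm := A.g_symm p
  g_nondegenerate := A.g_nondegenerate p
  g_phi := A.g_phi p

section

variable {E : Type*} [NormedAddCommGroup E] [NormedSpace ℝ E]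
  {Mbar : Type*} [TopologicalSpace Mbar] [ChartedSpace E Mbar] [IsManifold 𝓘(ℝ, E) ∞ Mbar]
  {E' : Type*} [NormedAddCommGroup E'] [NormedSpace ℝ E'] [FiniteDimensional ℝ E']
  {M : Type*} [TopologicalSpace M] [ChartedSpace E' M] [IsManifold 𝓘(ℝ, E') ∞ M]
  {A : AlmostContactBMetric E Mbar} {ι : M → Mbar}
  {S : (x : M) → Submodule ℝ (TangentSpace 𝓘(ℝ, E') x)}
  {St : (x : M) → Submodule ℝ (TangentSpace 𝓘(ℝ, E) (ι x))}

omit [FiniteDimensional ℝ E'] in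
theorem ltr_orthogonal_screen {x : M} {N : TangentSpace 𝓘(ℝ, E) (ι x)} (hN : N ∈ ltr A ι S St x) :
    (∀ s ∈ S x, A.g (ι x) N (dmap ι x s) = 0) ∧ ∀ l ∈ St x, A.g (ι x) N l = 0 := by
  refine Submodule.span_induction (p := fun N _ =>
    (∀ s ∈ S x, A.g (ι x) N (dmap ι x s) = 0) ∧ ∀ l ∈ St x, A.g (ι x) N l = 0) ?_ ?_ ?_ ?_ hN
  · rintro N ⟨-, -, h1, h2⟩
    exact ⟨h1, h2⟩
  · exact ⟨fun s _ => by simp, fun l _ => by simp⟩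
  · rintro N N' - - ⟨h1, h2⟩ ⟨h3, h4⟩
    exact ⟨fun s hs => by simp [h1 s hs, h3 s hs], fun l hl => by simp [h2 l hl, h4 l hl]⟩
  · rintro a N - ⟨h1, h2⟩
    exact ⟨fun s hs => by simp [h1 s hs], fun l hl => by simp [h2 l hl]⟩

/-- Writing $\xi=a\zeta+N$ shows $\eta=0$ on the screen. If also $\eta(\zeta)=0$, then $\xi$ would
be normal, a combination of $\zeta$ and $\varphi\zeta$, contradicting $\eta(\xi)=1$. The last clause
says that pairing with $\zeta$ and $\varphi\zeta$ separates the transversal space. -/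
theorem exists_isAdapted (hM : IsHalfLightlike A ι S St) (hRST : IsRSTHL E' A ι St)
    (hasc : IsAscreen A ι S St) (hdim : 4 ≤ Module.finrank ℝ E) (x : M) :
    ∃ ζ, IsAdapted (A.form (ι x)) (dmap ι x).toLinearMap (S x) ζ ∧
      ∀ H ∈ tr A ι S St x, A.g (ι x) H (dmap ι x ζ) = 0 →
        A.g (ι x) H (A.phi (ι x) (dmap ι x ζ)) = 0 → H = 0 := by
  set B := A.form (ι x)
  set L : TangentSpace 𝓘(ℝ, E') x →ₗ[ℝ] TangentSpace 𝓘(ℝ, E) (ι x) := (dmap ι x).toLinearMap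
  have : FiniteDimensional ℝ (TangentSpace 𝓘(ℝ, E') x) := inferInstanceAs (FiniteDimensional ℝ E')
  obtain ⟨⟨ζ, hζ⟩, -, hspan⟩ := finrank_eq_one_iff'.1 (hM.rank_radical x)
  have hrad : ∀ v ∈ radical (E' := E') A ι x, ∃ k : ℝ, v = k • ζ := fun v hv => by
    obtain ⟨k, hk⟩ := hspan ⟨v, hv⟩
    exact ⟨k, (congrArg Subtype.val hk).symm⟩
  have g_zeta : ∀ w, B.g (L ζ) (L w) = 0 := hζ
  have hSt : ∀ k : ℝ, B.phi (L (k • ζ)) ∈ St x := fun k => by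
    rw [← hRST x]
    exact ⟨L (k • ζ), ⟨k • ζ, Submodule.smul_mem _ _ hζ, rfl⟩, rfl⟩
  have hφζ : B.phi (L ζ) ∈ St x := by simpa using hSt 1
  have hSt' : ∀ l ∈ St x, ∃ k : ℝ, l = k • B.phi (L ζ) := by
    intro l hl
    rw [← hRST x] at hl
    obtain ⟨-, ⟨v, hv, rfl⟩, rfl⟩ := hl
    obtain ⟨k, rfl⟩ := hrad v hv
    exact ⟨k, by change B.phi (L (k • ζ)) = _; rw [map_smul, map_smul]⟩
  have hnorm : ∀ u, u ∈ normalSpace (E' := E') A ι x ↔ ∀ w, B.g u (L w) = 0 := fun u => Iff.rfl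
  have g_phi_zeta : ∀ w, B.g (B.phi (L ζ)) (L w) = 0 := by
    rw [← hnorm, ← hM.transversal_sup x]
    exact Submodule.mem_sup_right hφζ
  have normal : ∀ u, (∀ w, B.g u (L w) = 0) → ∃ a b : ℝ, u = a • L ζ + b • B.phi (L ζ) := by
    intro u hu
    rw [← hnorm, ← hM.transversal_sup x] at hu
    obtain ⟨-, ⟨v, hv, rfl⟩, l, hl, rfl⟩ := Submodule.mem_sup.1 hu
    obtain ⟨a, rfl⟩ := hrad v hv
    obtain ⟨b, rfl⟩ := hSt' l hl
    exact ⟨a, b, by change L (a • ζ) + _ = _; rw [map_smul]⟩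
  have hltr : ∀ N ∈ ltr A ι S St x, (∀ s ∈ S x, B.g N (L s) = 0) ∧ B.g N (B.phi (L ζ)) = 0 :=
    fun N hN => ⟨(ltr_orthogonal_screen hN).1, (ltr_orthogonal_screen hN).2 _ hφζ⟩
  have hdec : ∀ w, ∃ k : ℝ, ∃ s ∈ S x, w = k • ζ + s := by
    intro w
    have hw : w ∈ radical (E' := E') A ι x ⊔ S x := by
      rw [(hM.screen_isCompl x).sup_eq_top]; trivial
    obtain ⟨v, hv, s, hs, rfl⟩ := Submodule.mem_sup.1 hw
    obtain ⟨k, rfl⟩ := hrad v hv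
    exact ⟨k, s, hs, rfl⟩
  have horth : ∀ u, B.g u (L ζ) = 0 → (∀ s ∈ S x, B.g u (L s) = 0) → ∀ w, B.g u (L w) = 0 := by
    intro u h1 h2 w
    obtain ⟨k, s, hs, rfl⟩ := hdec w
    rw [map_add, map_smul, map_add, map_smul, h1, h2 s hs, smul_zero, add_zero]
  obtain ⟨a₀, N₀, hN₀, hxi⟩ : ∃ a : ℝ, ∃ N ∈ ltr A ι S St x, B.xi = a • L ζ + N := by
    obtain ⟨-, ⟨v, hv, rfl⟩, N, hN, hsum⟩ := Submodule.mem_sup.1 (hasc x)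
    obtain ⟨a, rfl⟩ := hrad v hv
    exact ⟨a, N, hN, by rw [← map_smul]; exact hsum.symm⟩
  have eta_screen : ∀ s ∈ S x, B.eta (L s) = 0 := by
    intro s hs
    rw [← B.g_xi_left, hxi, map_add, map_smul, LinearMap.add_apply, LinearMap.smul_apply, g_zeta,
      (hltr N₀ hN₀).1 s hs, smul_zero, add_zero]
  have eta_ne : B.eta (L ζ) ≠ 0 := by
    intro h0
    obtain ⟨a, b, hab⟩ := normal B.xi (horth _ (by rw [B.g_xi_left, h0])
      fun s hs => by rw [B.g_xi_left, eta_screen s hs])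
    have h1 := B.eta_xi
    rw [hab, map_add, map_smul, map_smul, h0, B.eta_phi] at h1
    simp at h1
  have exists_ne : ∃ s ∈ S x, L s ≠ 0 := by
    have h1 := Submodule.finrank_add_eq_of_isCompl (hM.screen_isCompl x)
    rw [hM.rank_radical x] at h1
    have h2 : Module.finrank ℝ (TangentSpace 𝓘(ℝ, E') x) = Module.finrank ℝ E' := rfl
    have h3 := hM.codim_two
    have h4 : S x ≠ ⊥ := by
      intro h4
      rw [h4, finrank_bot, h2] at h1
      omega
    obtain ⟨s, hs, hs0⟩ := Submodule.exists_mem_ne_zero_of_ne_bot h4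
    refine ⟨s, hs, fun h5 => hs0 ?_⟩
    have h6 : s ∈ radical (E' := E') A ι x := fun w => by
      change B.g (L s) (L w) = 0
      rw [h5, map_zero, LinearMap.zero_apply]
    exact Submodule.disjoint_def.1 (hM.screen_isCompl x).disjoint s h6 hs
  refine ⟨ζ, ⟨g_zeta, g_phi_zeta, normal, eta_ne, eta_screen, exists_ne⟩, ?_⟩
  have g_phi_phi : B.g (B.phi (L ζ)) (B.phi (L ζ)) = B.eta (L ζ) ^ 2 := by
    rw [B.g_phi, g_zeta]; ring
  have g_phi_self : B.g (L ζ) (B.phi (L ζ)) = 0 := by rw [B.g_symm, g_phi_zeta]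
  set b := B.eta (L ζ) with hb
  have hb2 : b ^ 2 ≠ 0 := pow_ne_zero 2 eta_ne
  -- The explicit lightlike transversal vector: $\xi$ corrected along $\zeta$ to become null and
  -- scaled so that $g(P,\zeta)=1$.
  let P : TangentSpace 𝓘(ℝ, E) (ι x) := b⁻¹ • (B.xi - (2 * b)⁻¹ • L ζ)
  have hPζ : B.g P (L ζ) = 1 := by
    simp only [P, map_smul, map_sub, LinearMap.smul_apply, LinearMap.sub_apply, g_zeta,
      B.g_xi_left, ← hb, smul_eq_mul, mul_zero, sub_zero]
    field_simp
  have hPP : B.g P P = 0 := by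
    have h1 : B.g P B.xi = (2 * b)⁻¹ := by
      rw [B.g_xi]
      simp only [P, map_smul, map_sub, B.eta_xi, ← hb, smul_eq_mul]
      field_simp
      norm_num
    have h2 : ∀ Q, B.g Q P = b⁻¹ * (B.g Q B.xi - (2 * b)⁻¹ * B.g Q (L ζ)) := fun Q => by
      simp only [P, map_smul, map_sub, smul_eq_mul]
    rw [h2, h1, hPζ]
    ring
  have hPS : ∀ s ∈ S x, B.g P (L s) = 0 := by
    intro s hs
    simp only [P, map_smul, map_sub, LinearMap.smul_apply, LinearMap.sub_apply, g_zeta,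
      B.g_xi_left, eta_screen s hs, smul_zero, sub_zero]
  have hPφ : B.g P (B.phi (L ζ)) = 0 := by
    simp only [P, map_smul, map_sub, LinearMap.smul_apply, LinearMap.sub_apply, g_phi_self,
      B.g_xi_left, B.eta_phi, smul_zero, sub_zero]
  have hline : ∀ N ∈ ltr A ι S St x, ∃ k : ℝ, N = k • P := by
    intro N hN
    suffices ltr A ι S St x ≤ Submodule.span ℝ {P} by
      obtain ⟨k, hk⟩ := Submodule.mem_span_singleton.1 (this hN)
      exact ⟨k, hk.symm⟩
    refine Submodule.span_le.2 ?_
    rintro N ⟨⟨ζ', hζ', h1⟩, h2, h3, h4⟩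
    obtain ⟨k', rfl⟩ := hrad ζ' hζ'
    change B.g N (L (k' • ζ)) = 1 at h1
    change B.g N N = 0 at h2
    have h3' : ∀ s ∈ S x, B.g N (L s) = 0 := h3
    have h4' : B.g N (B.phi (L ζ)) = 0 := h4 _ hφζ
    set k := B.g N (L ζ) with hk
    have hk0 : k ≠ 0 := by
      intro h0
      rw [map_smul, map_smul, ← hk, h0] at h1
      simp at h1
    -- $N-kP$ is normal. Pairing with $\varphi\zeta$ removes its $\varphi\zeta$-component, and
    -- nullity of $N$ and $P$ removes the $\zeta$-component.
    obtain ⟨a, c, hac⟩ := normal (N - k • P) (horth _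
      (by rw [map_sub, map_smul, LinearMap.sub_apply, LinearMap.smul_apply, hPζ, ← hk]; simp)
      fun s hs => by
        rw [map_sub, map_smul, LinearMap.sub_apply, LinearMap.smul_apply, h3' s hs, hPS s hs]; simp)
    have hc : c = 0 := by
      have h5 := congrArg (fun u => B.g u (B.phi (L ζ))) hac
      simp only [map_sub, map_add, map_smul, LinearMap.sub_apply, LinearMap.add_apply,
        LinearMap.smul_apply, h4', hPφ, g_phi_self, g_phi_phi, smul_eq_mul, mul_zero, sub_zero,
        zero_add] at h5
      exact (mul_eq_zero.1 h5.symm).resolve_right hb2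
    rw [hc, zero_smul, add_zero, sub_eq_iff_eq_add] at hac
    have ha : a = 0 := by
      have h6 : B.g (L ζ) P = 1 := by rw [B.g_symm, hPζ]
      rw [hac] at h2
      simp only [map_add, map_smul, LinearMap.add_apply, LinearMap.smul_apply, g_zeta, hPP, hPζ, h6,
        smul_eq_mul, mul_zero, mul_one, zero_add, add_zero] at h2
      have h7 : k * a = 0 := by linarith
      exact (mul_eq_zero.1 h7).resolve_left hk0
    rw [hac, ha, zero_smul, zero_add]
    exact Submodule.smul_mem _ _ (Submodule.mem_span_singleton_self P)
  intro H hH h1 h2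
  change B.g H (L ζ) = 0 at h1
  change B.g H (B.phi (L ζ)) = 0 at h2
  obtain ⟨l, hl, N, hN, rfl⟩ := Submodule.mem_sup.1 hH
  obtain ⟨β, rfl⟩ := hSt' l hl
  obtain ⟨k, rfl⟩ := hline N hN
  simp only [map_add, map_smul, LinearMap.add_apply, LinearMap.smul_apply, g_phi_phi, hPφ,
    g_phi_zeta, hPζ, smul_eq_mul, mul_zero, mul_one, zero_add, add_zero] at h1 h2
  rw [h1, (mul_eq_zero.1 h2).resolve_right hb2]
  simp

end

end

/-! ### Straightening the immersion and the Gauss formula in charts. -/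

section


open Filter Set VectorField

namespace AlmostContactBMetric

variable {E : Type*} [NormedAddCommGroup E] [NormedSpace ℝ E] [FiniteDimensional ℝ E]
  {M : Type*} [TopologicalSpace M] [ChartedSpace E M] [IsManifold 𝓘(ℝ, E) ∞ M]
  (A : AlmostContactBMetric E M)
  {e : OpenPartialHomeomorph M E} (he : e ∈ IsManifold.maximalAtlas 𝓘(ℝ, E) ∞ M)

include he

theorem chartG_tauto {p : M} (hp : p ∈ e.source) (u v : TangentSpace 𝓘(ℝ, E) p) :
    A.chartG e (e p) (tauto e p u) (tauto e p v) = A.g p u v := by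
  obtain ⟨y, hy, rfl⟩ : ∃ y ∈ e.target, e.symm y = p := ⟨e p, e.map_source hp, e.left_inv hp⟩
  rw [e.right_inv hy, chartG_apply, cotauto_tauto he hp, cotauto_tauto he hp]

theorem chartPhi_tauto {p : M} (hp : p ∈ e.source) (u : TangentSpace 𝓘(ℝ, E) p) :
    A.chartPhi e (e p) (tauto e p u) = tauto e p (A.phi p u) := by
  obtain ⟨y, hy, rfl⟩ : ∃ y ∈ e.target, e.symm y = p := ⟨e p, e.map_source hp, e.left_inv hp⟩
  rw [e.right_inv hy, chartPhi_apply, cotauto_tauto he hp]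

theorem chartEta_tauto {p : M} (hp : p ∈ e.source) (u : TangentSpace 𝓘(ℝ, E) p) :
    A.chartEta e (e p) (tauto e p u) = A.eta p u := by
  obtain ⟨y, hy, rfl⟩ : ∃ y ∈ e.target, e.symm y = p := ⟨e p, e.map_source hp, e.left_inv hp⟩
  rw [e.right_inv hy, chartEta_apply, cotauto_tauto he hp]

end AlmostContactBMetric

section

variable {E : Type*} [NormedAddCommGroup E] [NormedSpace ℝ E] [FiniteDimensional ℝ E]
  {Mbar : Type*} [TopologicalSpace Mbar] [ChartedSpace E Mbar] [IsManifold 𝓘(ℝ, E) ∞ Mbar]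
  {E' : Type*} [NormedAddCommGroup E'] [NormedSpace ℝ E'] [FiniteDimensional ℝ E']
  {M : Type*} [TopologicalSpace M] [ChartedSpace E' M] [IsManifold 𝓘(ℝ, E') ∞ M]

/-- In the charts `d` and `e`, the map `ι` is the linear map `L`. -/
structure IsStraightening (ι : M → Mbar) (d : OpenPartialHomeomorph M E')
    (e : OpenPartialHomeomorph Mbar E) (L : E' →L[ℝ] E) : Prop where
  mem_dom : d ∈ IsManifold.maximalAtlas 𝓘(ℝ, E') ∞ M
  mem_cod : e ∈ IsManifold.maximalAtlas 𝓘(ℝ, E) ∞ Mbar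
  injective : Function.Injective L
  mapsTo : ∀ x ∈ d.source, ι x ∈ e.source
  eq : ∀ x ∈ d.source, e (ι x) = L (d x)

/-- Local normal form of an immersion, with the complement absorbed into the linear map. -/
theorem exists_isStraightening {ι : M → Mbar}
    (hι : Manifold.IsImmersion 𝓘(ℝ, E') 𝓘(ℝ, E) ∞ ι) (x : M) :
    ∃ (d : OpenPartialHomeomorph M E') (e : OpenPartialHomeomorph Mbar E) (L : E' →L[ℝ] E),
      IsStraightening ι d e L ∧ x ∈ d.source := by
  have h := hι.isImmersionAt x
  refine ⟨h.domChart, h.codChart,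
    h.equiv.toContinuousLinearMap.comp (ContinuousLinearMap.inl ℝ E' h.complement),
    ⟨h.domChart_mem_maximalAtlas, h.codChart_mem_maximalAtlas, ?_, h.source_subset_preimage_source,
      ?_⟩, h.mem_domChart_source⟩
  · intro a b hab
    have h1 := h.equiv.injective hab
    exact congrArg Prod.fst h1
  · intro z hz
    have h0 : h.domChart z ∈ (h.domChart.extend 𝓘(ℝ, E')).target := by
      simpa using h.domChart.map_source hz
    have h1 := h.writtenInCharts h0
    simpa [h.domChart.left_inv hz] using h1

namespace IsStraightening

variable {ι : M → Mbar} {d : OpenPartialHomeomorph M E'} {e : OpenPartialHomeomorph Mbar E}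
  {L : E' →L[ℝ] E} (h : IsStraightening ι d e L)

include h

theorem mem_target {z : E'} (hz : z ∈ d.target) : L z ∈ e.target := by
  have h1 := d.map_target hz
  rw [← d.right_inv hz, ← h.eq _ h1]
  exact e.map_source (h.mapsTo _ h1)

theorem symm_apply {z : E'} (hz : z ∈ d.target) : e.symm (L z) = ι (d.symm z) := by
  have h1 := d.map_target hz
  have h2 := h.eq _ h1
  rw [d.right_inv hz] at h2
  rw [← h2, e.left_inv (h.mapsTo _ h1)]

theorem tauto_dmap {x : M} (hx : x ∈ d.source) (v : TangentSpace 𝓘(ℝ, E') x) :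
    tauto e (ι x) (dmap (E := E) ι x v) = L (tauto d x v) := by
  have hd := (contMDiffAt_chart h.mem_dom hx).mdifferentiableAt (by simp)
  have h1 : HasMFDerivAt 𝓘(ℝ, E') 𝓘(ℝ, E) (L ∘ d) x (L.comp (mfderiv 𝓘(ℝ, E') 𝓘(ℝ, E') d x)) :=
    L.hasFDerivAt.hasMFDerivAt.comp x hd.hasMFDerivAt
  have hsymm := contMDiffAt_chart_symm h.mem_cod (h.mem_target (d.map_source hx))
  have h2 : MDifferentiableAt 𝓘(ℝ, E') 𝓘(ℝ, E) ι x := by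
    refine ((hsymm.mdifferentiableAt (by simp)).comp x
      h1.mdifferentiableAt).congr_of_eventuallyEq ?_
    filter_upwards [d.open_source.mem_nhds hx] with z hz
    simp only [Function.comp_apply]
    rw [h.symm_apply (d.map_source hz), d.left_inv hz]
  have he := (contMDiffAt_chart h.mem_cod (h.mapsTo x hx)).mdifferentiableAt (by simp)
  have h3 := he.hasMFDerivAt.comp x h2.hasMFDerivAt
  have h4 : (e ∘ ι) =ᶠ[𝓝 x] (L ∘ d) := by
    filter_upwards [d.open_source.mem_nhds hx] with z hz using h.eq z hz
  have h5 := hasMFDerivAt_unique h3 (h1.congr_of_eventuallyEq h4)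
  exact DFunLike.congr_fun h5 v

theorem continuousAt {x : M} (hx : x ∈ d.source) : ContinuousAt ι x := by
  have h1 : ContinuousAt (fun z => e.symm (L (d z))) x :=
    ContinuousAt.comp (f := fun z => L (d z))
      (e.continuousAt_symm (h.mem_target (d.map_source hx)))
      (L.continuous.continuousAt.comp (d.continuousAt hx))
  refine h1.congr ?_
  filter_upwards [d.open_source.mem_nhds hx] with z hz
  rw [h.symm_apply (d.map_source hz), d.left_inv hz]

variable [T2Space Mbar] [T2Space M]

/-- The Gauss formula of a totally umbilical submanifold in a chart. -/
theorem gauss (A : AlmostContactBMetric E Mbar)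
    {nabla : CovariantDerivative 𝓘(ℝ, E) E (TangentSpace 𝓘(ℝ, E) : Mbar → Type _)}
    {D : CovariantDerivative 𝓘(ℝ, E') E' (TangentSpace 𝓘(ℝ, E') : M → Type _)}
    {x : M} (hx : x ∈ d.source) {H : TangentSpace 𝓘(ℝ, E) (ι x)}
    (hH : ∀ (Y : (x : M) → TangentSpace 𝓘(ℝ, E') x) (Yb : (p : Mbar) → TangentSpace 𝓘(ℝ, E) p),
        SmoothField Y → SmoothField Yb → ExtendsAt ι Y Yb x →
          ∀ v : TangentSpace 𝓘(ℝ, E') x,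
            gaussDefect nabla D ι Y Yb x v = inducedMetric A ι x v (Y x) • H) (t s : E') :
    christoffel h.mem_cod nabla (L (d x)) (L t) (L s) =
      L (christoffel h.mem_dom D (d x) t s) +
        A.chartG e (L (d x)) (L t) (L s) • tauto e (ι x) H := by
  -- Since the immersion is `L` in these charts, the field constantly $Ls$ extends the field
  -- constantly $s$; both are cut off to become global, and locality of the connections undoes this.
  obtain ⟨Y, hY, hYe⟩ := exists_smoothField_eventually_eq h.mem_dom hx (W := fun _ => s)
    contDiffOn_const
  obtain ⟨Yb, hYb, hYbe⟩ := exists_smoothField_eventually_eq h.mem_cod (h.mapsTo x hx)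
    (W := fun _ => L s) contDiffOn_const
  have hext : ExtendsAt ι Y Yb x := by
    filter_upwards [hYe, (h.continuousAt hx).eventually hYbe, d.open_source.mem_nhds hx]
      with z hz1 hz2 hz
    have h1 := h.tauto_dmap hz (Y z)
    rw [hz1, field, tauto_cotauto h.mem_dom hz] at h1
    rw [hz2, field, ← h1, cotauto_tauto h.mem_cod (h.mapsTo z hz), hz1, field]
  have h1 := hH Y Yb hY hYb hext (cotauto d x t)
  have hv : tauto e (ι x) (dmap (E := E) ι x (cotauto d x t)) = L t := by
    rw [h.tauto_dmap hx, tauto_cotauto h.mem_dom hx]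
  have hYx : tauto d x (Y x) = s := by
    rw [hYe.self_of_nhds, field, tauto_cotauto h.mem_dom hx]
  have hYxb : tauto e (ι x) (dmap (E := E) ι x (Y x)) = L s := by
    rw [h.tauto_dmap hx, hYx]
  have hnD : D Y x = D (field d fun _ => s) x :=
    (D.isCovariantDerivativeOn (s := univ)).congr_of_eventuallyEq
      (hY.contMDiffAt.mdifferentiableAt (by simp))
      (mdifferentiableAt_field h.mem_dom hx (differentiableAt_const s)) univ_mem hYe
  have hn : nabla Yb (ι x) = nabla (field e fun _ => L s) (ι x) :=
    (nabla.isCovariantDerivativeOn (s := univ)).congr_of_eventuallyEq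
      (hYb.contMDiffAt.mdifferentiableAt (by simp))
      (mdifferentiableAt_field h.mem_cod (h.mapsTo x hx) (differentiableAt_const _)) univ_mem hYbe
  have h2 := congrArg (tauto e (ι x)) h1
  rw [gaussDefect, map_sub, h.tauto_dmap hx, hnD, hn,
    tauto_nabla_field h.mem_cod nabla (h.mapsTo x hx) (differentiableAt_const _),
    tauto_nabla_field h.mem_dom D hx (differentiableAt_const _), hv, tauto_cotauto h.mem_dom hx,
    map_smul, inducedMetric, ← A.chartG_tauto h.mem_cod (h.mapsTo x hx), hv, hYxb, h.eq x hx] at h2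
  simp only [fderiv_fun_const, Pi.zero_apply, zero_apply, zero_add] at h2
  rw [← h2]
  abel

end IsStraightening

end

end

/-! ### Vanishing of the second fundamental form and of the curvature function. -/

section


open Filter Set VectorField

section

variable {E : Type*} [NormedAddCommGroup E] [NormedSpace ℝ E] [FiniteDimensional ℝ E]
  {Mbar : Type*} [TopologicalSpace Mbar] [T2Space Mbar]
  [ChartedSpace E Mbar] [IsManifold 𝓘(ℝ, E) ∞ Mbar]
  {E' : Type*} [NormedAddCommGroup E'] [NormedSpace ℝ E'] [FiniteDimensional ℝ E']
  {M : Type*} [TopologicalSpace M] [T2Space M]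
  [ChartedSpace E' M] [IsManifold 𝓘(ℝ, E') ∞ M]
  {A : AlmostContactBMetric E Mbar}
  {nabla : CovariantDerivative 𝓘(ℝ, E) E (TangentSpace 𝓘(ℝ, E) : Mbar → Type _)}
  {D : CovariantDerivative 𝓘(ℝ, E') E' (TangentSpace 𝓘(ℝ, E') : M → Type _)}
  {ι : M → Mbar}
  {S : (x : M) → Submodule ℝ (TangentSpace 𝓘(ℝ, E') x)}
  {St : (x : M) → Submodule ℝ (TangentSpace 𝓘(ℝ, E) (ι x))}
  {d : OpenPartialHomeomorph M E'} {e : OpenPartialHomeomorph Mbar E} {L : E' →L[ℝ] E}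

namespace IsStraightening

omit [T2Space Mbar] [T2Space M] in
theorem exists_leftInverse (h : IsStraightening ι d e L) :
    ∃ π : E →L[ℝ] E', ∀ w, π (L w) = w := by
  obtain ⟨π, hπ⟩ := L.toLinearMap.exists_leftInverse_of_injective
    (LinearMap.ker_eq_bot.2 h.injective)
  exact ⟨LinearMap.toContinuousLinearMap π, fun w => LinearMap.congr_fun hπ w⟩

/-- The adapted structure of a tangent space, in charts. -/
theorem isAdapted (h : IsStraightening ι d e L) (hn : IsLeviCivita nabla A.metric)
    (hF0 : A.IsF0 nabla) {x : M} (hx : x ∈ d.source) {ζ : TangentSpace 𝓘(ℝ, E') x}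
    (hζ : IsAdapted (A.form (ι x)) (dmap ι x).toLinearMap (S x) ζ) :
    IsAdapted ((A.chartData h.mem_cod hn hF0).form (h.mem_target (d.map_source hx)))
      L.toLinearMap ((S x).map (tauto d x).toLinearMap) (tauto d x ζ) := by
  have hp := h.mapsTo x hx
  refine hζ.conj (tauto e (ι x)).toLinearMap (tauto d x).toLinearMap
    (isInvertible_tauto h.mem_cod hp).bijective (isInvertible_tauto h.mem_dom hx).surjective
    (fun v => (h.tauto_dmap hx v).symm) ?_ ?_ ?_
  · intro u v
    have h1 := A.chartG_tauto h.mem_cod hp u v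
    rwa [h.eq x hx] at h1
  · intro u
    have h1 := A.chartPhi_tauto h.mem_cod hp u
    rwa [h.eq x hx] at h1
  · intro u
    have h1 := A.chartEta_tauto h.mem_cod hp u
    rwa [h.eq x hx] at h1

variable (hE : 4 ≤ Module.finrank ℝ E) (hn : IsLeviCivita nabla A.metric)
  (hF0 : A.IsF0 nabla) (hM : IsHalfLightlike A ι S St) (hRST : IsRSTHL E' A ι St)
  (hasc : IsAscreen A ι S St) (humb : IsTotallyUmbilical A nabla ι S St D)
  (h : IsStraightening ι d e L)

include hE hn hF0 hM hRST hasc humb h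

/-- The second fundamental form vanishes. -/
theorem christoffel_map {x : M} (hx : x ∈ d.source) (t s : E') :
    christoffel h.mem_cod nabla (L (d x)) (L t) (L s) =
      L (christoffel h.mem_dom D (d x) t s) := by
  obtain ⟨U, hU, hxU, H, -, hHtr, hH⟩ := humb x
  have hg := h.gauss A hx (H := H x) (fun Y Yb hY hYb hext v => hH Y Yb hY hYb x hxU hext v)
  suffices hH0 : H x = 0 by rw [hg, hH0, map_zero, smul_zero, add_zero]
  obtain ⟨ζ, hζ, hζtr⟩ := exists_isAdapted hM hRST hasc hE x
  have had := h.isAdapted hn hF0 hx hζ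
  set Dt := A.chartData h.mem_cod hn hF0 with hDt
  have hz := d.map_source hx
  have hy := h.mem_target hz
  have hp := h.mapsTo x hx
  set B := Dt.form hy with hB
  obtain ⟨v, hv, hv0⟩ := hζ.exists_ne
  obtain ⟨V, hV, hVS, hVx⟩ := hM.smooth_screen x v hv
  set z := d x with hzdef
  have hVd : DifferentiableAt ℝ (rep d V) z :=
    (contDiffAt_rep h.mem_dom hz hV.contMDiffAt).differentiableAt (by simp)
  have hrep : ∀ {x' : M}, x' ∈ d.source → rep d V (d x') = tauto d x' (V x') := fun {x'} hx' => by
    rw [rep, d.left_inv hx']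
  -- `F` is $\varphi V$ along the submanifold for a screen field $V$. It is tangent at every point,
  -- so in the straightened chart its derivative is tangent too, which is what `hFπ` and `hF2`
  -- encode.
  let F : E' → E := fun w => A.chartPhi e (L w) (L (rep d V w))
  have hF : HasFDerivAt F _ z :=
    ((Dt.hasFDerivAt_phi hy).comp z L.hasFDerivAt).clm_apply
      (L.hasFDerivAt.comp z hVd.hasFDerivAt)
  have hFr : ∀ w ∈ d.target, ∃ r, F w = L r := by
    intro w hw
    obtain ⟨x', hx', rfl⟩ : ∃ x' ∈ d.source, d x' = w :=
      ⟨d.symm w, d.map_target hw, d.right_inv hw⟩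
    obtain ⟨ζ', hζ', -⟩ := exists_isAdapted hM hRST hasc hE x'
    have had' := h.isAdapted hn hF0 hx' hζ'
    obtain ⟨r, hr⟩ := had'.phi_screen (s := rep d V (d x'))
      (by rw [hrep hx']; exact ⟨V x', hVS x', rfl⟩)
    exact ⟨r, hr⟩
  obtain ⟨π, hπ⟩ := h.exists_leftInverse
  have hFπ : F =ᶠ[𝓝 z] fun w => L (π (F w)) := by
    filter_upwards [d.open_target.mem_nhds hz] with w hw
    obtain ⟨r, hr⟩ := hFr w hw
    rw [hr, hπ]
  have hF2 := (hF.congr_of_eventuallyEq hFπ.symm).unique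
    (L.hasFDerivAt.comp z (π.hasFDerivAt.comp z hF))
  have hVz : rep d V z = tauto d x v := by rw [hrep hx, hVx]
  set s₀ := tauto d x v with hs₀
  have hs₀S : s₀ ∈ (S x).map (tauto d x).toLinearMap := ⟨v, hv, rfl⟩
  obtain ⟨w, hw⟩ := had.phi_screen hs₀S
  have hw' : A.chartPhi e (L z) (L s₀) = L w := hw
  set η := tauto e (ι x) (H x) with hη
  set ζ₀ := tauto d x ζ with hζ₀
  have hG : ∀ a b, A.chartG e (L z) a b = B.g a b := fun a b => rfl
  have hP : ∀ a, A.chartPhi e (L z) a = B.phi a := fun a => rfl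
  have hpair : ∀ a, B.g (L a) (L ζ₀) = 0 := fun a => by rw [B.g_symm]; exact had.g_zeta a
  have hpair' : ∀ a, B.g (B.phi (L a)) (L ζ₀) = 0 := fun a => by
    rw [B.g_phi_left, B.g_symm]; exact had.g_phi_zeta a
  -- Expand the derivative of $\varphi V$ by parallelism of $\varphi$ and the Gauss formula, and
  -- pair with $\zeta$. Tangent vectors and their images under $\varphi$ are orthogonal to $\zeta$,
  -- so only the two terms with $H$ (here `η`) remain.
  have key : ∀ t, B.g (B.phi η) (L ζ₀) * B.g (L t) (L s₀) =
      B.g η (L ζ₀) * B.g (L t) (B.phi (L s₀)) := by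
    intro t
    have h1 := congr($hF2 t)
    have hpar : ∀ u v, fderiv ℝ Dt.phi (L z) u v = A.chartPhi e (L z)
      (christoffel h.mem_cod nabla (L z) u v) -
      christoffel h.mem_cod nabla (L z) u (A.chartPhi e (L z) v) := Dt.parallel_phi _ hy
    have hphi : ∀ u, Dt.phi (L z) u = B.phi u := fun u => rfl
    simp only [add_apply, ContinuousLinearMap.comp_apply, ContinuousLinearMap.flip_apply,
      Function.comp_apply, hVz, hpar, hw', hg, hphi] at h1
    have h2 := congrArg (fun u => B.g u (L ζ₀)) h1
    simp only [hP, map_add, map_sub, map_smul, LinearMap.add_apply, LinearMap.sub_apply,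
      LinearMap.smul_apply, hpair, hpair', smul_eq_mul, hG, zero_add] at h2
    have hw2 : B.phi (L s₀) = L w := hw
    rw [hw2]
    linarith
  have hs₀0 : L s₀ ≠ 0 := by
    intro h0
    have h1 : tauto e (ι x) (dmap (E := E) ι x v) = 0 := by rw [h.tauto_dmap hx]; exact h0
    apply hv0
    change dmap (E := E) ι x v = 0
    rw [← cotauto_tauto h.mem_cod hp (dmap (E := E) ι x v), h1, map_zero]
  obtain ⟨h3, h4⟩ := had.eq_zero_of_proportional hs₀S hs₀0 key
  have hζL : L ζ₀ = tauto e (ι x) (dmap (E := E) ι x ζ) := (h.tauto_dmap hx ζ).symm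
  refine hζtr (H x) (hHtr x hxU) ?_ ?_
  · have h5 := A.chartG_tauto h.mem_cod hp (H x) (dmap (E := E) ι x ζ)
    rw [h.eq x hx, ← hζL] at h5
    rw [← h5]
    exact h4
  · have h5 := A.chartG_tauto h.mem_cod hp (H x) (A.phi (ι x) (dmap (E := E) ι x ζ))
    rw [← A.chartPhi_tauto h.mem_cod hp, h.eq x hx, ← hζL] at h5
    rw [← h5]
    have h6 : B.g η (B.phi (L ζ₀)) = 0 := by rw [← B.g_phi_left]; exact h3
    exact h6

theorem christoffel_map_of_mem_target {z : E'} (hz : z ∈ d.target) (t s : E') :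
    christoffel h.mem_cod nabla (L z) (L t) (L s) = L (christoffel h.mem_dom D z t s) := by
  have h1 := christoffel_map hE hn hF0 hM hRST hasc humb h (d.map_target hz) t s
  rwa [d.right_inv hz] at h1

/-- The induced symbols are recovered from the smooth ambient ones by a linear left inverse of `L`,
now that the second fundamental form vanishes. -/
theorem differentiableAt_christoffel {z : E'} (hz : z ∈ d.target) :
    DifferentiableAt ℝ (christoffel h.mem_dom D) z := by
  suffices ContDiffOn ℝ ∞ (christoffel h.mem_dom D) d.target from
    (this.contDiffAt (d.open_target.mem_nhds hz)).differentiableAt (by simp)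
  obtain ⟨π, hπ⟩ := h.exists_leftInverse
  rw [contDiffOn_clm_apply]
  intro t
  rw [contDiffOn_clm_apply]
  intro s
  have h1 : ContDiffOn ℝ ∞ (fun z => christoffel h.mem_cod nabla (L z)) d.target :=
    (A.contDiffOn_christoffel h.mem_cod hn).comp L.contDiff.contDiffOn
      fun z hz => h.mem_target hz
  have h2 : ContDiffOn ℝ ∞ (fun z => π (christoffel h.mem_cod nabla (L z) (L t) (L s))) d.target :=
    π.contDiff.comp_contDiffOn ((h1.clm_apply contDiffOn_const).clm_apply contDiffOn_const)
  refine h2.congr fun z hz => ?_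
  rw [christoffel_map_of_mem_target hE hn hF0 hM hRST hasc humb h hz, hπ]

/-- The submanifold is autoparallel, hence its curvature is that of the ambient manifold. -/
theorem chartCurvature_map {z : E'} (hz : z ∈ d.target) (a b c : E') :
    chartCurvature (christoffel h.mem_cod nabla) (L z) (L a) (L b) (L c) =
      L (chartCurvature (christoffel h.mem_dom D) z a b c) := by
  have hmap := fun {z} (hz : z ∈ d.target) =>
    christoffel_map_of_mem_target hE hn hF0 hM hRST hasc humb h hz
  have h1 := (A.differentiableAt_christoffel h.mem_cod hn (h.mem_target hz)).hasFDerivAt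
  have h2 := (differentiableAt_christoffel hE hn hF0 hM hRST hasc humb h hz).hasFDerivAt
  have hd : ∀ t u s, fderiv ℝ (christoffel h.mem_cod nabla) (L z) (L t) (L u) (L s) =
      L (fderiv ℝ (christoffel h.mem_dom D) z t u s) := by
    intro t u s
    have h3 := ((h1.comp z L.hasFDerivAt).clm_apply (hasFDerivAt_const (L u) z)).clm_apply
      (hasFDerivAt_const (L s) z)
    have h4 := L.hasFDerivAt.comp z ((h2.clm_apply (hasFDerivAt_const u z)).clm_apply
      (hasFDerivAt_const s z))
    have h5 : (fun w => christoffel h.mem_cod nabla (L w) (L u) (L s)) =ᶠ[𝓝 z]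
        fun w => L (christoffel h.mem_dom D w u s) := by
      filter_upwards [d.open_target.mem_nhds hz] with w hw using hmap hw u s
    have h6 := congr($((h3.congr_of_eventuallyEq h5.symm).unique h4) t)
    simpa using h6
  simp only [chartCurvature, hd, hmap hz, map_sub, map_add]

/-- The curvature function vanishes along the submanifold. -/
theorem curvatureFunction_eq_zero
    {nablaT : CovariantDerivative 𝓘(ℝ, E) E (TangentSpace 𝓘(ℝ, E) : Mbar → Type _)}
    (hnT : IsLeviCivita nablaT A.assocMetric) {nu nuT : Mbar → ℝ}
    (hnu : A.HasTotallyRealCurvatures nabla nablaT nu nuT) {x : M} (hx : x ∈ d.source) :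
    (⟨nu (ι x), -nuT (ι x)⟩ : ℂ) = 0 := by
  obtain ⟨ζ, hζ, -⟩ := exists_isAdapted hM hRST hasc hE x
  have had := h.isAdapted hn hF0 hx hζ
  have hz := d.map_source hx
  -- Autoparallelism makes the ambient curvature of tangent vectors tangent, so the model tensor
  -- preserves the tangent space.
  refine had.eq_zero_of_model fun t u w => ⟨chartCurvature (christoffel h.mem_dom D) (d x) t u w, ?_⟩
  have h1 := chartCurvature_map hE hn hF0 hM hRST hasc humb h hz t u w
  rw [A.chartCurvature_eq_model h.mem_cod hE hn hnT hF0 hnu (h.mem_target hz), h.symm_apply hz,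
    d.left_inv hx] at h1
  exact h1

/-- The induced connection is flat at the points of the chart. -/
theorem curvature_induced_eq_zero
    {nablaT : CovariantDerivative 𝓘(ℝ, E) E (TangentSpace 𝓘(ℝ, E) : Mbar → Type _)}
    (hnT : IsLeviCivita nablaT A.assocMetric) {nu nuT : Mbar → ℝ}
    (hnu : A.HasTotallyRealCurvatures nabla nablaT nu nuT) {x : M} (hx : x ∈ d.source)
    {X Y Z : (x : M) → TangentSpace 𝓘(ℝ, E') x} (hX : SmoothField X) (hY : SmoothField Y)
    (hZ : SmoothField Z) : curvature D X Y Z x = 0 := by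
  have hz := d.map_source hx
  have h1 := tauto_curvature h.mem_dom D hx
    (differentiableAt_christoffel hE hn hF0 hM hRST hasc humb h hz) hX hY hZ
  have h2 := chartCurvature_map hE hn hF0 hM hRST hasc humb h hz
    (tauto d x (X x)) (tauto d x (Y x)) (tauto d x (Z x))
  rw [A.chartCurvature_eq_model h.mem_cod hE hn hnT hF0 hnu (h.mem_target hz), h.symm_apply hz,
    d.left_inv hx, curvatureFunction_eq_zero hE hn hF0 hM hRST hasc humb h hnT hnu hx] at h2
  have h3 : chartCurvature (christoffel h.mem_dom D) (d x) (tauto d x (X x)) (tauto d x (Y x))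
      (tauto d x (Z x)) = 0 := h.injective (by
    rw [← h2, map_zero]; simp [ContactBForm.model, ContactBForm.J_zero])
  rw [← cotauto_tauto h.mem_dom hx (curvature D X Y Z x), h1, h3, map_zero]

/-- The curvature function vanishes near the points of the submanifold. -/
theorem eventually_curvatureFunction_eq_zero
    {nablaT : CovariantDerivative 𝓘(ℝ, E) E (TangentSpace 𝓘(ℝ, E) : Mbar → Type _)}
    (hnT : IsLeviCivita nablaT A.assocMetric) {nu nuT : Mbar → ℝ}
    (hnu : A.HasTotallyRealCurvatures nabla nablaT nu nuT) {x : M} (hx : x ∈ d.source) :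
    ∀ᶠ p in 𝓝 (ι x), (⟨nu p, -nuT p⟩ : ℂ) = 0 := by
  have hz := d.map_source hx
  have hy := h.mem_target hz
  have hp := h.mapsTo x hx
  obtain ⟨ζ, hζ, -⟩ := exists_isAdapted hM hRST hasc hE x
  have had := h.isAdapted hn hF0 hx hζ
  set Dt := A.chartData h.mem_cod hn hF0
  have hhol := A.isHolomorphicOn h.mem_cod hE hn hnT hF0 hnu
  have h1 : ∀ᶠ y in 𝓝 (L (d x)), (⟨nu (e.symm y), -nuT (e.symm y)⟩ : ℂ) = 0 := by
    refine hhol.eventually_eq_zero_of_codim_two hM.codim_two (ξ := rep e A.xi) ?_ ?_ h.injective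
      hy ?_ ?_
    · exact (A.contDiffOn_rep_xi h.mem_cod).of_le (WithTop.coe_le_coe.mpr le_top)
    · intro y hy
      have h2 := hhol.eq_I_mul y hy (rep e A.xi y)
      have h3 : A.chartPhi e y (rep e A.xi y) = 0 := Dt.phi_xi hy
      rw [h3, map_zero] at h2
      exact (mul_eq_zero.1 h2.symm).resolve_left Complex.I_ne_zero
    -- $\xi$ is not tangent: $\zeta$ is orthogonal to the tangent space while
    -- $g(\xi,\zeta)=\eta(\zeta)\neq0$.
    · intro v hv
      have h2 := had.g_zeta v
      have h3 : (Dt.form hy).xi = L v := hv.symm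
      rw [(Dt.form hy).g_symm] at h2
      change (Dt.form hy).g (L v) (L (tauto d x ζ)) = 0 at h2
      rw [← h3, (Dt.form hy).g_xi_left] at h2
      exact had.eta_ne h2
    · filter_upwards [d.open_target.mem_nhds hz] with w hw
      rw [h.symm_apply hw]
      exact curvatureFunction_eq_zero hE hn hF0 hM hRST hasc humb h hnT hnu (d.map_target hw)
  have h2 : Tendsto e (𝓝 (ι x)) (𝓝 (L (d x))) := by
    rw [← h.eq x hx]; exact e.continuousAt hp
  filter_upwards [h2.eventually h1, e.open_source.mem_nhds hp] with q hq hqs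
  rwa [e.left_inv hqs] at hq

end IsStraightening

end

end

end BMetric

end

/-! ### Conclusion. -/

theorem corollary4p3 (n : ℕ) (hn : 2 ≤ n)
    {E : Type*} [NormedAddCommGroup E] [NormedSpace ℝ E] [FiniteDimensional ℝ E]
    (hE : Module.finrank ℝ E = 2 * n + 1)
    {Mbar : Type*} [TopologicalSpace Mbar] [T2Space Mbar] [ConnectedSpace Mbar]
    [ChartedSpace E Mbar] [IsManifold 𝓘(ℝ, E) ∞ Mbar]
    {E' : Type*} [NormedAddCommGroup E'] [NormedSpace ℝ E'] [FiniteDimensional ℝ E']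
    {M : Type*} [TopologicalSpace M] [T2Space M] [Nonempty M]
    [ChartedSpace E' M] [IsManifold 𝓘(ℝ, E') ∞ M]
    (A : BMetric.AlmostContactBMetric E Mbar)
    (nabla nablaT : CovariantDerivative 𝓘(ℝ, E) E (TangentSpace 𝓘(ℝ, E) : Mbar → Type _))
    (hnabla : BMetric.IsLeviCivita nabla A.metric)
    (hnablaT : BMetric.IsLeviCivita nablaT A.assocMetric)
    (hF0 : A.IsF0 nabla)
    (nu nuT : Mbar → ℝ)
    (hnu : A.HasTotallyRealCurvatures nabla nablaT nu nuT)
    (ι : M → Mbar)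
    (S : (x : M) → Submodule ℝ (TangentSpace 𝓘(ℝ, E') x))
    (St : (x : M) → Submodule ℝ (TangentSpace 𝓘(ℝ, E) (ι x)))
    (hM : BMetric.IsHalfLightlike A ι S St)
    (hRST : BMetric.IsRSTHL E' A ι St)
    (hasc : BMetric.IsAscreen A ι S St)
    (D : CovariantDerivative 𝓘(ℝ, E') E' (TangentSpace 𝓘(ℝ, E') : M → Type _))
    (hD : BMetric.IsInducedConnection A nabla ι S St D)
    (humb : BMetric.IsTotallyUmbilical A nabla ι S St D) :
    BMetric.IsFlat D ∧ BMetric.IsFlat nabla := by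
  have hE4 : 4 ≤ Module.finrank ℝ E := by omega
  refine ⟨fun X Y Z hX hY hZ x => ?_, ?_⟩
  · obtain ⟨d, e, L, h, hx⟩ := BMetric.exists_isStraightening hM.immersion x
    exact h.curvature_induced_eq_zero hE4 hnabla hF0 hM hRST hasc humb hnablaT hnu hx hX hY hZ
  · obtain ⟨x⟩ := ‹Nonempty M›
    obtain ⟨d, e, L, h, hx⟩ := BMetric.exists_isStraightening hM.immersion x
    exact A.isFlat_of_forall_eq_zero hE4 hnabla hnablaT hF0 hnu
      (A.eq_zero_of_eventually_eq_zero hE4 hnabla hnablaT hF0 hnu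
        (h.eventually_curvatureFunction_eq_zero hE4 hnabla hF0 hM hRST hasc humb hnablaT hnu hx))
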